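/- For an integer $N\ge 10$ let \[ g_N(z)=b_{1/2}(z)^N=\Bigl(\frac{z-\frac12}{1-\frac z2}\Bigr)^N ,\qquad |z|<1, \] and let $\widehat{g_N}(k)$, $k\ge 0$, be its Taylor coefficients, $g_N(z)=\sum_{k\ge0}\widehat{g_N}(k)z^k$. For $p\ge 2$ set \[ u_p(N)=\begin{cases} N^{\frac1p-\frac12}, & 2\le p<4,\\ (\log N)^{\frac14}N^{-\frac14}, & p=4,\\ N^{\frac1{3p}-\frac13}, & p>4.\end{cases} \] Then: (i) for every $N\ge10$, $g_N$ is holomorphic in the unit disc $\mathbb D$ and $\|g_N\|_{H^\infty(\mathbb D)}=\sup_{|z|<1}|g_N(z)|=1$; (ii) for every $N\ge10$, $\min_{|z|=1-1/N}|g_N(z)|\ge e^{-4}$; (iii) there is an absolute constant $\delta>0$ such that $|\widehat{g_N}(k)|\le e^{-\delta k}$ for all $N\ge10$ and all integers $k\ge 4N$; (iv) there is an absolute constant $C>0$ such that $\|\widehat{g_N}\|_\infty=\sup_{k\ge0}|\widehat{g_N}(k)|\le C N^{-1/3}$ for all $N\ge10$; (v) for every real $p$ with $2\le p<\infty$, \[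 \Bigl(\sum_{k\ge0}\min\bigl(|\widehat{g_N}(2k)|^p,|\widehat{g_N}(2k+1)|^p\bigr)\Bigr)^{1/p}\asymp \Bigl(\sum_{k\ge0}|\widehat{g_N}(k)|^p\Bigr)^{1/p}\asymp u_p(N),\qquad N\ge10, \] where both series converge, and $A_N\asymp B_N$ means that $c\,B_N\le A_N\le C\,B_N$ for all integers $N\ge10$ with constants $c,C>0$ depending only on $p$. -/

import Mathlib

open scoped Nat

noncomputable section

/-- The Blaschke factor `b_lam (z) = (z - lam) / (1 - lam z)` with a real parameter `lam`. -/
def blaschke (lam : ℝ) (z : ℂ) : ℂ := (z - (lam : ℂ)) / (1 - (lam : ℂ) * z)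

/-- The function `g_N = b_{1/2} ^ N`. -/
def gFun (N : ℕ) (z : ℂ) : ℂ := blaschke (1 / 2) z ^ N

/-- The `k`-th Taylor coefficient at the origin of `f`. -/
def taylorCoeff (f : ℂ → ℂ) (k : ℕ) : ℂ := iteratedDeriv k f 0 / (k ! : ℂ)

/-- The `ℓ^p` norm, `0 < p < ∞`, of a sequence (meaningful when the series converges). -/
def seqNorm (p : ℝ) (a : ℕ → ℂ) : ℝ := (∑' k, ‖a k‖ ^ p) ^ (1 / p)

/-- The `ℓ^∞` norm of a sequence (meaningful when the sequence is bounded). -/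
def seqSupNorm (a : ℕ → ℂ) : ℝ := ⨆ k, ‖a k‖

/-- The general term `min (|a_{2k}|^p, |a_{2k+1}|^p)` of the paired-minimum sum. -/
def pairedMin (p : ℝ) (a : ℕ → ℂ) (k : ℕ) : ℝ :=
  min (‖a (2 * k)‖ ^ p) (‖a (2 * k + 1)‖ ^ p)

/-- The paired-minimum quantity `(∑_k min (|a_{2k}|^p, |a_{2k+1}|^p))^{1/p}`
(meaningful when the series converges). -/
def pairedNorm (p : ℝ) (a : ℕ → ℂ) : ℝ := (∑' k, pairedMin p a k) ^ (1 / p)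

/-- The comparison function `u_p(N)`, used for `2 ≤ p`. -/
def uFun (p : ℝ) (N : ℕ) : ℝ :=
  if p < 4 then (N : ℝ) ^ (1 / p - 1 / 2)
  else if p = 4 then Real.log N ^ (1 / 4 : ℝ) * (N : ℝ) ^ (-(1 / 4) : ℝ)
  else (N : ℝ) ^ (1 / (3 * p) - 1 / 3)

/-- `f ≍ g` on the integers `N ≥ N₀`: two-sided bounds with positive constants
independent of `N`. -/
def ComparableFrom (N₀ : ℕ) (f g : ℕ → ℝ) : Prop :=
  ∃ c C : ℝ, 0 < c ∧ 0 < C ∧ ∀ N : ℕ, N₀ ≤ N → c * g N ≤ f N ∧ f N ≤ C * g N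

end

/-! The coefficients a_k of g_N are estimated by a discrete WKB argument. Since (z - 1/2)(1 - z/2)
g_N' = (3N/4) g_N, the numbers c_k = k a_k satisfy c_{k+1} + c_{k-1} = x_k c_k with x_k = 5/2 -
3N/(2k). Here |x_k| < 2 exactly for N/3 < k < 3N, so the sequence oscillates there and is of
exponential type outside.

In the oscillatory range E_k = c_k² + c_{k-1}² - x_k c_k c_{k-1} is positive definite, and with r_k
= (4 - x_k²)^{-1/2} the product r_k E_k is an adiabatic invariant. After a first-order correction
its relative increments are O(δ² r⁵) with δ = O(1/N), and they sum to a small number at distance S ≈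
10⁶ N^{1/3} from both edges (`gInv_comparable`). Hence c_k² ≲ G r_k, where G is the invariant at k =
N, and r_k ≲ √(N/d), d being the distance to the edges. Across the remaining strips of width S the
growth is bounded by a Gronwall argument (`rightTransition`, `leftTransition`). Beyond them monotone
quantities control c_k, because c_k → 0 on the right and c_0 = 0 on the left (`recessive_bounds`,
`dominant_bounds`).

Parseval's identity forces G ≍ N (`one_le_gNormal`, `gNormal_le`). So a_k² ≲ (N d)^{-1/2} in the
range and a_k² ≲ N^{-2/3} everywhere. Summing (N d)^{-p/4} over the range gives u_p, the case p = 4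
being the harmonic sum.

For the lower bound, x_k ≈ 2 near the right edge, so neighbouring c_k mostly agree. A virial
identity bounds the mean of c_k c_{k-1} over a block from below by a multiple of the square of the
maximal size (`block_virial`). Therefore the mean of the pairwise minima is of maximal order
(`block_sum_min`), and the power mean inequality passes to exponent p. One block suffices for p ≠ 4;
for p = 4 about log N dyadic blocks contribute equally. The two-sided estimates are proved for N ≥
10⁴⁰, and the finitely many other N only need positivity of the quantities compared.

Parts (i)-(iii) follow from the modulus of the Blaschke factor on circles and from Cauchy's estimate
on |z| = 11/10. -/

/-! ### Taylor coefficients, the differential equation and the three-term recurrence. -/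

theorem taylorCoeff_zero (f : ℂ → ℂ) : taylorCoeff f 0 = f 0 := by
  simp [taylorCoeff]

theorem taylorCoeff_congr {f g : ℂ → ℂ} (h : f =ᶠ[nhds 0] g) (k : ℕ) :
    taylorCoeff f k = taylorCoeff g k := by
  simp only [taylorCoeff, h.iteratedDeriv_eq k]

theorem taylorCoeff_deriv (f : ℂ → ℂ) (k : ℕ) :
    taylorCoeff (deriv f) k = (k + 1) * taylorCoeff f (k + 1) := by
  have h : ((k ! : ℕ) : ℂ) ≠ 0 := by exact_mod_cast Nat.factorial_ne_zero k
  have h2 : (k : ℂ) + 1 ≠ 0 := by exact_mod_cast Nat.succ_ne_zero k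
  simp only [taylorCoeff, iteratedDeriv_succ', Nat.factorial_succ]
  push_cast
  field_simp

theorem taylorCoeff_add {f g : ℂ → ℂ} (hf : AnalyticAt ℂ f 0) (hg : AnalyticAt ℂ g 0) (k : ℕ) :
    taylorCoeff (fun z => f z + g z) k = taylorCoeff f k + taylorCoeff g k := by
  simp only [taylorCoeff]
  rw [iteratedDeriv_fun_add hf.contDiffAt hg.contDiffAt, add_div]

theorem taylorCoeff_const_mul (c : ℂ) (f : ℂ → ℂ) (k : ℕ) :
    taylorCoeff (fun z => c * f z) k = c * taylorCoeff f k := by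
  simp only [taylorCoeff]
  rw [iteratedDeriv_const_mul_field, mul_div_assoc]

theorem taylorCoeff_id_mul_succ {f : ℂ → ℂ} (hf : AnalyticAt ℂ f 0) (k : ℕ) :
    taylorCoeff (fun z => z * f z) (k + 1) = taylorCoeff f k := by
  have h : ((k ! : ℕ) : ℂ) ≠ 0 := by exact_mod_cast Nat.factorial_ne_zero k
  have h2 : (k : ℂ) + 1 ≠ 0 := by exact_mod_cast Nat.succ_ne_zero k
  simp only [taylorCoeff]
  rw [iteratedDeriv_fun_mul (f := fun z : ℂ => z) contDiffAt_id hf.contDiffAt,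
    Finset.sum_eq_single 1]
  · rw [iteratedDeriv_fun_id_zero]
    simp [Nat.factorial_succ]
    field_simp
  · intro i _ hi
    rw [iteratedDeriv_fun_id_zero]
    simp [hi]
  · intro h
    exact absurd (Finset.mem_range.2 (by omega)) h

theorem gFun_den_ne_zero {z : ℂ} (hz : ‖z‖ < 2) : 1 - ((1 / 2 : ℝ) : ℂ) * z ≠ 0 := by
  intro h
  have h1 : ((1 / 2 : ℝ) : ℂ) * z = 1 := (sub_eq_zero.1 h).symm
  have h2 := congrArg norm h1
  rw [norm_mul, Complex.norm_real, norm_one, Real.norm_of_nonneg (by norm_num)] at h2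
  linarith

theorem differentiableAt_blaschke {z : ℂ} (hz : ‖z‖ < 2) :
    DifferentiableAt ℂ (blaschke (1 / 2)) z := by
  unfold blaschke
  exact (by fun_prop : DifferentiableAt ℂ (fun z : ℂ => z - ((1 / 2 : ℝ) : ℂ)) z).div (by fun_prop)
    (gFun_den_ne_zero hz)

theorem differentiableOn_gFun (N : ℕ) : DifferentiableOn ℂ (gFun N) (Metric.ball 0 2) :=
  fun z hz => ((differentiableAt_blaschke (by simpa using hz)).pow N).differentiableWithinAt

theorem analyticAt_gFun (N : ℕ) : AnalyticAt ℂ (gFun N) 0 :=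
  (differentiableOn_gFun N).analyticAt (Metric.ball_mem_nhds 0 (by norm_num))

/-- This is b'/b = (3/4) / ((z - 1/2)(1 - z/2)). The polynomial factor is expanded into nested
multiplications by z, so that each term becomes an index shift of Taylor coefficients. -/
theorem gFun_ode (N : ℕ) {z : ℂ} (hz : ‖z‖ < 2) :
    (-1 / 2) * deriv (gFun N) z + ((5 / 4) * (z * deriv (gFun N) z) +
      (-1 / 2) * (z * (z * deriv (gFun N) z))) = (3 / 4 * N) * gFun N z := by
  have hd := gFun_den_ne_zero hz
  have h1 : HasDerivAt (blaschke (1 / 2))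
      ((1 * (1 - ((1 / 2 : ℝ) : ℂ) * z) - (z - ((1 / 2 : ℝ) : ℂ)) * (-(((1 / 2 : ℝ) : ℂ) * 1))) /
        (1 - ((1 / 2 : ℝ) : ℂ) * z) ^ 2) z :=
    ((hasDerivAt_id z).sub_const _).div (((hasDerivAt_id z).const_mul _).const_sub 1) hd
  have h2 : deriv (gFun N) z = _ := (h1.pow N).deriv
  rw [h2]
  rcases N with _ | n
  · simp
  · simp only [gFun, pow_succ, Nat.add_sub_cancel]
    have : blaschke (1 / 2) z = (z - ((1 / 2 : ℝ) : ℂ)) / (1 - ((1 / 2 : ℝ) : ℂ) * z) := rfl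
    rw [this]
    push_cast at hd ⊢
    set w := ((z - 1 / 2) / (1 - 1 / 2 * z)) ^ n
    have hd2 : 2 - z ≠ 0 := fun h0 => hd (by linear_combination h0 / 2)
    have e1 : 1 - 1 / 2 * z = (2 - z) / 2 := by ring
    rw [e1]
    field_simp
    ring

theorem taylorCoeff_gFun_rec (N k : ℕ) :
    ((k : ℂ) + 2) * taylorCoeff (gFun N) (k + 2) + k * taylorCoeff (gFun N) k =
      (5 / 2 * (k + 1) - 3 / 2 * N) * taylorCoeff (gFun N) (k + 1) := by
  have ha := (analyticAt_gFun N).deriv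
  have hev : (fun z => (-1 / 2) * deriv (gFun N) z + ((5 / 4) * (z * deriv (gFun N) z) +
      (-1 / 2) * (z * (z * deriv (gFun N) z)))) =ᶠ[nhds 0] fun z => (3 / 4 * N) * gFun N z := by
    filter_upwards [Metric.ball_mem_nhds (0 : ℂ) (show (0 : ℝ) < 2 by norm_num)] with z hz
    exact gFun_ode N (by simpa using hz)
  have h := taylorCoeff_congr hev (k + 1)
  have hz : AnalyticAt ℂ (fun z : ℂ => z) 0 := analyticAt_id
  rw [taylorCoeff_add (by fun_prop) (by fun_prop), taylorCoeff_add (by fun_prop) (by fun_prop),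
    taylorCoeff_const_mul, taylorCoeff_const_mul, taylorCoeff_const_mul, taylorCoeff_const_mul,
    taylorCoeff_id_mul_succ ha, taylorCoeff_id_mul_succ (by fun_prop), taylorCoeff_deriv,
    taylorCoeff_deriv] at h
  -- For `k = 0` the doubly shifted term only contributes a constant coefficient, which vanishes.
  rcases k with _ | k
  · rw [taylorCoeff_zero (fun z => z * deriv (gFun N) z)] at h
    push_cast at h ⊢
    linear_combination (-2) * h
  · rw [taylorCoeff_id_mul_succ ha, taylorCoeff_deriv] at h
    push_cast at h ⊢
    linear_combination (-2) * h

theorem taylorCoeff_gFun_zero (N : ℕ) : taylorCoeff (gFun N) 0 = (-1 / 2) ^ N := by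
  simp [taylorCoeff_zero, gFun, blaschke]
  norm_num

theorem taylorCoeff_gFun_one (N : ℕ) :
    taylorCoeff (gFun N) 1 = -(3 / 2 * N) * taylorCoeff (gFun N) 0 := by
  have h := gFun_ode N (z := 0) (by norm_num)
  have h1 := taylorCoeff_deriv (gFun N) 0
  rw [taylorCoeff_zero] at h1
  rw [taylorCoeff_zero (gFun N)]
  simp at h h1
  rw [← h1]
  linear_combination (-2) * h

/-- The (real) Taylor coefficients of `gFun N`. -/
noncomputable def gCoeff (N k : ℕ) : ℝ := (taylorCoeff (gFun N) k).re

theorem taylorCoeff_gFun (N k : ℕ) : taylorCoeff (gFun N) k = (gCoeff N k : ℂ) := by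
  suffices h : ∀ k, (taylorCoeff (gFun N) k).im = 0 by
    apply Complex.ext <;> simp [gCoeff, h]
  intro k
  induction k using Nat.twoStepInduction with
  | zero =>
    rw [taylorCoeff_gFun_zero, show (-1 / 2 : ℂ) ^ N = (((-1 / 2 : ℝ) ^ N : ℝ) : ℂ) by push_cast; rfl]
    exact Complex.ofReal_im _
  | one =>
    rw [taylorCoeff_gFun_one, taylorCoeff_gFun_zero,
      show -(3 / 2 * (N : ℂ)) * (-1 / 2 : ℂ) ^ N =
        ((-(3 / 2 * (N : ℝ)) * (-1 / 2 : ℝ) ^ N : ℝ) : ℂ) by push_cast; rfl]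
    exact Complex.ofReal_im _
  | more n h0 h1 =>
    have h := congrArg Complex.im (taylorCoeff_gFun_rec N n)
    have e1 : ((n : ℂ) + 2) = ((n + 2 : ℝ) : ℂ) := by push_cast; rfl
    have e2 : (5 / 2 * ((n : ℂ) + 1) - 3 / 2 * N) = ((5 / 2 * (n + 1) - 3 / 2 * N : ℝ) : ℂ) := by
      push_cast; rfl
    have e3 : (n : ℂ) = ((n : ℝ) : ℂ) := by push_cast; rfl
    rw [e1, e2, e3, Complex.add_im, Complex.im_ofReal_mul, Complex.im_ofReal_mul,
      Complex.im_ofReal_mul, h0, h1] at h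
    have h3 : (n : ℝ) + 2 ≠ 0 := by positivity
    simpa [h3] using h

theorem gCoeff_rec (N k : ℕ) :
    ((k : ℝ) + 2) * gCoeff N (k + 2) + k * gCoeff N k =
      (5 / 2 * (k + 1) - 3 / 2 * N) * gCoeff N (k + 1) := by
  have h := taylorCoeff_gFun_rec N k
  simp only [taylorCoeff_gFun] at h
  exact Complex.ofReal_injective (by push_cast; exact h)

theorem gCoeff_one (N : ℕ) : gCoeff N 1 = -(3 / 2 * N) * gCoeff N 0 := by
  have h := taylorCoeff_gFun_one N
  simp only [taylorCoeff_gFun] at h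
  exact Complex.ofReal_injective (by push_cast; exact h)

theorem gCoeff_zero_ne_zero (N : ℕ) : gCoeff N 0 ≠ 0 := by
  have h := taylorCoeff_gFun_zero N
  rw [taylorCoeff_gFun] at h
  intro h0
  rw [h0] at h
  have : (-1 / 2 : ℂ) ^ N ≠ 0 := pow_ne_zero _ (by norm_num)
  exact this (by simpa using h.symm)

theorem norm_taylorCoeff_gFun (N k : ℕ) : ‖taylorCoeff (gFun N) k‖ = |gCoeff N k| := by
  rw [taylorCoeff_gFun, Complex.norm_real, Real.norm_eq_abs]

/-! ### Modulus of the Blaschke factor on circles; parts (i)-(iii). -/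

/-- `|1 - z/2|² - |z - 1/2|² = (3/4)(1 - |z|²)`. -/
theorem normSq_den_sub_normSq_num (z : ℂ) :
    ‖1 - ((1 / 2 : ℝ) : ℂ) * z‖ ^ 2 - ‖z - ((1 / 2 : ℝ) : ℂ)‖ ^ 2 = 3 / 4 * (1 - ‖z‖ ^ 2) := by
  simp only [← Complex.normSq_eq_norm_sq, Complex.normSq_apply]
  simp
  ring

theorem norm_blaschke (z : ℂ) :
    ‖blaschke (1 / 2) z‖ = ‖z - ((1 / 2 : ℝ) : ℂ)‖ / ‖1 - ((1 / 2 : ℝ) : ℂ) * z‖ := by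
  rw [blaschke, norm_div]

theorem norm_blaschke_le_one {z : ℂ} (hz : ‖z‖ ≤ 1) : ‖blaschke (1 / 2) z‖ ≤ 1 := by
  rw [norm_blaschke]
  refine div_le_one_of_le₀ ?_ (norm_nonneg _)
  have h := normSq_den_sub_normSq_num z
  refine (abs_le_of_sq_le_sq' ?_ (norm_nonneg _)).2
  nlinarith [norm_nonneg z]

theorem norm_blaschke_eq_one {z : ℂ} (hz : ‖z‖ = 1) : ‖blaschke (1 / 2) z‖ = 1 := by
  have hd := gFun_den_ne_zero (z := z) (by linarith)
  rw [norm_blaschke, div_eq_one_iff_eq (norm_ne_zero_iff.2 hd)]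
  have h := normSq_den_sub_normSq_num z
  rw [hz] at h
  exact (sq_eq_sq₀ (norm_nonneg _) (norm_nonneg _)).1 (by linarith)

theorem norm_den_ge {z : ℂ} : 1 - ‖z‖ / 2 ≤ ‖1 - ((1 / 2 : ℝ) : ℂ) * z‖ := by
  have := norm_sub_norm_le (1 : ℂ) (((1 / 2 : ℝ) : ℂ) * z)
  rw [norm_one, norm_mul, Complex.norm_real, Real.norm_of_nonneg (by norm_num)] at this
  linarith

/-- Lower bound for `|b|` on a circle of radius `r ≤ 1`. -/
theorem norm_blaschke_ge {z : ℂ} (h1 : 1 / 2 ≤ ‖z‖) (h2 : ‖z‖ ≤ 1) :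
    (‖z‖ - 1 / 2) / (1 - ‖z‖ / 2) ≤ ‖blaschke (1 / 2) z‖ := by
  have hd : 0 < 1 - ‖z‖ / 2 := by linarith
  have hge := norm_den_ge (z := z)
  have h := normSq_den_sub_normSq_num z
  rw [norm_blaschke]
  set r := ‖z‖
  set D := ‖1 - ((1 / 2 : ℝ) : ℂ) * z‖
  set A := ‖z - ((1 / 2 : ℝ) : ℂ)‖
  have hA : 0 ≤ A := norm_nonneg _
  have hD : 0 < D := lt_of_lt_of_le hd hge
  rw [div_le_div_iff₀ hd hD]
  refine (abs_le_of_sq_le_sq' ?_ (by positivity)).2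
  -- Eliminating A leaves an expression in D alone, monotone because 1 - r² has a sign. The extremal
  -- value D = 1 - r/2 is attained at z = r.
  have e : (A * (1 - r / 2)) ^ 2 = (D ^ 2 - 3 / 4 * (1 - r ^ 2)) * (1 - r / 2) ^ 2 := by
    rw [← h]; ring
  rw [e]
  have : (1 - r / 2) ^ 2 ≤ D ^ 2 := by gcongr
  have h4 : 0 ≤ 3 / 4 * (1 - r ^ 2) * (D ^ 2 - (1 - r / 2) ^ 2) :=
    mul_nonneg (by nlinarith) (by linarith)
  nlinarith

/-- Upper bound for `|b|` on a circle of radius `1 ≤ r < 2`. -/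
theorem norm_blaschke_le {z : ℂ} (h1 : 1 ≤ ‖z‖) (h2 : ‖z‖ < 2) :
    ‖blaschke (1 / 2) z‖ ≤ (‖z‖ - 1 / 2) / (1 - ‖z‖ / 2) := by
  have hd : 0 < 1 - ‖z‖ / 2 := by linarith
  have hge := norm_den_ge (z := z)
  have h := normSq_den_sub_normSq_num z
  rw [norm_blaschke]
  set r := ‖z‖
  set D := ‖1 - ((1 / 2 : ℝ) : ℂ) * z‖
  set A := ‖z - ((1 / 2 : ℝ) : ℂ)‖
  have hA : 0 ≤ A := norm_nonneg _
  have hD : 0 < D := lt_of_lt_of_le hd hge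
  rw [div_le_div_iff₀ hD hd]
  refine (abs_le_of_sq_le_sq' ?_ (mul_nonneg (by linarith) hD.le)).2
  have e : (A * (1 - r / 2)) ^ 2 = (D ^ 2 - 3 / 4 * (1 - r ^ 2)) * (1 - r / 2) ^ 2 := by
    rw [← h]; ring
  rw [e]
  have : (1 - r / 2) ^ 2 ≤ D ^ 2 := by gcongr
  have h4 : 0 ≤ 3 / 4 * (r ^ 2 - 1) * (D ^ 2 - (1 - r / 2) ^ 2) :=
    mul_nonneg (by nlinarith) (by linarith)
  nlinarith

theorem gFun_isLUB (N : ℕ) :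
    IsLUB ((fun z => ‖gFun N z‖) '' Metric.ball (0 : ℂ) 1) 1 := by
  constructor
  · rintro _ ⟨z, hz, rfl⟩
    simp only [gFun, norm_pow]
    exact pow_le_one₀ (norm_nonneg _) (norm_blaschke_le_one (by simpa using (Metric.mem_ball.1 hz).le))
  · intro c hc
    have hcont : ContinuousAt (fun z => ‖gFun N z‖) 1 :=
      ((differentiableAt_blaschke (z := 1) (by norm_num)).continuousAt.pow N).norm
    have hval : ‖gFun N 1‖ = 1 := by
      rw [gFun, norm_pow, norm_blaschke_eq_one norm_one, one_pow]
    have hlim : Filter.Tendsto (fun n : ℕ => ((1 - 1 / ((n : ℝ) + 1) : ℝ) : ℂ)) Filter.atTop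
        (nhds 1) := by
      have h := (tendsto_const_nhds (x := (1 : ℝ))).sub (tendsto_one_div_add_atTop_nhds_zero_nat (𝕜 := ℝ))
      simpa [Function.comp_def] using (Complex.continuous_ofReal.tendsto _).comp h
    have h := hcont.tendsto.comp hlim
    rw [hval] at h
    refine le_of_tendsto h (Filter.Eventually.of_forall fun n => hc ⟨_, ?_, rfl⟩)
    rw [Metric.mem_ball, dist_zero_right, Complex.norm_real, Real.norm_eq_abs, abs_lt]
    have h1 : 0 < 1 / ((n : ℝ) + 1) := by positivity
    have h2 : 1 / ((n : ℝ) + 1) ≤ 1 := by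
      rw [div_le_one (by positivity)]; linarith [Nat.cast_nonneg (α := ℝ) n]
    constructor <;> linarith

/-- At radius 1 - 1/N the bound for |b| is (N-2)/(N+1) = 1/(1 + 3/(N-2)) ≥ exp(-3/(N-2)), and
3N/(N-2) ≤ 4 once N ≥ 8. -/
theorem gFun_lower_bound {N : ℕ} (hN : 10 ≤ N) {z : ℂ} (hz : ‖z‖ = 1 - 1 / (N : ℝ)) :
    Real.exp (-4) ≤ ‖gFun N z‖ := by
  have hN' : (10 : ℝ) ≤ N := by exact_mod_cast hN
  have h1 : 1 / (N : ℝ) ≤ 1 / 10 := one_div_le_one_div_of_le (by norm_num) hN'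
  have h0 : 0 < 1 / (N : ℝ) := by positivity
  have hb := norm_blaschke_ge (z := z) (by linarith) (by linarith)
  have hq : (‖z‖ - 1 / 2) / (1 - ‖z‖ / 2) = 1 / (1 + 3 / ((N : ℝ) - 2)) := by
    have : (N : ℝ) - 2 ≠ 0 := by linarith
    have : (N : ℝ) + 1 ≠ 0 := by linarith
    rw [hz, div_eq_div_iff (by linarith) (by have : 0 < 3 / ((N : ℝ) - 2) := div_pos (by norm_num) (by linarith)
                                             linarith)]
    field_simp
    ring
  rw [hq] at hb
  have hpos : 0 < 3 / ((N : ℝ) - 2) := div_pos (by norm_num) (by linarith)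
  simp only [gFun, norm_pow]
  calc Real.exp (-4) ≤ Real.exp (-(3 / ((N : ℝ) - 2))) ^ N := by
        rw [← Real.exp_nat_mul]
        apply Real.exp_le_exp.2
        rw [mul_neg, neg_le_neg_iff, mul_div_assoc', div_le_iff₀ (by linarith)]
        linarith
    _ ≤ (1 / (1 + 3 / ((N : ℝ) - 2))) ^ N := by
        gcongr
        rw [Real.exp_neg, ← one_div]
        apply one_div_le_one_div_of_le (by linarith)
        linarith [Real.add_one_le_exp (3 / ((N : ℝ) - 2))]
    _ ≤ _ := by gcongr

/-- Cauchy's estimate on |z| = 11/10, inside the pole at 2; there |b| ≤ (3/5)/(9/20) = 4/3. -/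
theorem norm_taylorCoeff_le (N k : ℕ) :
    ‖taylorCoeff (gFun N) k‖ ≤ (4 / 3) ^ N / (11 / 10) ^ k := by
  have hdc : DiffContOnCl ℂ (gFun N) (Metric.ball 0 (11 / 10)) := by
    refine DifferentiableOn.diffContOnCl_ball (U := Metric.ball 0 2) (differentiableOn_gFun N) ?_
    exact Metric.closedBall_subset_ball (by norm_num)
  have h := Complex.norm_iteratedDeriv_le_of_forall_mem_sphere_norm_le (C := (4 / 3) ^ N) k
    (by norm_num) hdc (by
      intro z hz
      have hz' : ‖z‖ = 11 / 10 := by simpa using hz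
      simp only [gFun, norm_pow]
      gcongr
      refine (norm_blaschke_le (by rw [hz']; norm_num) (by rw [hz']; norm_num)).trans ?_
      rw [hz']; norm_num)
  have hk : (0 : ℝ) < (k ! : ℕ) := by exact_mod_cast Nat.factorial_pos k
  rw [taylorCoeff, norm_div, Complex.norm_natCast, div_le_iff₀ hk]
  refine h.trans (le_of_eq ?_)
  ring

/-- Since (4/3)² ≤ (11/10)⁷ and N ≤ k/4, the factor (4/3)^N costs at most (11/10)^{7k/8}, which
leaves (11/10)^{-k/8}. -/
theorem taylorCoeff_exp_decay {N k : ℕ} (hk : 4 * N ≤ k) :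
    ‖taylorCoeff (gFun N) k‖ ≤ Real.exp (-(Real.log (11 / 10) / 8) * k) := by
  refine (norm_taylorCoeff_le N k).trans ?_
  have hl : 0 < Real.log (11 / 10) := Real.log_pos (by norm_num)
  have hk' : (4 : ℝ) * N ≤ k := by exact_mod_cast hk
  have e1 : ((11 / 10 : ℝ)) ^ k = Real.exp (Real.log (11 / 10) * k) := by
    rw [mul_comm, Real.exp_nat_mul, Real.exp_log (by norm_num)]
  have e2 : ((4 / 3 : ℝ)) ^ N ≤ Real.exp (7 / 2 * Real.log (11 / 10) * N) := by
    rw [mul_comm, Real.exp_nat_mul]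
    gcongr
    have h3 : (4 / 3 : ℝ) ^ 2 ≤ Real.exp (7 / 2 * Real.log (11 / 10)) ^ 2 := by
      rw [← Real.exp_nat_mul, show ((2 : ℕ) : ℝ) * (7 / 2 * Real.log (11 / 10)) =
        ((7 : ℕ) : ℝ) * Real.log (11 / 10) by push_cast; ring, Real.exp_nat_mul,
        Real.exp_log (by norm_num)]
      norm_num
    exact (abs_le_of_sq_le_sq' h3 (by positivity)).2
  calc (4 / 3 : ℝ) ^ N / (11 / 10) ^ k
      ≤ Real.exp (7 / 2 * Real.log (11 / 10) * N) / Real.exp (Real.log (11 / 10) * k) := by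
        rw [e1]; gcongr
    _ = Real.exp (7 / 2 * Real.log (11 / 10) * N - Real.log (11 / 10) * k) := by
        rw [Real.exp_sub]
    _ ≤ _ := by
        apply Real.exp_le_exp.2
        nlinarith

/-! ### Summability, the power series on |z| < 2, and Parseval's identity. -/

theorem summable_abs_gCoeff (N : ℕ) : Summable fun k => |gCoeff N k| := by
  refine Summable.of_nonneg_of_le (fun _ => abs_nonneg _)
    (fun k => (norm_taylorCoeff_gFun N k).symm.le.trans (norm_taylorCoeff_le N k)) ?_
  have : Summable fun k : ℕ => (4 / 3 : ℝ) ^ N * (10 / 11 : ℝ) ^ k :=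
    (summable_geometric_of_lt_one (by norm_num) (by norm_num)).mul_left _
  refine this.congr fun k => ?_
  rw [show (10 / 11 : ℝ) = (11 / 10)⁻¹ by norm_num, inv_pow, ← div_eq_mul_inv]

theorem tendsto_mul_gCoeff (N : ℕ) :
    Filter.Tendsto (fun k : ℕ => (k : ℝ) * gCoeff N k) Filter.atTop (nhds 0) := by
  have h : Filter.Tendsto (fun k : ℕ => (4 / 3 : ℝ) ^ N * ((k : ℝ) * (10 / 11 : ℝ) ^ k))
      Filter.atTop (nhds 0) := by
    simpa using (tendsto_self_mul_const_pow_of_lt_one (r := (10 / 11 : ℝ)) (by norm_num)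
      (by norm_num)).const_mul ((4 / 3 : ℝ) ^ N)
  refine squeeze_zero_norm (fun k => ?_) h
  have := (norm_taylorCoeff_gFun N k).symm.le.trans (norm_taylorCoeff_le N k)
  rw [norm_mul, Real.norm_eq_abs, Real.norm_eq_abs, abs_of_nonneg (Nat.cast_nonneg k)]
  calc (k : ℝ) * |gCoeff N k| ≤ k * ((4 / 3) ^ N / (11 / 10) ^ k) := by gcongr
    _ = _ := by
      rw [div_eq_mul_inv, ← inv_pow, show (11 / 10 : ℝ)⁻¹ = 10 / 11 by norm_num]
      ring

theorem hasSum_gFun (N : ℕ) {z : ℂ} (hz : ‖z‖ < 2) :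
    HasSum (fun k => (gCoeff N k : ℂ) * z ^ k) (gFun N z) := by
  have h := Complex.hasSum_taylorSeries_on_ball (differentiableOn_gFun N) (z := z) (by simpa using hz)
  convert! h using 2 with k
  rw [← taylorCoeff_gFun, taylorCoeff, sub_zero, smul_eq_mul, smul_eq_mul]
  ring

/-- Parseval's identity for `gFun N`. -/
theorem hasSum_gCoeff_sq (N : ℕ) : HasSum (fun k => gCoeff N k ^ 2) 1 := by
  rw [hasSum_iff_tendsto_nat_of_nonneg (fun _ => sq_nonneg _)]
  have hs := summable_abs_gCoeff N
  set τ : ℕ → ℝ := fun n => ∑' k, |gCoeff N (k + n)|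
  have hτ : Filter.Tendsto τ Filter.atTop (nhds 0) := tendsto_sum_nat_add fun k => |gCoeff N k|
  have hτ0 : ∀ n, 0 ≤ τ n := fun n => tsum_nonneg fun _ => abs_nonneg _
  -- Parseval for the Taylor polynomial of g_N: on the unit circle |g_N| = 1, so the modulus of the
  -- polynomial differs from 1 by at most the tail τ n.
  have key : ∀ n, 1 - 2 * τ n ≤ ∑ i ∈ Finset.range n, gCoeff N i ^ 2 ∧
      ∑ i ∈ Finset.range n, gCoeff N i ^ 2 ≤ (1 + τ n) ^ 2 := by
    intro n
    set p : Polynomial ℂ := ∑ i ∈ Finset.range n, Polynomial.monomial i (gCoeff N i : ℂ)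
    have hcoef : ∀ i, p.coeff i = if i < n then (gCoeff N i : ℂ) else 0 := by
      intro i
      simp [p, Polynomial.finsetSum_coeff, Polynomial.coeff_monomial]
    have hsum : ∑ i ∈ p.support, ‖p.coeff i‖ ^ 2 = ∑ i ∈ Finset.range n, gCoeff N i ^ 2 := by
      rw [Finset.sum_subset (s₂ := Finset.range n)]
      · refine Finset.sum_congr rfl fun i hi => ?_
        rw [hcoef, if_pos (Finset.mem_range.1 hi), Complex.norm_real, Real.norm_eq_abs, sq_abs]
      · intro i hi
        by_contra hc
        rw [Polynomial.mem_support_iff, hcoef, if_neg (by simpa using hc)] at hi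
        exact hi rfl
      · intro i _ hi
        rw [Polynomial.notMem_support_iff.1 hi]; simp
    have hav := p.sum_sq_norm_coeff_eq_circleAverage
    rw [hsum] at hav
    have hev : ∀ z : ℂ, p.eval z = ∑ i ∈ Finset.range n, (gCoeff N i : ℂ) * z ^ i := by
      intro z
      simp [p, Polynomial.eval_finsetSum]
    have hclose : ∀ z : ℂ, ‖z‖ = 1 → |‖p.eval z‖ - 1| ≤ τ n := by
      intro z hz
      have h1 := hasSum_gFun N (z := z) (by linarith)
      have h2 : gFun N z - p.eval z = ∑' k, (gCoeff N (k + n) : ℂ) * z ^ (k + n) := by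
        rw [hev, ← h1.tsum_eq, ← h1.summable.sum_add_tsum_nat_add n]
        ring
      have h3 : ‖gFun N z - p.eval z‖ ≤ τ n := by
        rw [h2]
        refine tsum_of_norm_bounded (((summable_nat_add_iff n).2 hs).hasSum) fun k => ?_
        simp [norm_pow, hz]
      have h4 : ‖gFun N z‖ = 1 := by rw [gFun, norm_pow, norm_blaschke_eq_one hz, one_pow]
      rw [← h4, abs_sub_comm]
      exact (abs_norm_sub_norm_le _ _).trans h3
    have hint : CircleIntegrable (fun z : ℂ => ‖p.eval z‖ ^ 2) 0 1 := by
      apply ContinuousOn.circleIntegrable (by norm_num)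
      exact ((p.continuous.norm).pow 2).continuousOn
    constructor
    · rw [hav]
      have hle := Real.circleAverage_mono (f₁ := fun _ => 1 - 2 * τ n) (c := 0) (R := 1)
        (circleIntegrable_const _ _ _) hint (fun z hz => by
          have := abs_le.1 (hclose z (by simpa using hz))
          show 1 - 2 * τ n ≤ ‖p.eval z‖ ^ 2
          nlinarith [hτ0 n])
      simpa [Real.circleAverage_const] using hle
    · rw [hav]
      refine Real.circleAverage_mono_on_of_le_circle hint (fun z hz => ?_)
      have := abs_le.1 (hclose z (by simpa using hz))
      show ‖p.eval z‖ ^ 2 ≤ _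
      have := hτ0 n
      gcongr
      linarith
  have hl : Filter.Tendsto (fun n => 1 - 2 * τ n) Filter.atTop (nhds 1) := by
    simpa using (tendsto_const_nhds (x := (1 : ℝ))).sub (hτ.const_mul 2)
  have hu : Filter.Tendsto (fun n => (1 + τ n) ^ 2) Filter.atTop (nhds 1) := by
    simpa using ((tendsto_const_nhds (x := (1 : ℝ))).add hτ).pow 2
  exact tendsto_of_tendsto_of_tendsto_of_le_of_le hl hu (fun n => (key n).1) (fun n => (key n).2)

/-! ### Algebra of the energy and of its corrected version. -/

/-- The quadratic form `p² + q² - x p q`. -/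
def energy (x p q : ℝ) : ℝ := p ^ 2 + q ^ 2 - x * p * q

theorem energy_comm (x p q : ℝ) : energy x p q = energy x q p := by
  unfold energy; ring

section Energy

variable {x p q r : ℝ}

/-- Completing the square. With x = 2 cos θ and 0 < θ < π the normalization means r = 1/(2 sin θ),
and this identity is the source of all size bounds in terms of the energy. -/
theorem four_mul_energy (hx : r ^ 2 * (4 - x ^ 2) = 1) :
    4 * energy x p q * r ^ 2 = p ^ 2 + r ^ 2 * (x * p - 2 * q) ^ 2 := by
  unfold energy
  linear_combination p ^ 2 * hx

theorem sq_le_energy (hx : r ^ 2 * (4 - x ^ 2) = 1) : p ^ 2 ≤ 4 * energy x p q * r ^ 2 := by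
  rw [four_mul_energy hx]
  nlinarith [sq_nonneg (r * (x * p - 2 * q))]

theorem energy_nonneg (hr : 0 < r) (hx : r ^ 2 * (4 - x ^ 2) = 1) : 0 ≤ energy x p q := by
  have h := sq_le_energy (p := p) (q := q) hx
  have h2 : 0 < r ^ 2 := by positivity
  by_contra hc
  nlinarith [sq_nonneg p]

theorem sq_le_energy' (hx : r ^ 2 * (4 - x ^ 2) = 1) : q ^ 2 ≤ 4 * energy x p q * r ^ 2 := by
  rw [energy_comm]; exact sq_le_energy hx

theorem abs_mul_le_energy (hx : r ^ 2 * (4 - x ^ 2) = 1) :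
    |p * q| ≤ 4 * energy x p q * r ^ 2 := by
  have h1 := sq_le_energy (p := p) (q := q) hx
  have h2 := sq_le_energy' (p := p) (q := q) hx
  rw [abs_le]
  constructor <;> nlinarith [sq_nonneg (p + q), sq_nonneg (p - q)]

theorem abs_cross_le_energy (hr : 0 < r) (hx : r ^ 2 * (4 - x ^ 2) = 1) :
    |p * (x * p - 2 * q)| ≤ 2 * energy x p q * r := by
  have h := four_mul_energy (p := p) (q := q) hx
  rw [← mul_le_mul_iff_right₀ hr, ← abs_of_pos hr, ← abs_mul, abs_of_pos hr, abs_le]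
  constructor <;>
    nlinarith [sq_nonneg (p + r * (x * p - 2 * q)), sq_nonneg (p - r * (x * p - 2 * q))]

theorem abs_cross_le_energy' (hr : 0 < r) (hx : r ^ 2 * (4 - x ^ 2) = 1) :
    |q * (2 * p - x * q)| ≤ 2 * energy x p q * r := by
  rw [energy_comm, ← abs_neg, show -(q * (2 * p - x * q)) = q * (x * q - 2 * p) by ring]
  exact abs_cross_le_energy hr hx

theorem half_le_of_amplitude (hr : 0 < r) (hx : r ^ 2 * (4 - x ^ 2) = 1) : 1 / 2 ≤ r := by
  by_contra hc
  push Not at hc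
  nlinarith [sq_nonneg x, sq_nonneg (r * x)]

end Energy

section Step

variable {x y r s δ δ' p q : ℝ}

/-- Two successive amplitudes are comparable. -/
theorem amplitude_comparable (hr : 0 < r) (hs : 0 < s) (hx : r ^ 2 * (4 - x ^ 2) = 1)
    (hy : s ^ 2 * (4 - y ^ 2) = 1) (hδ : δ = x - y) (hδ0 : 0 ≤ δ) (hδr : δ * r ^ 2 ≤ 1 / 16) :
    4 / 5 * r ≤ s ∧ s ≤ 5 / 4 * r := by
  have hxa : |x| ≤ 2 := by
    refine abs_le_of_sq_le_sq ?_ (by norm_num)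
    by_contra hc
    nlinarith [sq_nonneg r]
  have hya : |y| ≤ 2 := by
    refine abs_le_of_sq_le_sq ?_ (by norm_num)
    by_contra hc
    nlinarith [mul_pos hs hs]
  have hx' := abs_le.1 hxa
  have hy' := abs_le.1 hya
  -- `r² (4 - y²) ∈ [3/4, 5/4]`
  have e : r ^ 2 * (4 - y ^ 2) = 1 + (δ * r ^ 2) * (x + y) := by
    rw [hδ]; linear_combination hx
  have h0 : 0 ≤ δ * r ^ 2 := by positivity
  have l1 : 3 / 4 ≤ r ^ 2 * (4 - y ^ 2) := by rw [e]; nlinarith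
  have l2 : r ^ 2 * (4 - y ^ 2) ≤ 5 / 4 := by rw [e]; nlinarith
  have hs2 : 0 < s ^ 2 := by positivity
  have hr2 : 0 < r ^ 2 := by positivity
  have k1 : 3 / 4 * s ^ 2 ≤ r ^ 2 := by
    have := mul_le_mul_of_nonneg_right l1 hs2.le
    linear_combination this + r ^ 2 * hy
  have k2 : r ^ 2 ≤ 5 / 4 * s ^ 2 := by
    have := mul_le_mul_of_nonneg_right l2 hs2.le
    linear_combination this - r ^ 2 * hy
  constructor
  · refine (abs_le_of_sq_le_sq' ?_ hs.le).2
    nlinarith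
  · refine (abs_le_of_sq_le_sq' ?_ (by positivity)).2
    nlinarith

theorem abs_le_two_of_amplitude (hx : r ^ 2 * (4 - x ^ 2) = 1) : |x| ≤ 2 := by
  refine abs_le_of_sq_le_sq ?_ (by norm_num)
  by_contra hc
  nlinarith [sq_nonneg r]

theorem pow_three_le_of_amplitude (hr : 0 < r) (hx : r ^ 2 * (4 - x ^ 2) = 1) :
    r ^ 3 ≤ 4 * r ^ 5 := by
  have hr2 := half_le_of_amplitude hr hx
  have h : 1 ≤ 4 * r ^ 2 := by nlinarith
  calc r ^ 3 = r ^ 3 * 1 := (mul_one _).symm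
    _ ≤ r ^ 3 * (4 * r ^ 2) := by gcongr
    _ = _ := by ring

/-- First and second order expansion of the amplitude. -/
theorem amplitude_sub_bounds (hr : 0 < r) (hs : 0 < s) (hx : r ^ 2 * (4 - x ^ 2) = 1)
    (hy : s ^ 2 * (4 - y ^ 2) = 1) (hδ : δ = x - y) (hδ0 : 0 ≤ δ) (hδr : δ * r ^ 2 ≤ 1 / 16) :
    |r - s| ≤ 4 * δ * r ^ 3 ∧ |(r - s) - r ^ 3 * δ * x| ≤ 20 * δ ^ 2 * r ^ 5 := by
  obtain ⟨c1, c2⟩ := amplitude_comparable hr hs hx hy hδ hδ0 hδr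
  have hxa := abs_le_two_of_amplitude hx
  have hya := abs_le_two_of_amplitude hy
  have hrs : 0 < r + s := by positivity
  -- difference of amplitudes
  have d1 : (r - s) * (r + s) = δ * (x + y) * (r ^ 2 * s ^ 2) := by
    rw [hδ]; linear_combination s ^ 2 * hx - r ^ 2 * hy
  have hs2 : s ^ 2 ≤ 7 / 8 * r * (r + s) := by nlinarith
  have hxy : |x + y| ≤ 4 := (abs_add_le x y).trans (by linarith)
  have b1 : |r - s| ≤ 4 * δ * r ^ 3 := by
    rw [← mul_le_mul_iff_left₀ hrs, ← abs_of_pos hrs, ← abs_mul, abs_of_pos hrs, d1, abs_mul,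
      abs_mul, abs_of_nonneg hδ0, abs_of_nonneg (by positivity : 0 ≤ r ^ 2 * s ^ 2)]
    calc δ * |x + y| * (r ^ 2 * s ^ 2) ≤ δ * 4 * (r ^ 2 * (7 / 8 * r * (r + s))) := by gcongr
      _ ≤ _ := by
        have : 0 ≤ δ * r ^ 3 * (r + s) := by positivity
        linarith
  refine ⟨b1, ?_⟩
  have b2 : |(r - s) - r ^ 3 * δ * x| ≤ 20 * δ ^ 2 * r ^ 5 := by
    have d2 : ((r - s) - r ^ 3 * δ * x) * (r + s) =
        δ * (x * r ^ 2 * ((s - r) * (2 * s + r)) - δ * (r ^ 2 * s ^ 2)) := by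
      rw [sub_mul, d1, show y = x - δ by rw [hδ]; ring]; ring
    rw [← mul_le_mul_iff_left₀ hrs, ← abs_of_pos hrs, ← abs_mul, abs_of_pos hrs, d2, abs_mul,
      abs_of_nonneg hδ0]
    have t1 : |x * r ^ 2 * ((s - r) * (2 * s + r))| ≤
        2 * r ^ 2 * ((4 * δ * r ^ 3) * (2 * (r + s))) := by
      rw [abs_mul, abs_mul, abs_mul, abs_of_nonneg (sq_nonneg r), abs_sub_comm,
        abs_of_pos (by positivity : 0 < 2 * s + r)]
      gcongr
      linarith
    have t2 : |δ * (r ^ 2 * s ^ 2)| ≤ δ * (r ^ 2 * (7 / 8 * r * (r + s))) := by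
      rw [abs_of_nonneg (by positivity)]
      gcongr
    have t3 : δ * (r ^ 2 * (7 / 8 * r * (r + s))) ≤ 4 * δ * r ^ 5 * (r + s) := by
      have := pow_three_le_of_amplitude hr hx
      have h5 : 0 ≤ δ * (r + s) := by positivity
      have := mul_le_mul_of_nonneg_left this h5
      have h6 : 0 ≤ δ * (r + s) * r ^ 3 := by positivity
      nlinarith
    have t4 := (abs_sub (x * r ^ 2 * ((s - r) * (2 * s + r))) (δ * (r ^ 2 * s ^ 2))).trans
      (add_le_add t1 (t2.trans t3))
    calc _ ≤ δ * (2 * r ^ 2 * ((4 * δ * r ^ 3) * (2 * (r + s))) + 4 * δ * r ^ 5 * (r + s)) := by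
          gcongr
      _ = _ := by ring
  exact b2

/-- The factor r³δ multiplies the correction term, so its variation has to be of second order. This
holds because both r and δ vary slowly. -/
theorem amplitude_cube_sub_le (hr : 0 < r) (hs : 0 < s) (hx : r ^ 2 * (4 - x ^ 2) = 1)
    (hδ0 : 0 ≤ δ) (c2 : s ≤ 5 / 4 * r) (b1 : |r - s| ≤ 4 * δ * r ^ 3)
    (hδ' : |δ - δ'| ≤ 8 * δ ^ 2) :
    |r ^ 3 * δ - s ^ 3 * δ'| ≤ 80 * δ ^ 2 * r ^ 5 := by
  have e : r ^ 3 * δ - s ^ 3 * δ' = (r - s) * (r ^ 2 + r * s + s ^ 2) * δ + s ^ 3 * (δ - δ') := by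
    ring
  have u1 : |(r - s) * (r ^ 2 + r * s + s ^ 2) * δ| ≤ (4 * δ * r ^ 3) * (4 * r ^ 2) * δ := by
    rw [abs_mul, abs_mul, abs_of_nonneg hδ0,
      abs_of_pos (by positivity : 0 < r ^ 2 + r * s + s ^ 2)]
    gcongr
    nlinarith
  have u2 : |s ^ 3 * (δ - δ')| ≤ (5 / 4 * r) ^ 3 * (8 * δ ^ 2) := by
    rw [abs_mul, abs_of_pos (by positivity : 0 < s ^ 3)]
    gcongr
  have u3 : (5 / 4 * r) ^ 3 * (8 * δ ^ 2) ≤ 64 * δ ^ 2 * r ^ 5 := by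
    have := pow_three_le_of_amplitude hr hx
    have h5 : 0 ≤ δ ^ 2 := by positivity
    have := mul_le_mul_of_nonneg_left this h5
    have h6 : 0 ≤ δ ^ 2 * r ^ 3 := by positivity
    nlinarith
  rw [e]
  refine (abs_add_le _ _).trans ((add_le_add u1 (u2.trans u3)).trans (le_of_eq ?_))
  ring

/-- One step of the amplitude-corrected energy of `c_{k+1} + c_{k-1} = x_k c_k`. -/
theorem corrected_energy_step (hr : 0 < r) (hs : 0 < s) (hx : r ^ 2 * (4 - x ^ 2) = 1)
    (hy : s ^ 2 * (4 - y ^ 2) = 1) (hδ : δ = x - y) (hδ0 : 0 ≤ δ) (hδr : δ * r ^ 2 ≤ 1 / 16)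
    (hδ' : |δ - δ'| ≤ 8 * δ ^ 2) :
    |(r * energy x p q - r ^ 3 * δ * (p * (x * p - 2 * q))) -
      (s * energy y p q - s ^ 3 * δ' * (q * (2 * p - y * q)))| ≤
      160 * δ ^ 2 * r ^ 5 * (r * energy x p q + s * energy y p q) := by
  obtain ⟨c1, c2⟩ := amplitude_comparable hr hs hx hy hδ hδ0 hδr
  have hE := energy_nonneg (p := p) (q := q) hr hx
  have hE' := energy_nonneg (p := p) (q := q) hs hy
  have hP := abs_mul_le_energy (p := p) (q := q) hx
  have hq := sq_le_energy' (p := p) (q := q) hx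
  have hQ := abs_cross_le_energy' (p := p) (q := q) hs hy
  have hr2 := half_le_of_amplitude hr hx
  set E := energy x p q with hEdef
  set E' := energy y p q with hE'def
  obtain ⟨b1, b2⟩ := amplitude_sub_bounds hr hs hx hy hδ hδ0 hδr
  have b3 := amplitude_cube_sub_le hr hs hx hδ0 c2 b1 hδ'
  -- To first order r - s ≈ r³δx, and the energy changes by -δpq. Since xE - (4 - x²)pq = p(xp - 2q)
  -- - q(2p - xq), the first-order change of rE is a difference of cross terms, which the correction
  -- removes. The four terms left are each of order δ²r⁵ times an invariant.
  have key : (r * E - r ^ 3 * δ * (p * (x * p - 2 * q))) -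
      (s * E' - s ^ 3 * δ' * (q * (2 * p - y * q))) =
      (r - s) * δ * (p * q) + ((r - s) - r ^ 3 * δ * x) * E + r ^ 3 * δ ^ 2 * q ^ 2 -
        (r ^ 3 * δ - s ^ 3 * δ') * (q * (2 * p - y * q)) := by
    rw [hEdef, hE'def, show y = x - δ by rw [hδ]; ring]
    unfold energy
    linear_combination r * δ * p * q * hx
  rw [key]
  have v1 : |(r - s) * δ * (p * q)| ≤ (4 * δ * r ^ 3) * δ * (4 * E * r ^ 2) := by
    rw [abs_mul, abs_mul, abs_of_nonneg hδ0]
    gcongr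
  have v2 : |((r - s) - r ^ 3 * δ * x) * E| ≤ 20 * δ ^ 2 * r ^ 5 * E := by
    rw [abs_mul, abs_of_nonneg hE]
    gcongr
  have v3 : |r ^ 3 * δ ^ 2 * q ^ 2| ≤ r ^ 3 * δ ^ 2 * (4 * E * r ^ 2) := by
    rw [abs_of_nonneg (by positivity)]
    gcongr
  have v4 : |(r ^ 3 * δ - s ^ 3 * δ') * (q * (2 * p - y * q))| ≤
      80 * δ ^ 2 * r ^ 5 * (2 * E' * s) := by
    rw [abs_mul]
    gcongr
  have htot := (abs_sub _ _).trans (add_le_add ((abs_add_three _ _ _).trans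
    (add_le_add (add_le_add v1 v2) v3)) v4)
  refine htot.trans ?_
  have hrE : E ≤ 2 * (r * E) := by nlinarith
  have h7 : 0 ≤ δ ^ 2 * r ^ 5 := by positivity
  have := mul_le_mul_of_nonneg_left hrE h7
  have h8 : 0 ≤ δ ^ 2 * r ^ 5 * (r * E) := by positivity
  nlinarith

end Step

/-! ### Gronwall comparison and power sums. -/

/-- A discrete Gronwall comparison: small relative increments keep a sequence comparable. -/
theorem comparable_of_small_steps {J ε : ℕ → ℝ} {m n : ℕ} (hmn : m ≤ n)
    (hJ : ∀ k, m ≤ k → k ≤ n → 0 ≤ J k) (hε0 : ∀ k, m < k → k ≤ n → 0 ≤ ε k)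
    (hε1 : ∀ k, m < k → k ≤ n → ε k ≤ 1 / 4)
    (h : ∀ k, m < k → k ≤ n → |J k - J (k - 1)| ≤ ε k * (J k + J (k - 1))) :
    J n ≤ Real.exp (3 * ∑ k ∈ Finset.Ioc m n, ε k) * J m ∧
      J m ≤ Real.exp (3 * ∑ k ∈ Finset.Ioc m n, ε k) * J n := by
  induction n, hmn using Nat.le_induction with
  | base => simp
  | succ n hmn ih =>
    obtain ⟨i1, i2⟩ := ih (fun k h1 h2 => hJ k h1 (by omega)) (fun k h1 h2 => hε0 k h1 (by omega))
      (fun k h1 h2 => hε1 k h1 (by omega)) (fun k h1 h2 => h k h1 (by omega))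
    have hs := h (n + 1) (by omega) le_rfl
    have e0 := hε0 (n + 1) (by omega) le_rfl
    have e1 := hε1 (n + 1) (by omega) le_rfl
    have j0 := hJ n hmn (by omega)
    have j1 := hJ (n + 1) (by omega) le_rfl
    rw [Nat.add_sub_cancel] at hs
    set e := ε (n + 1)
    have hexp : 1 + 3 * e ≤ Real.exp (3 * e) := by linarith [Real.add_one_le_exp (3 * e)]
    have hs' := abs_le.1 hs
    -- The increment gives the ratio (1 + e)/(1 - e), which is at most 1 + 3e for e ≤ 1/3.
    have step1 : J (n + 1) ≤ (1 + 3 * e) * J n := by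
      nlinarith [mul_nonneg e0 j0, mul_nonneg e0 j1, mul_nonneg (mul_nonneg e0 e0) j0]
    have step2 : J n ≤ (1 + 3 * e) * J (n + 1) := by
      nlinarith [mul_nonneg e0 j0, mul_nonneg e0 j1, mul_nonneg (mul_nonneg e0 e0) j1]
    rw [Finset.sum_Ioc_succ_top (by omega), mul_add, Real.exp_add]
    set X := Real.exp (3 * ∑ k ∈ Finset.Ioc m n, ε k)
    have hX : 0 < X := Real.exp_pos _
    constructor
    · calc J (n + 1) ≤ (1 + 3 * e) * J n := step1
        _ ≤ Real.exp (3 * e) * (X * J m) := by gcongr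
        _ = _ := by ring
    · calc J m ≤ X * J n := i2
        _ ≤ X * (Real.exp (3 * e) * J (n + 1)) := by
          gcongr
          exact step2.trans (by gcongr)
        _ = _ := by ring

section PowerSums

/-- Discrete form of bounding a term by the integral of t^{-q} over [n, n+1]; it comes from log(m/n)
≥ 1/m with m = n + 1. -/
theorem rpow_neg_le_telescope {q : ℝ} (hq : 1 < q) {n : ℕ} (hn : 1 ≤ n) :
    ((n + 1 : ℕ) : ℝ) ^ (-q) ≤
      1 / (q - 1) * ((n : ℝ) ^ (1 - q) - ((n + 1 : ℕ) : ℝ) ^ (1 - q)) := by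
  have hn0 : (0 : ℝ) < n := by exact_mod_cast hn
  set m : ℝ := ((n + 1 : ℕ) : ℝ) with hm
  have hmn : m = n + 1 := by rw [hm]; push_cast; ring
  have hm0 : 0 < m := by linarith
  have hq0 : 0 < q - 1 := by linarith
  have h1 : m ^ (-q) = m ^ (1 - q) * (1 / m) := by
    rw [show -q = (1 - q) - 1 by ring, Real.rpow_sub_one hm0.ne']; ring
  have h2 : 1 + (q - 1) / m ≤ (m / n) ^ (q - 1) := by
    have hl : 1 / m ≤ Real.log (m / n) := by
      have := Real.one_sub_inv_le_log_of_pos (div_pos hm0 hn0)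
      rw [inv_div] at this
      refine le_trans (le_of_eq ?_) this
      rw [hmn] at hm0 ⊢
      field_simp; ring
    rw [Real.rpow_def_of_pos (div_pos hm0 hn0)]
    have := Real.add_one_le_exp (Real.log (m / n) * (q - 1))
    have h3 := mul_le_mul_of_nonneg_right hl hq0.le
    have h4 : 1 / m * (q - 1) = (q - 1) / m := by ring
    linarith
  have h3 : (n : ℝ) ^ (1 - q) = m ^ (1 - q) * (m / n) ^ (q - 1) := by
    rw [Real.div_rpow hm0.le hn0.le, show 1 - q = -(q - 1) by ring, Real.rpow_neg hn0.le,
      Real.rpow_neg hm0.le]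
    field_simp
  have h4 : 0 < m ^ (1 - q) := by positivity
  rw [h1, h3, show m ^ (1 - q) * (m / n) ^ (q - 1) - m ^ (1 - q) =
    m ^ (1 - q) * ((m / n) ^ (q - 1) - 1) by ring]
  calc m ^ (1 - q) * (1 / m) = 1 / (q - 1) * (m ^ (1 - q) * ((q - 1) / m)) := by field_simp
    _ ≤ _ := by gcongr; linarith

/-- The subtracted boundary term at M is kept so that the induction closes by telescoping. -/
theorem sum_Icc_rpow_neg_le {q : ℝ} (hq : 1 < q) {S M : ℕ} (hS : 1 ≤ S) (hM : S ≤ M) :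
    ∑ n ∈ Finset.Icc S M, (n : ℝ) ^ (-q) ≤
      q / (q - 1) * (S : ℝ) ^ (1 - q) - 1 / (q - 1) * (M : ℝ) ^ (1 - q) := by
  induction M, hM using Nat.le_induction with
  | base =>
    have hq0 : 0 < q - 1 := by linarith
    have hS1 : (1 : ℝ) ≤ S := by exact_mod_cast hS
    rw [Finset.Icc_self, Finset.sum_singleton, ← sub_mul, ← sub_div, div_self hq0.ne', one_mul]
    exact Real.rpow_le_rpow_of_exponent_le hS1 (by linarith)
  | succ n hn ih =>
    rw [Finset.sum_Icc_succ_top (by omega)]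
    have := rpow_neg_le_telescope hq (le_trans hS hn)
    linarith

/-- Tail of a convergent power sum along an injection. -/
theorem sum_rpow_neg_le {ι : Type*} {q : ℝ} (hq : 1 < q) {S : ℕ} (hS : 1 ≤ S) (F : Finset ι)
    (e : ι → ℕ) (he : Set.InjOn e F) (h : ∀ i ∈ F, S ≤ e i) :
    ∑ i ∈ F, (e i : ℝ) ^ (-q) ≤ q / (q - 1) * (S : ℝ) ^ (1 - q) := by
  classical
  have hq0 : 0 < q - 1 := by linarith
  rw [← Finset.sum_image (f := fun n : ℕ => (n : ℝ) ^ (-q)) he]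
  set M := max S ((F.image e).sup id)
  calc ∑ n ∈ F.image e, (n : ℝ) ^ (-q) ≤ ∑ n ∈ Finset.Icc S M, (n : ℝ) ^ (-q) := by
        refine Finset.sum_le_sum_of_subset_of_nonneg (fun n hn => ?_) fun _ _ _ => by positivity
        have h1 : n ≤ M := (Finset.le_sup (f := id) hn).trans (le_max_right _ _)
        obtain ⟨i, hi, rfl⟩ := Finset.mem_image.1 hn
        exact Finset.mem_Icc.2 ⟨h i hi, h1⟩
    _ ≤ _ := sum_Icc_rpow_neg_le hq hS (le_max_left _ _)
    _ ≤ _ := by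
        have : 0 ≤ 1 / (q - 1) * (M : ℝ) ^ (1 - q) := by positivity
        linarith

/-- Telescoping again; Bernoulli's inequality for the concave power 1 - q replaces the exponential
bound. -/
theorem sum_range_rpow_neg_le {q : ℝ} (hq0 : 0 ≤ q) (hq : q < 1) (M : ℕ) :
    ∑ n ∈ Finset.range M, ((n + 1 : ℕ) : ℝ) ^ (-q) ≤ 1 / (1 - q) * (M : ℝ) ^ (1 - q) := by
  have hq1 : 0 < 1 - q := by linarith
  induction M with
  | zero => simp [Real.zero_rpow hq1.ne']
  | succ n ih =>
    rw [Finset.sum_range_succ]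
    set m : ℝ := ((n + 1 : ℕ) : ℝ) with hm
    have hmn : m = n + 1 := by rw [hm]; push_cast; ring
    have hn0 : (0 : ℝ) ≤ n := Nat.cast_nonneg n
    have hm0 : 0 < m := by linarith
    have h1 : m ^ (-q) = m ^ (1 - q) * (1 / m) := by
      rw [show -q = (1 - q) - 1 by ring, Real.rpow_sub_one hm0.ne']; ring
    have h2 : (n : ℝ) ^ (1 - q) ≤ m ^ (1 - q) * (1 - (1 - q) / m) := by
      have e : (n : ℝ) = m * (1 + -(1 / m)) := by rw [hmn] at hm0 ⊢; field_simp; ring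
      have hle : 1 / m ≤ 1 := by rw [div_le_one hm0]; linarith
      have := rpow_one_add_le_one_add_mul_self (s := -(1 / m)) (by linarith) hq1.le (by linarith)
      rw [e, Real.mul_rpow hm0.le (by linarith)]
      gcongr
      refine this.trans (le_of_eq ?_)
      ring
    have h3 : m ^ (-q) = 1 / (1 - q) * (m ^ (1 - q) * ((1 - q) / m)) := by
      rw [h1]; field_simp
    have h4 : 1 / (1 - q) * (n : ℝ) ^ (1 - q) ≤
        1 / (1 - q) * (m ^ (1 - q) * (1 - (1 - q) / m)) := by gcongr
    rw [mul_sub, mul_one] at h4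
    nlinarith

/-- Power sums with exponent below one along an injection into `[1, M]`. -/
theorem sum_rpow_neg_le_of_lt_one {ι : Type*} {q : ℝ} (hq0 : 0 ≤ q) (hq : q < 1) {M : ℕ}
    (F : Finset ι) (e : ι → ℕ) (he : Set.InjOn e F) (h : ∀ i ∈ F, 1 ≤ e i ∧ e i ≤ M) :
    ∑ i ∈ F, (e i : ℝ) ^ (-q) ≤ 1 / (1 - q) * (M : ℝ) ^ (1 - q) := by
  classical
  rw [← Finset.sum_image (f := fun n : ℕ => (n : ℝ) ^ (-q)) he]
  refine le_trans ?_ (sum_range_rpow_neg_le hq0 hq M)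
  rw [← Finset.sum_image (s := Finset.range M) (g := fun n => n + 1)
    (f := fun n : ℕ => (n : ℝ) ^ (-q)) (by simp)]
  refine Finset.sum_le_sum_of_subset_of_nonneg (fun n hn => ?_) fun _ _ _ => by positivity
  obtain ⟨i, hi, rfl⟩ := Finset.mem_image.1 hn
  have := h i hi
  exact Finset.mem_image.2 ⟨e i - 1, Finset.mem_range.2 (by omega), by omega⟩

/-- Harmonic sums along an injection into `[1, M]`. -/
theorem sum_inv_le_log {ι : Type*} {M : ℕ} (F : Finset ι) (e : ι → ℕ) (he : Set.InjOn e F)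
    (h : ∀ i ∈ F, 1 ≤ e i ∧ e i ≤ M) :
    ∑ i ∈ F, (e i : ℝ)⁻¹ ≤ 1 + Real.log M := by
  classical
  rw [← Finset.sum_image (f := fun n : ℕ => (n : ℝ)⁻¹) he]
  refine le_trans ?_ (harmonic_le_one_add_log M)
  rw [harmonic_eq_sum_Icc]
  push_cast
  refine Finset.sum_le_sum_of_subset_of_nonneg (fun n hn => ?_) fun _ _ _ => by positivity
  obtain ⟨i, hi, rfl⟩ := Finset.mem_image.1 hn
  exact Finset.mem_Icc.2 (h i hi)

end PowerSums

/-! ### The weighted sequence, its recurrence and its oscillatory range. -/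

/-- The sequence `k a_k`, which satisfies a three-term recurrence. -/
noncomputable def gWeighted (N k : ℕ) : ℝ := k * gCoeff N k

/-- The coefficient of the three-term recurrence of `gWeighted`. -/
noncomputable def gDiag (N k : ℕ) : ℝ := 5 / 2 - 3 * N / (2 * k)

theorem gWeighted_zero (N : ℕ) : gWeighted N 0 = 0 := by simp [gWeighted]

theorem gWeighted_rec (N k : ℕ) :
    gWeighted N (k + 2) + gWeighted N k = gDiag N (k + 1) * gWeighted N (k + 1) := by
  have h := gCoeff_rec N k
  have h1 : ((k : ℝ) + 1) ≠ 0 := by positivity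
  unfold gWeighted gDiag
  push_cast
  rw [h]
  field_simp

theorem gWeighted_rec' {N k : ℕ} (hk : 1 ≤ k) :
    gWeighted N (k + 1) = gDiag N k * gWeighted N k - gWeighted N (k - 1) := by
  obtain ⟨j, rfl⟩ := Nat.exists_eq_add_of_le' hk
  rw [Nat.add_sub_cancel]
  linarith [gWeighted_rec N j]

/-- The amplitude factor `(4 - x_k²)^{-1/2}`. -/
noncomputable def gAmp (N k : ℕ) : ℝ := (√(4 - gDiag N k ^ 2))⁻¹

/-- The increment of the recurrence coefficient. -/
noncomputable def gStep (N k : ℕ) : ℝ := gDiag N k - gDiag N (k - 1)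

/-- The energy at `k` of the recurrence of `gWeighted`. -/
noncomputable def gEnergy (N k : ℕ) : ℝ := energy (gDiag N k) (gWeighted N k) (gWeighted N (k - 1))

/-- The adiabatic invariant: energy times amplitude factor. -/
noncomputable def gInv (N k : ℕ) : ℝ := gAmp N k * gEnergy N k

/-- `S` is a large multiple of `N^{1/3}` and a small multiple of `N`. -/
structure EdgeScale (N S : ℕ) : Prop where
  cube_ge : (10 : ℝ) ^ 18 * N ≤ (S : ℝ) ^ 3
  cube_le : (S : ℝ) ^ 3 ≤ 10 ^ 19 * N
  le : (10 : ℝ) ^ 6 * S ≤ N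
  pos : 0 < N

/-- The oscillatory range of indices, at distance at least `S` from both edges. -/
structure InZone (N S k : ℕ) : Prop where
  left : N + S ≤ 3 * k
  right : k + S ≤ 3 * N

section Zone

variable {N S k : ℕ}

theorem EdgeScale.posR (h : EdgeScale N S) : (0 : ℝ) < N := by exact_mod_cast h.pos

theorem EdgeScale.posS (h : EdgeScale N S) : (0 : ℝ) < S := by
  have h1 := h.cube_ge
  have h2 := h.posR
  by_contra hc
  have : (S : ℝ) = 0 := le_antisymm (not_lt.1 hc) (Nat.cast_nonneg S)
  rw [this] at h1
  norm_num at h1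
  linarith

theorem EdgeScale.large (h : EdgeScale N S) : (10 : ℝ) ^ 6 ≤ S := by
  have h1 := h.cube_ge
  have h2 := h.le
  have h3 := h.posS
  by_contra hc
  push Not at hc
  have : (S : ℝ) ^ 2 < (10 ^ 6) ^ 2 := by gcongr
  nlinarith

theorem InZone.leftR (hz : InZone N S k) : (N : ℝ) + S ≤ 3 * k := by exact_mod_cast hz.left

theorem InZone.rightR (hz : InZone N S k) : (k : ℝ) + S ≤ 3 * N := by exact_mod_cast hz.right

/-- The factorization locates the turning points k = N/3, where x = -2, and k = 3N, where x = 2. -/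
theorem four_sub_gDiag_sq (hk : 0 < k) :
    4 - gDiag N k ^ 2 = 3 * (3 * N - k) * (3 * k - N) / (4 * (k : ℝ) ^ 2) := by
  have : (k : ℝ) ≠ 0 := by positivity
  unfold gDiag
  field_simp
  ring

theorem InZone.k_pos (h : EdgeScale N S) (hz : InZone N S k) : 0 < k := by
  have := hz.left
  have := h.pos
  omega

theorem gAmp_spec (h : EdgeScale N S) (hz : InZone N S k) :
    0 < gAmp N k ∧ gAmp N k ^ 2 * (4 - gDiag N k ^ 2) = 1 := by
  have hS := h.posS
  have hk := hz.k_pos h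
  have hpos : 0 < 4 - gDiag N k ^ 2 := by
    rw [four_sub_gDiag_sq hk]
    have h1 := hz.leftR
    have h2 := hz.rightR
    have h3 : (0 : ℝ) < 3 * N - k := by linarith
    have h4 : (0 : ℝ) < 3 * k - N := by linarith
    positivity
  constructor
  · unfold gAmp; positivity
  · unfold gAmp
    rw [inv_pow, Real.sq_sqrt hpos.le, inv_mul_cancel₀ hpos.ne']

theorem gAmp_sq (h : EdgeScale N S) (hz : InZone N S k) :
    gAmp N k ^ 2 * (3 * (3 * N - k) * (3 * k - N)) = 4 * (k : ℝ) ^ 2 := by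
  have h1 := (gAmp_spec h hz).2
  have hk : (k : ℝ) ≠ 0 := by have := hz.k_pos h; positivity
  rw [four_sub_gDiag_sq (hz.k_pos h)] at h1
  field_simp at h1
  linarith

/-- The distance of `k` to the edges of the oscillatory range. -/
def edgeDist (N k : ℕ) : ℕ := min (3 * N - k) (3 * k - N)

theorem InZone.le_edgeDist (hz : InZone N S k) : S ≤ edgeDist N k := by
  have := hz.left
  have := hz.right
  unfold edgeDist
  omega

theorem InZone.edgeDist_le_right (hz : InZone N S k) : (edgeDist N k : ℝ) ≤ 3 * N - k := by
  have h : edgeDist N k + k ≤ 3 * N := by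
    have := hz.left
    have := hz.right
    unfold edgeDist
    omega
  have : (edgeDist N k : ℝ) + k ≤ 3 * N := by exact_mod_cast h
  linarith

theorem InZone.edgeDist_le_left (hz : InZone N S k) : (edgeDist N k : ℝ) ≤ 3 * k - N := by
  have h : edgeDist N k + N ≤ 3 * k := by
    have := hz.left
    have := hz.right
    unfold edgeDist
    omega
  have : (edgeDist N k : ℝ) + N ≤ 3 * k := by exact_mod_cast h
  linarith

/-- Of the two distances to the edges, one is at least 2N when k ≤ N and the other is at least 2k
when k > N; the remaining factor is bounded below by `edgeDist`. -/
theorem gAmp_sq_le (h : EdgeScale N S) (hz : InZone N S k) :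
    gAmp N k ^ 2 * edgeDist N k ≤ 6 * N := by
  have h1 := gAmp_sq h hz
  have hl := hz.edgeDist_le_left
  have hr := hz.edgeDist_le_right
  have hS := h.posS
  have hz1 := hz.leftR
  have hz2 := hz.rightR
  have hN := h.posR
  set m : ℝ := (edgeDist N k : ℝ)
  have hm : 0 ≤ m := Nat.cast_nonneg _
  set g := gAmp N k ^ 2
  have hg : 0 ≤ g := sq_nonneg _
  have hk : (0 : ℝ) < k := by linarith
  by_cases hc : (k : ℝ) ≤ N
  · have e1 : g * (3 * (2 * N) * m) ≤ g * (3 * (3 * N - k) * (3 * k - N)) := by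
      have : 3 * (2 * N) * m ≤ 3 * (3 * (N : ℝ) - k) * (3 * k - N) := by
        apply mul_le_mul <;> linarith
      gcongr
    have e2 : (k : ℝ) ^ 2 ≤ (N : ℝ) ^ 2 := by gcongr
    have e3 : N * (g * m) ≤ N * (6 * N) := by nlinarith
    exact le_of_mul_le_mul_left e3 hN
  · push Not at hc
    have e1 : g * (3 * m * (2 * k)) ≤ g * (3 * (3 * N - k) * (3 * k - N)) := by
      have : 3 * m * (2 * k) ≤ 3 * (3 * (N : ℝ) - k) * (3 * k - N) := by
        apply mul_le_mul <;> linarith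
      gcongr
    have e3 : k * (g * m) ≤ k * (6 * N) := by nlinarith
    exact le_of_mul_le_mul_left e3 hk

theorem gAmp_sq_mul_S_le (h : EdgeScale N S) (hz : InZone N S k) : gAmp N k ^ 2 * S ≤ 6 * N := by
  refine le_trans ?_ (gAmp_sq_le h hz)
  have : (S : ℝ) ≤ edgeDist N k := by exact_mod_cast hz.le_edgeDist
  gcongr

theorem gStep_eq (hk : 2 ≤ k) : gStep N k = 3 * N / (2 * k * (k - 1)) := by
  have h0 : (2 : ℝ) ≤ k := by exact_mod_cast hk
  have h1 : (k : ℝ) ≠ 0 := by linarith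
  have h2 : (k : ℝ) - 1 ≠ 0 := by linarith
  unfold gStep gDiag
  rw [Nat.cast_sub (by omega)]
  push_cast
  field_simp
  ring

theorem gStep_nonneg (hk : 2 ≤ k) : 0 ≤ gStep N k := by
  have h0 : (2 : ℝ) ≤ k := by exact_mod_cast hk
  rw [gStep_eq hk]
  have : (0 : ℝ) < k - 1 := by linarith
  positivity

theorem gStep_le (hN : 0 < N) (hk : 2 ≤ k) (h3 : N + 3 ≤ 3 * k) : gStep N k * N ≤ 14 := by
  have h0 : (2 : ℝ) ≤ k := by exact_mod_cast hk
  have h1 : (N : ℝ) + 3 ≤ 3 * k := by exact_mod_cast h3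
  have hN' : (0 : ℝ) < N := by exact_mod_cast hN
  have h2 : (0 : ℝ) < k - 1 := by linarith
  rw [gStep_eq hk, div_mul_eq_mul_div, div_le_iff₀ (by positivity)]
  nlinarith

/-- The difference of steps is -3N/(k(k-1)(k-2)), while the square of a step is 9N²/(4k²(k-1)²).
They compare because k ≤ 3N. -/
theorem abs_gStep_sub_le (hN : 0 < N) (hk : 10 ≤ k) (h3 : k ≤ 3 * N) :
    |gStep N k - gStep N (k - 1)| ≤ 8 * gStep N k ^ 2 := by
  have h0 : (10 : ℝ) ≤ k := by exact_mod_cast hk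
  have h1 : (k : ℝ) ≤ 3 * N := by exact_mod_cast h3
  have hN' : (0 : ℝ) < N := by exact_mod_cast hN
  have h2 : (0 : ℝ) < k - 1 := by linarith
  have h4 : (0 : ℝ) < k - 2 := by linarith
  have h5 : (k : ℝ) ≠ 0 := by linarith
  have e : gStep N k - gStep N (k - 1) = -(3 * N / (k * (k - 1) * (k - 2))) := by
    rw [gStep_eq (by omega), gStep_eq (by omega), Nat.cast_sub (by omega)]
    push_cast
    have h2' : (k : ℝ) - 1 ≠ 0 := h2.ne'
    have h4' : (k : ℝ) - 2 ≠ 0 := h4.ne'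
    rw [show (k : ℝ) - 1 - 1 = k - 2 by ring]
    field_simp
    ring
  rw [e, abs_neg, abs_of_pos (by positivity), gStep_eq (by omega), div_pow, mul_div_assoc',
    div_le_div_iff₀ (by positivity) (by positivity)]
  have : (2 * (k : ℝ) * (k - 1)) ≤ 6 * N * (k - 2) * (3 / 2) := by nlinarith
  have h6 : 0 ≤ 3 * N * (2 * (k : ℝ) * (k - 1)) := by positivity
  nlinarith [mul_le_mul_of_nonneg_left this h6]

end Zone

/-! ### Near constancy of the adiabatic invariant. -/

/-- The cross term `c_k (c_{k+1} - c_{k-1})`. -/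
noncomputable def gCross (N k : ℕ) : ℝ :=
  gWeighted N k * (gDiag N k * gWeighted N k - 2 * gWeighted N (k - 1))

/-- The adiabatic invariant with its first correction. -/
noncomputable def gCorr (N k : ℕ) : ℝ := gInv N k - gAmp N k ^ 3 * gStep N k * gCross N k

section Invariant

variable {N S k : ℕ}

/-- By the recurrence, the energies at k and at k - 1 are forms in the same pair (c_k, c_{k-1}),
with coefficients x_k and x_{k-1}. This is the situation of `corrected_energy_step`. -/
theorem gEnergy_pred (hk : 2 ≤ k) :
    gEnergy N (k - 1) = energy (gDiag N (k - 1)) (gWeighted N k) (gWeighted N (k - 1)) := by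
  have h := gWeighted_rec' (N := N) (k := k - 1) (by omega)
  rw [Nat.sub_add_cancel (by omega)] at h
  rw [gEnergy, h]
  unfold energy
  ring

theorem gCross_pred (hk : 2 ≤ k) :
    gCross N (k - 1) =
      gWeighted N (k - 1) * (2 * gWeighted N k - gDiag N (k - 1) * gWeighted N (k - 1)) := by
  have h := gWeighted_rec' (N := N) (k := k - 1) (by omega)
  rw [Nat.sub_add_cancel (by omega)] at h
  rw [gCross, h]
  ring

theorem InZone.ten_le (h : EdgeScale N S) (hz : InZone N S k) : 10 ≤ k := by
  have h1 := h.large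
  have h2 := hz.leftR
  have h3 := h.posR
  have : (10 : ℝ) ≤ k := by linarith
  exact_mod_cast this

theorem gInv_nonneg (h : EdgeScale N S) (hz : InZone N S k) : 0 ≤ gInv N k := by
  obtain ⟨h1, h2⟩ := gAmp_spec h hz
  exact mul_nonneg h1.le (energy_nonneg h1 h2)

theorem InZone.gStep_le (h : EdgeScale N S) (hz : InZone N S k) : gStep N k * N ≤ 14 := by
  have h1 : 10 ^ 6 ≤ S := by exact_mod_cast h.large
  have h2 := hz.left
  exact _root_.gStep_le h.pos (by have := hz.ten_le h; omega) (by omega)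

theorem InZone.gStep_nonneg (h : EdgeScale N S) (hz : InZone N S k) : 0 ≤ gStep N k :=
  _root_.gStep_nonneg (by have := hz.ten_le h; omega)

theorem gStep_mul_gAmp_sq_le (h : EdgeScale N S) (hz : InZone N S k) :
    gStep N k * gAmp N k ^ 2 ≤ 1 / 16 := by
  have h1 := gAmp_sq_mul_S_le h hz
  have h2 := hz.gStep_le h
  have h3 := hz.gStep_nonneg h
  have hN := h.posR
  have hS := h.posS
  have hL := h.large
  have : (gStep N k * N) * (gAmp N k ^ 2 * S) ≤ 14 * (6 * N) := by gcongr
  have h5 : (gStep N k * gAmp N k ^ 2) * S ≤ 84 := by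
    refine le_of_mul_le_mul_right ?_ hN
    nlinarith
  have h6 : 0 ≤ gStep N k * gAmp N k ^ 2 := by positivity
  nlinarith

/-- The square of the left side is at most 14²·6³·N/S³, so the condition S³ ≥ 10¹⁸N makes the
correction negligible. This is where the scale N^{1/3} is forced. -/
theorem gAmp_cube_mul_gStep_le (h : EdgeScale N S) (hz : InZone N S k) :
    gAmp N k ^ 3 * gStep N k ≤ 1 / 4 := by
  have h1 := gAmp_sq_mul_S_le h hz
  have h2 := hz.gStep_le h
  have h3 := hz.gStep_nonneg h
  have h0 := (gAmp_spec h hz).1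
  have hN := h.posR
  have hS := h.posS
  have hc := h.cube_ge
  have e1 : (gStep N k * N) ^ 2 * (gAmp N k ^ 2 * S) ^ 3 ≤ 14 ^ 2 * (6 * N) ^ 3 := by gcongr
  refine (abs_le_of_sq_le_sq' ?_ (by norm_num)).2
  have e2 : (gAmp N k ^ 3 * gStep N k) ^ 2 * (N ^ 2 * S ^ 3) ≤ 42336 * N * N ^ 2 := by
    nlinarith
  have e3 : (gAmp N k ^ 3 * gStep N k) ^ 2 * S ^ 3 ≤ 42336 * N := by
    refine le_of_mul_le_mul_right ?_ (by positivity : (0 : ℝ) < N ^ 2)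
    nlinarith
  have e4 : 0 ≤ (gAmp N k ^ 3 * gStep N k) ^ 2 := sq_nonneg _
  have e5 : (gAmp N k ^ 3 * gStep N k) ^ 2 * (10 ^ 18 * N) ≤ 42336 * N := by nlinarith
  have e6 : (gAmp N k ^ 3 * gStep N k) ^ 2 * 10 ^ 18 ≤ 42336 := by
    refine le_of_mul_le_mul_right ?_ hN
    nlinarith
  norm_num at e6 ⊢
  linarith

theorem abs_gCross_le (h : EdgeScale N S) (hz : InZone N S k) : |gCross N k| ≤ 2 * gInv N k := by
  obtain ⟨h1, h2⟩ := gAmp_spec h hz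
  have := abs_cross_le_energy (p := gWeighted N k) (q := gWeighted N (k - 1)) h1 h2
  unfold gInv gEnergy gCross
  linarith

theorem gCorr_bounds (h : EdgeScale N S) (hz : InZone N S k) :
    1 / 2 * gInv N k ≤ gCorr N k ∧ gCorr N k ≤ 3 / 2 * gInv N k := by
  have h1 := abs_gCross_le h hz
  have h2 := gAmp_cube_mul_gStep_le h hz
  have h3 : 0 ≤ gAmp N k ^ 3 * gStep N k := by
    have := (gAmp_spec h hz).1
    have := hz.gStep_nonneg h
    positivity
  have h4 : |gAmp N k ^ 3 * gStep N k * gCross N k| ≤ 1 / 4 * (2 * gInv N k) := by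
    rw [abs_mul, abs_of_nonneg h3]
    gcongr
  have := abs_le.1 h4
  unfold gCorr
  constructor <;> linarith

theorem gCorr_step (h : EdgeScale N S) (hz : InZone N S k) (hz' : InZone N S (k - 1)) :
    |gCorr N k - gCorr N (k - 1)| ≤
      320 * gStep N k ^ 2 * gAmp N k ^ 5 * (gCorr N k + gCorr N (k - 1)) := by
  have hk := hz.ten_le h
  obtain ⟨h1, h2⟩ := gAmp_spec h hz
  obtain ⟨h3, h4⟩ := gAmp_spec h hz'
  have hk3 : k ≤ 3 * N := by have := hz.right; omega
  have hs := corrected_energy_step (p := gWeighted N k) (q := gWeighted N (k - 1)) h1 h3 h2 h4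
    (rfl : gStep N k = gDiag N k - gDiag N (k - 1)) (hz.gStep_nonneg h)
    (gStep_mul_gAmp_sq_le h hz) (abs_gStep_sub_le h.pos hk hk3)
  rw [← gEnergy_pred (by omega), ← gCross_pred (by omega)] at hs
  have e1 := (gCorr_bounds h hz).1
  have e2 := (gCorr_bounds h hz').1
  refine (show _ ≤ 160 * gStep N k ^ 2 * gAmp N k ^ 5 * (gInv N k + gInv N (k - 1)) from hs).trans ?_
  have e3 : 0 ≤ gStep N k ^ 2 * gAmp N k ^ 5 := by positivity
  nlinarith [mul_le_mul_of_nonneg_left (add_le_add e1 e2) e3]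

theorem edgeDist_pos (h : EdgeScale N S) (hz : InZone N S k) : (0 : ℝ) < edgeDist N k := by
  have : (S : ℝ) ≤ edgeDist N k := by exact_mod_cast hz.le_edgeDist
  linarith [h.posS]

theorem step_coeff_le (h : EdgeScale N S) (hz : InZone N S k) :
    320 * gStep N k ^ 2 * gAmp N k ^ 5 ≤
      10 ^ 7 * (N : ℝ) ^ (1 / 2 : ℝ) * (edgeDist N k : ℝ) ^ (-(5 / 2) : ℝ) := by
  have hm := edgeDist_pos h hz
  have hN := h.posR
  have h1 := (gAmp_spec h hz).1
  have h2 := hz.gStep_le h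
  have h3 := hz.gStep_nonneg h
  have h4 := gAmp_sq_le h hz
  have e1 : gStep N k ≤ 14 / N := by rw [le_div_iff₀ hN]; exact h2
  have e2 : gAmp N k ^ 2 ≤ 6 * N / edgeDist N k := by rw [le_div_iff₀ hm]; exact h4
  have e3 : gAmp N k ^ 5 ≤ (6 * N / edgeDist N k : ℝ) ^ (5 / 2 : ℝ) := by
    calc gAmp N k ^ 5 = (gAmp N k ^ 2) ^ (5 / 2 : ℝ) := by
          rw [← Real.rpow_natCast (gAmp N k) 2, ← Real.rpow_mul h1.le, ← Real.rpow_natCast]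
          norm_num
      _ ≤ _ := by gcongr
  have e4 : (6 * N / edgeDist N k : ℝ) ^ (5 / 2 : ℝ) =
      6 ^ (5 / 2 : ℝ) * ((N : ℝ) ^ 2 * (N : ℝ) ^ (1 / 2 : ℝ)) *
        (edgeDist N k : ℝ) ^ (-(5 / 2) : ℝ) := by
    rw [Real.div_rpow (by positivity) hm.le, Real.mul_rpow (by norm_num) hN.le, Real.rpow_neg hm.le,
      div_eq_mul_inv, ← Real.rpow_natCast (N : ℝ) 2, ← Real.rpow_add hN]
    norm_num
  have e5 : (6 : ℝ) ^ (5 / 2 : ℝ) ≤ 100 := by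
    refine (abs_le_of_sq_le_sq' ?_ (by norm_num)).2
    rw [← Real.rpow_natCast, ← Real.rpow_mul (by norm_num)]
    norm_num
  rw [e4] at e3
  calc 320 * gStep N k ^ 2 * gAmp N k ^ 5 ≤ 320 * (14 / N) ^ 2 *
        (100 * ((N : ℝ) ^ 2 * (N : ℝ) ^ (1 / 2 : ℝ)) * (edgeDist N k : ℝ) ^ (-(5 / 2) : ℝ)) := by
        gcongr
        exact e3.trans (by gcongr)
    _ = 320 * 14 ^ 2 * 100 * ((N : ℝ) ^ (1 / 2 : ℝ) * (edgeDist N k : ℝ) ^ (-(5 / 2) : ℝ)) := by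
        field_simp
    _ ≤ 10 ^ 7 * ((N : ℝ) ^ (1 / 2 : ℝ) * (edgeDist N k : ℝ) ^ (-(5 / 2) : ℝ)) := by
        gcongr; norm_num
    _ = _ := by ring

theorem edgeDist_rpow_le (N k : ℕ) (q : ℝ) :
    (edgeDist N k : ℝ) ^ q ≤ ((3 * N - k : ℕ) : ℝ) ^ q + ((3 * k - N : ℕ) : ℝ) ^ q := by
  rcases min_choice (3 * N - k) (3 * k - N) with hc | hc
  · rw [edgeDist, hc]
    have : 0 ≤ ((3 * k - N : ℕ) : ℝ) ^ q := by positivity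
    linarith
  · rw [edgeDist, hc]
    have : 0 ≤ ((3 * N - k : ℕ) : ℝ) ^ q := by positivity
    linarith

theorem injOn_right {F : Finset ℕ} (hF : ∀ k ∈ F, InZone N S k) :
    Set.InjOn (fun k => 3 * N - k) F := by
  intro a ha b hb hab
  have := (hF a ha).right
  have := (hF b hb).right
  simp only at hab
  omega

theorem injOn_left {F : Finset ℕ} (hF : ∀ k ∈ F, InZone N S k) :
    Set.InjOn (fun k => 3 * k - N) F := by
  intro a ha b hb hab
  have := (hF a ha).left
  have := (hF b hb).left
  simp only at hab
  omega

theorem EdgeScale.one_le (h : EdgeScale N S) : 1 ≤ S := by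
  have := h.posS
  exact_mod_cast this

/-- Power sums of the edge distance with exponent above one. -/
theorem sum_edgeDist_le (h : EdgeScale N S) {q : ℝ} (hq : 1 < q) {F : Finset ℕ}
    (hF : ∀ k ∈ F, InZone N S k) :
    ∑ k ∈ F, (edgeDist N k : ℝ) ^ (-q) ≤ 2 * (q / (q - 1) * (S : ℝ) ^ (1 - q)) := by
  have h1 := sum_rpow_neg_le hq h.one_le F (fun k => 3 * N - k) (injOn_right hF)
    (fun k hk => by have := (hF k hk).right; show S ≤ 3 * N - k; omega)
  have h2 := sum_rpow_neg_le hq h.one_le F (fun k => 3 * k - N) (injOn_left hF)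
    (fun k hk => by have := (hF k hk).left; show S ≤ 3 * k - N; omega)
  calc _ ≤ ∑ k ∈ F, (((3 * N - k : ℕ) : ℝ) ^ (-q) + ((3 * k - N : ℕ) : ℝ) ^ (-q)) :=
        Finset.sum_le_sum fun k _ => edgeDist_rpow_le N k _
    _ ≤ _ := by rw [Finset.sum_add_distrib]; linarith

theorem InZone.between {a b : ℕ} (ha : InZone N S a) (hb : InZone N S b) (h1 : a ≤ k)
    (h2 : k ≤ b) : InZone N S k :=
  ⟨by have := ha.left; omega, by have := hb.right; omega⟩

/-- The terms are of order N^{1/2} d^{-5/2}, their sum of order N^{1/2} S^{-3/2}, and N^{1/2} ≤ 10⁻⁹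
S^{3/2} by the choice of S. -/
theorem sum_step_coeff_le (h : EdgeScale N S) {F : Finset ℕ} (hF : ∀ k ∈ F, InZone N S k) :
    ∑ k ∈ F, 320 * gStep N k ^ 2 * gAmp N k ^ 5 ≤ 1 / 10 := by
  have hN := h.posR
  have hS := h.posS
  have h1 := sum_edgeDist_le h (q := 5 / 2) (by norm_num) hF
  have h2 : (10 : ℝ) ^ 9 * (N : ℝ) ^ (1 / 2 : ℝ) ≤ (S : ℝ) ^ (3 / 2 : ℝ) := by
    have : ((10 : ℝ) ^ 18 * N) ^ (1 / 2 : ℝ) ≤ ((S : ℝ) ^ 3) ^ (1 / 2 : ℝ) :=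
      Real.rpow_le_rpow (by positivity) h.cube_ge (by norm_num)
    rw [Real.mul_rpow (by norm_num) hN.le, ← Real.rpow_natCast 10 18, ← Real.rpow_mul (by norm_num),
      ← Real.rpow_natCast (S : ℝ) 3, ← Real.rpow_mul hS.le] at this
    convert this using 2 <;> norm_num
  calc ∑ k ∈ F, 320 * gStep N k ^ 2 * gAmp N k ^ 5
      ≤ ∑ k ∈ F, 10 ^ 7 * (N : ℝ) ^ (1 / 2 : ℝ) * (edgeDist N k : ℝ) ^ (-(5 / 2) : ℝ) :=
        Finset.sum_le_sum fun k hk => step_coeff_le h (hF k hk)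
    _ = 10 ^ 7 * (N : ℝ) ^ (1 / 2 : ℝ) * ∑ k ∈ F, (edgeDist N k : ℝ) ^ (-(5 / 2) : ℝ) := by
        rw [Finset.mul_sum]
    _ ≤ 10 ^ 7 * (N : ℝ) ^ (1 / 2 : ℝ) * (2 * (5 / 2 / (5 / 2 - 1) * (S : ℝ) ^ (1 - 5 / 2 : ℝ))) := by
        gcongr
    _ = 10 ^ 7 * (10 / 3) * (N : ℝ) ^ (1 / 2 : ℝ) / (S : ℝ) ^ (3 / 2 : ℝ) := by
        rw [show (1 - 5 / 2 : ℝ) = -(3 / 2) by norm_num, Real.rpow_neg hS.le]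
        ring
    _ ≤ 1 / 10 := by
        rw [div_le_iff₀ (by positivity)]
        have : 0 < (N : ℝ) ^ (1 / 2 : ℝ) := by positivity
        norm_num at h2 ⊢
        linarith

theorem gCorr_comparable (h : EdgeScale N S) {i j : ℕ} (hi : InZone N S i) (hj : InZone N S j)
    (hij : i ≤ j) : gCorr N j ≤ 3 / 2 * gCorr N i ∧
      gCorr N i ≤ 3 / 2 * gCorr N j := by
  have hmem : ∀ k ∈ Finset.Ioc i j, InZone N S k := fun k hk => by
    have := Finset.mem_Ioc.1 hk
    exact hi.between hj this.1.le this.2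
  have hsum := sum_step_coeff_le h hmem
  have hpos : ∀ k, InZone N S k → 0 ≤ 320 * gStep N k ^ 2 * gAmp N k ^ 5 := fun k hk => by
    have := (gAmp_spec h hk).1
    positivity
  have hJ : ∀ k, InZone N S k → 0 ≤ gCorr N k := fun k hk => by
    have := (gCorr_bounds h hk).1
    have := gInv_nonneg h hk
    linarith
  have key := comparable_of_small_steps (J := gCorr N)
    (ε := fun k => 320 * gStep N k ^ 2 * gAmp N k ^ 5) hij
    (fun k h1 h2 => hJ k (hi.between hj h1 h2))
    (fun k h1 h2 => hpos k (hi.between hj h1.le h2))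
    (fun k h1 h2 => by
      have := Finset.single_le_sum (f := fun k => 320 * gStep N k ^ 2 * gAmp N k ^ 5)
        (fun l hl => hpos l (hmem l hl)) (Finset.mem_Ioc.2 ⟨h1, h2⟩)
      linarith)
    (fun k h1 h2 => gCorr_step h (hi.between hj h1.le h2)
      (hi.between hj (by omega) (by omega)))
  -- The total error 1/10 gives exp(3/10) ≤ 1/(1 - 3/10) = 10/7.
  have hexp : Real.exp (3 * ∑ k ∈ Finset.Ioc i j, 320 * gStep N k ^ 2 * gAmp N k ^ 5) ≤
      3 / 2 := by
    calc _ ≤ Real.exp (3 / 10) := Real.exp_le_exp.2 (by linarith)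
      _ ≤ 1 / (1 - 3 / 10) := by
        rw [le_div_iff₀ (by norm_num), ← le_div_iff₀' (Real.exp_pos _), one_div, ← Real.exp_neg]
        linarith [Real.add_one_le_exp (-(3 / 10))]
      _ ≤ _ := by norm_num
  have j1 := hJ i hi
  have j2 := hJ j hj
  exact ⟨key.1.trans (by gcongr), key.2.trans (by gcongr)⟩

/-- The adiabatic invariant is constant up to a factor `5` in the oscillatory range. -/
theorem gInv_comparable (h : EdgeScale N S) {i j : ℕ} (hi : InZone N S i) (hj : InZone N S j) :
    gInv N i ≤ 5 * gInv N j := by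
  have b1 := gCorr_bounds h hi
  have b2 := gCorr_bounds h hj
  rcases le_total i j with hij | hij
  · have := (gCorr_comparable h hi hj hij).2
    have := gInv_nonneg h hj
    linarith
  · have := (gCorr_comparable h hj hi hij).1
    have := gInv_nonneg h hj
    linarith

end Invariant

/-! ### Comparison principles near and beyond the turning points. -/

/-- Growth bound for solutions of `e_{j+1} - 2 e_j + e_{j-1} = η_j e_j` with `|η_j| ≤ ε²`. -/
theorem gronwall_second_difference {e : ℕ → ℝ} {ε B : ℝ} (hε : 0 ≤ ε) (hB : 0 ≤ B) {n : ℕ}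
    (h : ∀ j, j < n → |e (j + 2) - 2 * e (j + 1) + e j| ≤ ε ^ 2 * |e (j + 1)|)
    (h0 : |e 0| ≤ B) (h1 : |e 1 - e 0| ≤ ε * B) (j : ℕ) (hj : j ≤ n) :
    |e j| ≤ B * Real.exp (2 * ε * j) ∧ |e (j + 1) - e j| ≤ ε * (B * Real.exp (2 * ε * j)) := by
  induction j with
  | zero => simpa using ⟨h0, h1⟩
  | succ j ih =>
    obtain ⟨i1, i2⟩ := ih (by omega)
    have hs := h j (by omega)
    set X := B * Real.exp (2 * ε * j)
    have hX : 0 ≤ X := by positivity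
    have hexp : X * (1 + ε) ^ 2 ≤ B * Real.exp (2 * ε * (j + 1 : ℕ)) := by
      have e1 : Real.exp (2 * ε * (j + 1 : ℕ)) = Real.exp (2 * ε * j) * Real.exp ε ^ 2 := by
        rw [← Real.exp_nat_mul, ← Real.exp_add]
        push_cast
        ring_nf
      rw [e1, ← mul_assoc]
      gcongr
      linarith [Real.add_one_le_exp ε]
    have a1 : |e (j + 1)| ≤ (1 + ε) * X := by
      have : e (j + 1) = e j + (e (j + 1) - e j) := by ring
      rw [this]
      refine (abs_add_le _ _).trans ?_
      linarith
    have a2 : |e (j + 2) - e (j + 1)| ≤ ε * (X * (1 + ε) ^ 2) := by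
      have : e (j + 2) - e (j + 1) =
        (e (j + 2) - 2 * e (j + 1) + e j) + (e (j + 1) - e j) := by ring
      rw [this]
      refine (abs_add_le _ _).trans ?_
      have : ε ^ 2 * |e (j + 1)| ≤ ε ^ 2 * ((1 + ε) * X) := by gcongr
      nlinarith [mul_nonneg (mul_nonneg hε hε) hX, mul_nonneg hε hX]
    constructor
    · refine a1.trans (le_trans ?_ hexp)
      nlinarith [mul_nonneg hε hX, mul_nonneg (mul_nonneg hε hε) hX]
    · refine a2.trans ?_
      gcongr

/-- A recessive solution beyond its turning point decays. -/
theorem recessive_bounds {c η : ℕ → ℝ} {m : ℕ}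
    (hrec : ∀ k, m ≤ k → c (k + 2) + c k = (2 + η (k + 1)) * c (k + 1))
    (hη : ∀ k, m < k → 0 ≤ η k) (hlim : Filter.Tendsto c Filter.atTop (nhds 0)) :
    (∀ k, m ≤ k → |c (k + 1)| ≤ |c k|) ∧
      ∀ n, ∑ k ∈ Finset.Ioc m (m + n), η k * c k ^ 2 ≤ |c m * (c (m + 1) - c m)| := by
  -- This quantity is nondecreasing where η ≥ 0 and tends to 0, hence is nonpositive. Its total
  -- increase dominates the weighted square sum.
  set T : ℕ → ℝ := fun k => c k * (c (k + 1) - c k) with hT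
  have hTdef : ∀ k, T k = c k * (c (k + 1) - c k) := fun _ => rfl
  have hstep : ∀ k, m ≤ k → T (k + 1) = T k + (c (k + 1) - c k) ^ 2 + η (k + 1) * c (k + 1) ^ 2 := by
    intro k hk
    rw [hTdef, hTdef]
    linear_combination c (k + 1) * hrec k hk
  have hmono : ∀ k, m ≤ k → T k ≤ T (k + 1) := by
    intro k hk
    rw [hstep k hk]
    have := mul_nonneg (hη (k + 1) (by omega)) (sq_nonneg (c (k + 1)))
    have := sq_nonneg (c (k + 1) - c k)
    linarith
  have hTlim : Filter.Tendsto T Filter.atTop (nhds 0) := by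
    have := hlim.mul ((hlim.comp (Filter.tendsto_add_atTop_nat 1)).sub hlim)
    simpa using this
  have hTneg : ∀ k, m ≤ k → T k ≤ 0 := by
    intro k hk
    refine ge_of_tendsto hTlim ?_
    filter_upwards [Filter.eventually_ge_atTop k] with l hl
    induction l, hl using Nat.le_induction with
    | base => exact le_rfl
    | succ l hl ih => exact ih.trans (hmono l (by omega))
  constructor
  · intro k hk
    have h1 := hTneg (k + 1) (by omega)
    rw [hstep k hk, hTdef] at h1
    have h2 := mul_nonneg (hη (k + 1) (by omega)) (sq_nonneg (c (k + 1)))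
    have h3 : c (k + 1) ^ 2 ≤ c (k + 1) * c k := by nlinarith
    have h4 : |c (k + 1)| * |c (k + 1)| ≤ |c (k + 1)| * |c k| := by
      rw [← abs_mul, ← abs_mul, ← sq, abs_of_nonneg (sq_nonneg _)]
      exact h3.trans (le_abs_self _)
    by_cases h0 : c (k + 1) = 0
    · rw [h0, abs_zero]; exact abs_nonneg _
    · exact le_of_mul_le_mul_left h4 (abs_pos.2 h0)
  · intro n
    have h : ∑ k ∈ Finset.Ioc m (m + n), η k * c k ^ 2 ≤ T (m + n) - T m := by
      induction n with
      | zero => simp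
      | succ n ih =>
        rw [← add_assoc, Finset.sum_Ioc_succ_top (by omega), hstep (m + n) (by omega)]
        have := sq_nonneg (c (m + n + 1) - c (m + n))
        linarith
    refine h.trans ?_
    have h1 := hTneg (m + n) (by omega)
    have h2 := neg_abs_le (T m)
    show _ ≤ |T m|
    linarith

/-- A solution of an alternating recurrence starting from `0` grows up to its turning point. -/
theorem dominant_bounds {c η : ℕ → ℝ} {K : ℕ} (h0 : c 0 = 0)
    (hrec : ∀ k, k < K → c (k + 2) + c k = -(2 + η (k + 1)) * c (k + 1))
    (hη : ∀ k, 0 < k → k ≤ K → 0 ≤ η k) :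
    (∀ k, k ≤ K → (1 + η k) * |c k| ≤ |c (k + 1)|) ∧
      ∑ k ∈ Finset.Ioc 0 K, η k * c k ^ 2 ≤ |c K * (c (K + 1) + c K)| := by
  -- Alternating analogue of the previous monotone quantity: it starts from 0 because c 0 = 0 and
  -- increases up to K.
  set T : ℕ → ℝ := fun k => -(c k * (c (k + 1) + c k)) with hT
  have hTdef : ∀ k, T k = -(c k * (c (k + 1) + c k)) := fun _ => rfl
  have hstep : ∀ k, k < K → T (k + 1) = T k + (c (k + 1) + c k) ^ 2 + η (k + 1) * c (k + 1) ^ 2 := by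
    intro k hk
    rw [hTdef, hTdef]
    linear_combination -c (k + 1) * hrec k hk
  have hTsum : ∀ k, k ≤ K → ∑ i ∈ Finset.Ioc 0 k, η i * c i ^ 2 ≤ T k := by
    intro k
    induction k with
    | zero => simp [hTdef, h0]
    | succ k ih =>
      intro hk
      rw [Finset.sum_Ioc_succ_top (by omega), hstep k (by omega)]
      have := ih (by omega)
      have := sq_nonneg (c (k + 1) + c k)
      linarith
  have hTη : ∀ k, k ≤ K → η k * c k ^ 2 ≤ T k := by
    intro k hk
    rcases Nat.eq_zero_or_pos k with rfl | hk0
    · simp [hTdef, h0]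
    · refine le_trans ?_ (hTsum k hk)
      refine Finset.single_le_sum (f := fun i => η i * c i ^ 2) (fun i hi => ?_)
        (Finset.mem_Ioc.2 ⟨hk0, le_rfl⟩)
      have := Finset.mem_Ioc.1 hi
      exact mul_nonneg (hη i this.1 (by omega)) (sq_nonneg _)
  constructor
  · intro k hk
    have h1 := hTη k hk
    rw [hTdef] at h1
    have h3 : (1 + η k) * c k ^ 2 ≤ -(c k * c (k + 1)) := by nlinarith
    by_cases hc : c k = 0
    · rw [hc, abs_zero, mul_zero]; exact abs_nonneg _
    · refine le_of_mul_le_mul_left ?_ (abs_pos.2 hc)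
      calc |c k| * ((1 + η k) * |c k|) = (1 + η k) * c k ^ 2 := by rw [← sq_abs (c k)]; ring
        _ ≤ _ := h3
        _ ≤ _ := by rw [← abs_mul]; exact neg_le_abs _
  · refine (hTsum K le_rfl).trans ?_
    rw [hTdef]
    exact neg_le_abs _

/-! ### Sizes and slopes at the two ends of the oscillatory range. -/

/-- Growth factor across the transition regions. -/
noncomputable def edgeConst : ℝ := Real.exp (2 * 10 ^ 10)

theorem edgeConst_pos : 0 < edgeConst := Real.exp_pos _

section Edges

variable {N S k : ℕ}

theorem EdgeScale.center (h : EdgeScale N S) : InZone N S N := by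
  have h1 : 10 ^ 6 * S ≤ N := by exact_mod_cast h.le
  exact ⟨by omega, by omega⟩

/-- The square of the slope at an edge, in terms of the energy. -/
theorem slope_sq_le {x p q r : ℝ} (hr : 0 < r) (hx : r ^ 2 * (4 - x ^ 2) = 1) :
    (-1 ≤ x → (p - q) ^ 2 ≤ 5 * energy x p q) ∧ (x ≤ 1 → (p + q) ^ 2 ≤ 5 * energy x p q) := by
  have hP := abs_le.1 (abs_mul_le_energy (p := p) (q := q) hx)
  have hE := energy_nonneg (p := p) (q := q) hr hx
  have hxa := abs_le.1 (abs_le_two_of_amplitude hx)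
  have hr2 : 0 < r ^ 2 := by positivity
  constructor
  · intro h1
    have e : (p - q) ^ 2 = energy x p q - (2 - x) * (p * q) := by unfold energy; ring
    have e2 : (2 - x) * (4 * energy x p q * r ^ 2) ≤ 4 * energy x p q := by
      have : (2 - x) * r ^ 2 ≤ 1 := by
        have : 0 ≤ (2 - x) * r ^ 2 := mul_nonneg (by linarith) hr2.le
        nlinarith
      nlinarith
    rw [e]
    nlinarith [mul_le_mul_of_nonneg_left hP.1 (by linarith : 0 ≤ 2 - x)]
  · intro h1
    have e : (p + q) ^ 2 = energy x p q + (2 + x) * (p * q) := by unfold energy; ring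
    have e2 : (2 + x) * (4 * energy x p q * r ^ 2) ≤ 4 * energy x p q := by
      have : (2 + x) * r ^ 2 ≤ 1 := by
        have : 0 ≤ (2 + x) * r ^ 2 := mul_nonneg (by linarith) hr2.le
        nlinarith
      nlinarith
    rw [e]
    nlinarith [mul_le_mul_of_nonneg_left hP.2 (by linarith : 0 ≤ 2 + x)]

/-- The WKB bound: c² ≤ 4Er² = 4(rE)r, and rE is at most five times its value at the centre. -/
theorem gWeighted_sq_le (h : EdgeScale N S) (hz : InZone N S k) :
    gWeighted N k ^ 2 ≤ 20 * gInv N N * gAmp N k ∧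
      gWeighted N (k - 1) ^ 2 ≤ 20 * gInv N N * gAmp N k := by
  obtain ⟨h1, h2⟩ := gAmp_spec h hz
  have hI := gInv_comparable h hz h.center
  have e : 4 * gEnergy N k * gAmp N k ^ 2 ≤ 20 * gInv N N * gAmp N k := by
    calc 4 * gEnergy N k * gAmp N k ^ 2 = 4 * gInv N k * gAmp N k := by unfold gInv; ring
      _ ≤ 4 * (5 * gInv N N) * gAmp N k := by gcongr
      _ = _ := by ring
  exact ⟨(sq_le_energy h2).trans e, (sq_le_energy' h2).trans e⟩

/-- `w = √(S/N)`, the reciprocal amplitude at the edges up to constants. -/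
noncomputable def edgeWidth (N S : ℕ) : ℝ := √((S : ℝ) / N)

theorem edgeWidth_pos (h : EdgeScale N S) : 0 < edgeWidth N S := by
  have := h.posR
  have := h.posS
  unfold edgeWidth
  positivity

theorem edgeWidth_sq (h : EdgeScale N S) : edgeWidth N S ^ 2 * N = S := by
  have := h.posR
  have := h.posS
  rw [edgeWidth, Real.sq_sqrt (by positivity)]
  field_simp

theorem edgeWidth_mul_le (h : EdgeScale N S) : edgeWidth N S * S ≤ 10 ^ 9 * 33 / 10 := by
  have hw := edgeWidth_sq h
  have hN := h.posR
  have hc := h.cube_le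
  refine (abs_le_of_sq_le_sq' ?_ (by norm_num)).2
  refine le_of_mul_le_mul_right ?_ hN
  calc (edgeWidth N S * S) ^ 2 * N = (edgeWidth N S ^ 2 * N) * S ^ 2 := by ring
    _ = (S : ℝ) ^ 3 := by rw [hw]; ring
    _ ≤ 10 ^ 19 * N := hc
    _ ≤ _ := by
      gcongr
      norm_num

/-- Fixes `edgeConst`: the exponent is at most 6·w·S, and (wS)² = S³/N ≤ 10¹⁹ gives 6·3.3·10⁹ <
2·10¹⁰. -/
theorem edgeExp_le (h : EdgeScale N S) {j : ℕ} (hj : j ≤ S) :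
    Real.exp (2 * (3 * edgeWidth N S) * j) ≤ edgeConst := by
  apply Real.exp_le_exp.2
  have h1 := edgeWidth_mul_le h
  have h2 := edgeWidth_pos h
  have h3 : (j : ℝ) ≤ S := by exact_mod_cast hj
  have h4 : edgeWidth N S * j ≤ edgeWidth N S * S := by gcongr
  norm_num at h1 ⊢
  linarith

/-- The size bound at the edges. -/
noncomputable def edgeBound (N S : ℕ) : ℝ := √(50 * gInv N N / edgeWidth N S)

theorem edgeBound_sq (h : EdgeScale N S) :
    edgeBound N S ^ 2 = 50 * gInv N N / edgeWidth N S := by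
  have := edgeWidth_pos h
  have := gInv_nonneg h h.center
  rw [edgeBound, Real.sq_sqrt (by positivity)]

theorem edgeBound_nonneg : 0 ≤ edgeBound N S := Real.sqrt_nonneg _

theorem gWeighted_le_edgeBound (h : EdgeScale N S) (hz : InZone N S k) :
    |gWeighted N k| ≤ edgeBound N S ∧ |gWeighted N (k - 1)| ≤ edgeBound N S := by
  have hw := edgeWidth_pos h
  have hw2 := edgeWidth_sq h
  have hG := gInv_nonneg h h.center
  have hr := (gAmp_spec h hz).1
  have h1 := gAmp_sq_mul_S_le h hz
  have hN := h.posR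
  have e1 : gAmp N k * edgeWidth N S ≤ 5 / 2 := by
    refine (abs_le_of_sq_le_sq' ?_ (by norm_num)).2
    have : (gAmp N k * edgeWidth N S) ^ 2 * N ≤ 6 * N := by
      rw [← hw2] at h1
      linarith
    have := le_of_mul_le_mul_right this hN
    linarith
  have e2 : 20 * gInv N N * gAmp N k ≤ edgeBound N S ^ 2 := by
    rw [edgeBound_sq h, le_div_iff₀ hw]
    nlinarith
  obtain ⟨h3, h4⟩ := gWeighted_sq_le h hz
  exact ⟨abs_le_of_sq_le_sq (h3.trans e2) edgeBound_nonneg,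
    abs_le_of_sq_le_sq (h4.trans e2) edgeBound_nonneg⟩

/-- At an edge the difference, or the sum on the alternating side, is smaller than the sequence by
the factor w. The lower bound on the amplitude gives rw ≥ 1/5, hence E ≤ 5w·rE. The product 3w is
exactly the rate ε in the Gronwall step. -/
theorem slope_le_edgeBound (h : EdgeScale N S) (hz : InZone N S k)
    (hlow : (N : ℝ) ≤ gAmp N k ^ 2 * S * 20) :
    (-1 ≤ gDiag N k → |gWeighted N k - gWeighted N (k - 1)| ≤
        3 * edgeWidth N S * edgeBound N S) ∧
      (gDiag N k ≤ 1 → |gWeighted N k + gWeighted N (k - 1)| ≤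
        3 * edgeWidth N S * edgeBound N S) := by
  have hw := edgeWidth_pos h
  have hw2 := edgeWidth_sq h
  have hG := gInv_nonneg h h.center
  obtain ⟨hr, hx⟩ := gAmp_spec h hz
  have hN := h.posR
  have hI := gInv_comparable h hz h.center
  have e0 : 1 ≤ 5 * (gAmp N k * edgeWidth N S) := by
    refine (abs_le_of_sq_le_sq' ?_ (by positivity)).2
    rw [← hw2] at hlow
    have : 1 ≤ (gAmp N k ^ 2 * edgeWidth N S ^ 2) * 20 := by
      refine le_of_mul_le_mul_right ?_ hN
      linarith
    nlinarith [sq_nonneg (gAmp N k * edgeWidth N S)]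
  have e1 : 5 * gEnergy N k ≤ (3 * edgeWidth N S * edgeBound N S) ^ 2 := by
    rw [mul_pow, edgeBound_sq h]
    have : (3 * edgeWidth N S) ^ 2 * (50 * gInv N N / edgeWidth N S) =
        450 * (edgeWidth N S * gInv N N) := by field_simp; ring
    rw [this]
    have e2 : gEnergy N k ≤ 5 * (edgeWidth N S) * gInv N k := by
      unfold gInv
      have := energy_nonneg (p := gWeighted N k) (q := gWeighted N (k - 1)) hr hx
      have h0 : 0 ≤ gEnergy N k := this
      nlinarith
    nlinarith
  obtain ⟨h3, h4⟩ := slope_sq_le (p := gWeighted N k) (q := gWeighted N (k - 1)) hr hx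
  have hnn : 0 ≤ 3 * edgeWidth N S * edgeBound N S := by
    have := edgeBound_nonneg (N := N) (S := S)
    positivity
  exact ⟨fun hc => abs_le_of_sq_le_sq ((h3 hc).trans e1) hnn,
    fun hc => abs_le_of_sq_le_sq ((h4 hc).trans e1) hnn⟩

end Edges

/-! ### The right turning point k = 3N. -/

section RightEdge

variable {N S k : ℕ}

theorem EdgeScale.leNat (h : EdgeScale N S) : 10 ^ 6 * S ≤ N := by exact_mod_cast h.le

theorem EdgeScale.largeNat (h : EdgeScale N S) : 10 ^ 6 ≤ S := by exact_mod_cast h.large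

/-- Gronwall run forward from the last indices of the zone: over the S steps up to 3N one has |x_k -
2| ≤ 9S/N = (3w)², so the total growth is bounded independently of N. -/
theorem rightTransition (h : EdgeScale N S) (hk1 : 3 * N ≤ k + S + 1) (hk2 : k + 1 ≤ 3 * N) :
    |gWeighted N k| ≤ edgeBound N S * edgeConst ∧
      |gWeighted N (k + 1) - gWeighted N k| ≤
        3 * edgeWidth N S * (edgeBound N S * edgeConst) := by
  have hS := h.leNat
  have hL := h.largeNat
  have hSR := h.le
  have hLR := h.large
  have hN := h.posR
  have hw := edgeWidth_pos h
  have hw2 := edgeWidth_sq h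
  have hB := edgeBound_nonneg (N := N) (S := S)
  obtain ⟨m, hm⟩ : ∃ m, 3 * N = m + 1 + S := ⟨3 * N - S - 1, by omega⟩
  have hmR : 3 * (N : ℝ) = m + 1 + S := by exact_mod_cast hm
  have hz : InZone N S (m + 1) := ⟨by omega, by omega⟩
  have hamp := gAmp_sq h hz
  have hr := (gAmp_spec h hz).1
  have hlow : (N : ℝ) ≤ gAmp N (m + 1) ^ 2 * S * 20 := by
    have e1 : ((m + 1 : ℕ) : ℝ) = 3 * N - S := by push_cast; linarith
    rw [e1] at hamp
    have e2 : gAmp N (m + 1) ^ 2 * S * (24 * N) ≥ 4 * (3 * (N : ℝ) - S) ^ 2 := by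
      rw [← hamp]
      have : 0 ≤ gAmp N (m + 1) ^ 2 * S * S := by positivity
      nlinarith
    have e3 : 4 * (3 * (N : ℝ) - S) ^ 2 ≥ 4 * (2 * N) ^ 2 := by
      gcongr; linarith
    have e4 : (24 * N) * (N : ℝ) ≤ (24 * N) * (gAmp N (m + 1) ^ 2 * S * 20) := by nlinarith
    exact le_of_mul_le_mul_left e4 (by positivity)
  have hdiag : -1 ≤ gDiag N (m + 1) := by
    unfold gDiag
    have : (0 : ℝ) < 2 * ((m + 1 : ℕ) : ℝ) := by positivity
    have : 3 * (N : ℝ) / (2 * ((m + 1 : ℕ) : ℝ)) ≤ 7 / 2 := by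
      rw [div_le_iff₀ this]; push_cast; linarith
    linarith
  have hstart := (gWeighted_le_edgeBound h hz).2
  have hslope := (slope_le_edgeBound h hz hlow).1 hdiag
  rw [Nat.add_sub_cancel] at hstart hslope
  have key := gronwall_second_difference (e := fun j => gWeighted N (m + j))
    (ε := 3 * edgeWidth N S) (B := edgeBound N S) (n := S) (by positivity) hB
    (fun j hj => by
      have e1 := gWeighted_rec N (m + j)
      have e2 : gWeighted N (m + (j + 2)) - 2 * gWeighted N (m + (j + 1)) + gWeighted N (m + j) =
          (gDiag N (m + j + 1) - 2) * gWeighted N (m + (j + 1)) := by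
        rw [← add_assoc, ← add_assoc]; linarith
      show |gWeighted N (m + (j + 2)) - 2 * gWeighted N (m + (j + 1)) + gWeighted N (m + j)| ≤ _
      rw [e2, abs_mul]
      gcongr
      have hjR : (j : ℝ) + 1 ≤ S := by exact_mod_cast hj
      have hj0 : (0 : ℝ) ≤ j := Nat.cast_nonneg j
      have hp : (0 : ℝ) < ((m + j + 1 : ℕ) : ℝ) := by positivity
      have e3 : gDiag N (m + j + 1) - 2 = -((S - j) / (2 * ((m + j + 1 : ℕ) : ℝ))) := by
        unfold gDiag
        field_simp
        push_cast
        linarith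
      have e4 : (3 * edgeWidth N S) ^ 2 = 9 * S / N := by
        rw [eq_div_iff hN.ne', ← hw2]; ring
      rw [e3, abs_neg, e4, abs_of_nonneg (by apply div_nonneg <;> linarith),
        div_le_div_iff₀ (by positivity) hN]
      push_cast
      nlinarith)
    hstart (by simpa using hslope) (k - m) (by omega)
  obtain ⟨k1, k2⟩ := key
  have hexp := edgeExp_le h (j := k - m) (by omega)
  simp only [show m + (k - m) = k by omega, show m + (k - m + 1) = k + 1 by omega] at k1 k2
  constructor
  · exact k1.trans (by gcongr)
  · exact k2.trans (by gcongr)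

/-- Size times slope is 3w times the squared size, and w cancels because the squared edge bound is
50G/w. -/
theorem edge_product_le (h : EdgeScale N S) {x y : ℝ} (hx : |x| ≤ edgeBound N S * edgeConst)
    (hy : |y| ≤ 3 * edgeWidth N S * (edgeBound N S * edgeConst)) :
    |x * y| ≤ 150 * edgeConst ^ 2 * gInv N N := by
  have hw := edgeWidth_pos h
  have hB := edgeBound_nonneg (N := N) (S := S)
  have hC := edgeConst_pos
  rw [abs_mul]
  calc |x| * |y| ≤ (edgeBound N S * edgeConst) *
        (3 * edgeWidth N S * (edgeBound N S * edgeConst)) := by gcongr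
    _ = 3 * edgeWidth N S * edgeConst ^ 2 * edgeBound N S ^ 2 := by ring
    _ = _ := by
      rw [edgeBound_sq h]
      field_simp
      ring

/-- Analyticity on |z| < 2 makes c_k → 0, so the sequence is the recessive solution. The start 3N -
1 is chosen because x_k ≥ 2 from 3N on. -/
theorem rightExterior (h : EdgeScale N S) :
    (∀ k, 3 * N ≤ k + 1 → |gWeighted N (k + 1)| ≤ |gWeighted N k|) ∧
      ∀ n, ∑ k ∈ Finset.Ioc (3 * N - 1) (3 * N - 1 + n), (gDiag N k - 2) * gWeighted N k ^ 2 ≤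
        150 * edgeConst ^ 2 * gInv N N := by
  have hN := h.pos
  have hS := h.leNat
  have key := recessive_bounds (c := gWeighted N) (η := fun k => gDiag N k - 2) (m := 3 * N - 1)
    (fun k _ => by rw [gWeighted_rec]; ring)
    (fun k hk => by
      have h1 : 3 * (N : ℝ) ≤ k := by exact_mod_cast (by omega : 3 * N ≤ k)
      have h2 : (0 : ℝ) < k := by have := h.posR; linarith
      show 0 ≤ gDiag N k - 2
      unfold gDiag
      have : 3 * (N : ℝ) / (2 * k) ≤ 1 / 2 := by
        rw [div_le_iff₀ (by positivity)]; linarith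
      linarith)
    (tendsto_mul_gCoeff N)
  refine ⟨fun k hk => key.1 k (by omega), fun n => (key.2 n).trans ?_⟩
  obtain ⟨h1, h2⟩ := rightTransition h (k := 3 * N - 1) (by omega) (by omega)
  exact edge_product_le h h1 h2

theorem rightSup (h : EdgeScale N S) (hk : 3 * N ≤ k + S + 1) :
    |gWeighted N k| ≤ edgeBound N S * edgeConst := by
  have hN := h.pos
  by_cases hc : k + 1 ≤ 3 * N
  · exact (rightTransition h hk hc).1
  · obtain ⟨n, rfl⟩ : ∃ n, k = 3 * N - 1 + n := ⟨k - (3 * N - 1), by omega⟩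
    clear hc hk
    induction n with
    | zero => exact (rightTransition h (by omega) (by omega)).1
    | succ n ih => exact ((rightExterior h).1 (3 * N - 1 + n) (by omega)).trans ih

/-- At distance S beyond the edge x_k - 2 = (k - 3N)/(2k) ≥ S/(8N), so the weighted sum of
`rightExterior` controls the unweighted one. -/
theorem rightTail (h : EdgeScale N S) (F : Finset ℕ) (hF : ∀ k ∈ F, 3 * N + S ≤ k) :
    ∑ k ∈ F, gWeighted N k ^ 2 ≤ 1200 * edgeConst ^ 2 * gInv N N * (N / S) := by
  have hN := h.posR
  have hS := h.posS
  have hSN := h.le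
  have hNn := h.pos
  obtain ⟨n, hn⟩ : ∃ n, F ⊆ Finset.Ioc (3 * N - 1) (3 * N - 1 + n) := by
    refine ⟨F.sup id, fun k hk => Finset.mem_Ioc.2 ⟨?_, ?_⟩⟩
    · have := hF k hk; omega
    · have : k ≤ F.sup id := Finset.le_sup (f := id) hk
      omega
  have hη : ∀ k, 3 * N ≤ k → 0 ≤ gDiag N k - 2 := by
    intro k hk
    have h1 : 3 * (N : ℝ) ≤ k := by exact_mod_cast hk
    have h2 : (0 : ℝ) < k := by linarith
    unfold gDiag
    have : 3 * (N : ℝ) / (2 * k) ≤ 1 / 2 := by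
      rw [div_le_iff₀ (by positivity)]; linarith
    linarith
  have hη2 : ∀ k, 3 * N + S ≤ k → (S : ℝ) / (8 * N) ≤ gDiag N k - 2 := by
    intro k hk
    have h1 : 3 * (N : ℝ) + S ≤ k := by exact_mod_cast hk
    have h2 : (0 : ℝ) < k := by linarith
    have e : gDiag N k - 2 = (k - 3 * N) / (2 * k) := by
      unfold gDiag; field_simp; ring
    rw [e, div_le_div_iff₀ (by positivity) (by positivity)]
    nlinarith
  have h1 : ∑ k ∈ F, (S : ℝ) / (8 * N) * gWeighted N k ^ 2 ≤ 150 * edgeConst ^ 2 * gInv N N := by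
    calc _ ≤ ∑ k ∈ F, (gDiag N k - 2) * gWeighted N k ^ 2 := by
          refine Finset.sum_le_sum fun k hk => ?_
          have := hη2 k (hF k hk)
          gcongr
      _ ≤ ∑ k ∈ Finset.Ioc (3 * N - 1) (3 * N - 1 + n), (gDiag N k - 2) * gWeighted N k ^ 2 := by
          refine Finset.sum_le_sum_of_subset_of_nonneg hn fun k hk _ => ?_
          have := (Finset.mem_Ioc.1 hk).1
          exact mul_nonneg (hη k (by omega)) (sq_nonneg _)
      _ ≤ _ := (rightExterior h).2 n
  rw [← Finset.mul_sum] at h1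
  calc ∑ k ∈ F, gWeighted N k ^ 2
      = (8 * N / S) * ((S : ℝ) / (8 * N) * ∑ k ∈ F, gWeighted N k ^ 2) := by field_simp
    _ ≤ (8 * N / S) * (150 * edgeConst ^ 2 * gInv N N) := by gcongr
    _ = _ := by ring

end RightEdge

/-! ### The left turning point k = N/3. -/

section LeftEdge

variable {N S k : ℕ}

theorem two_add_gDiag (hk : 0 < k) : 2 + gDiag N k = 3 * (3 * k - N) / (2 * k) := by
  have : (k : ℝ) ≠ 0 := by positivity
  unfold gDiag
  field_simp
  ring

theorem leftTransition (h : EdgeScale N S) (hk1 : N ≤ 3 * k + 2) (hk2 : 3 * k ≤ N + S + 2) :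
    |gWeighted N k| ≤ edgeBound N S * edgeConst ∧
      (3 * k ≤ N → |gWeighted N (k + 1) + gWeighted N k| ≤
        3 * edgeWidth N S * (edgeBound N S * edgeConst)) := by
  have hS := h.leNat
  have hL := h.largeNat
  have hSR := h.le
  have hLR := h.large
  have hN := h.posR
  have hw := edgeWidth_pos h
  have hw2 := edgeWidth_sq h
  have hB := edgeBound_nonneg (N := N) (S := S)
  obtain ⟨m, hm1, hm2⟩ : ∃ m, N + S ≤ 3 * m ∧ 3 * m ≤ N + S + 2 :=
    ⟨(N + S + 2) / 3, by omega, by omega⟩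
  have hm1R : (N : ℝ) + S ≤ 3 * m := by exact_mod_cast hm1
  have hm2R : (3 : ℝ) * m ≤ N + S + 2 := by exact_mod_cast hm2
  have hz : InZone N S m := ⟨hm1, by omega⟩
  have hm0 : (0 : ℝ) < m := by linarith
  have hamp := gAmp_sq h hz
  have hr := (gAmp_spec h hz).1
  have hlow : (N : ℝ) ≤ gAmp N m ^ 2 * S * 20 := by
    have e2 : gAmp N m ^ 2 * S * (80 / 9 * N) ≥ 4 * (m : ℝ) ^ 2 := by
      rw [← hamp]
      have : (3 * (3 * (N : ℝ) - m) * (3 * m - N)) ≤ S * (80 / 9 * N) := by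
        have : (3 * (m : ℝ) - N) ≤ 10 / 9 * S := by linarith
        have : (3 * (N : ℝ) - m) ≤ 8 / 3 * N := by linarith
        nlinarith
      have := mul_le_mul_of_nonneg_left this (sq_nonneg (gAmp N m))
      linarith
    have e3 : 4 * (m : ℝ) ^ 2 ≥ 4 * (N / 3) ^ 2 := by
      gcongr; linarith
    have e4 : (80 / 9 * N) * (N : ℝ) ≤ (80 / 9 * N) * (gAmp N m ^ 2 * S * 20) := by nlinarith
    exact le_of_mul_le_mul_left e4 (by positivity)
  have hdiag : gDiag N m ≤ 1 := by
    unfold gDiag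
    have : 3 / 2 ≤ 3 * (N : ℝ) / (2 * m) := by
      rw [le_div_iff₀ (by positivity)]; linarith
    linarith
  have hstart := (gWeighted_le_edgeBound h hz).1
  have hslope := (slope_le_edgeBound h hz hlow).2 hdiag
  -- Gronwall is run backward from m = ⌈(N + S)/3⌉. Since x ≈ -2 here, the sign (-1)^j turns the
  -- recurrence into a small perturbation of a vanishing second difference.
  have key := gronwall_second_difference (e := fun j => (-1) ^ j * gWeighted N (m - j))
    (ε := 3 * edgeWidth N S) (B := edgeBound N S) (n := m - k) (by positivity) hB
    (fun j hj => by
      obtain ⟨i, hi⟩ : ∃ i, m = i + 2 + j ∨ m = i + 1 + j ∧ i = 0 :=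
        ⟨m - j - 2, by omega⟩
      rcases hi with hi | ⟨hi, hi0⟩
      swap
      · omega
      have e1 := gWeighted_rec N i
      have e2 : (-1 : ℝ) ^ (j + 2) * gWeighted N i - 2 * ((-1) ^ (j + 1) * gWeighted N (i + 1)) +
          (-1) ^ j * gWeighted N (i + 2) =
          -(2 + gDiag N (i + 1)) * ((-1) ^ (j + 1) * gWeighted N (i + 1)) := by
        rw [pow_succ, pow_succ]
        linear_combination (-1) ^ j * e1
      simp only [show m - (j + 2) = i by omega, show m - (j + 1) = i + 1 by omega,
        show m - j = i + 2 by omega]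
      rw [e2, abs_mul]
      gcongr
      have hi1 : (N : ℝ) ≤ 3 * ((i + 1 : ℕ) : ℝ) + 2 := by
        exact_mod_cast (by omega : N ≤ 3 * (i + 1) + 2)
      have hi2 : 3 * ((i + 1 : ℕ) : ℝ) ≤ N + S + 2 := by
        exact_mod_cast (by omega : 3 * (i + 1) ≤ N + S + 2)
      have hp : (0 : ℝ) < ((i + 1 : ℕ) : ℝ) := by positivity
      have e4 : (3 * edgeWidth N S) ^ 2 = 9 * S / N := by
        rw [eq_div_iff hN.ne', ← hw2]; ring
      rw [two_add_gDiag (by omega), abs_neg, e4, abs_div, abs_of_pos (by positivity : (0 : ℝ) <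
        2 * ((i + 1 : ℕ) : ℝ)), div_le_div_iff₀ (by positivity) hN]
      have : |3 * (3 * ((i + 1 : ℕ) : ℝ) - N)| ≤ 3 * (S + 2) := by
        rw [abs_le]; constructor <;> linarith
      nlinarith)
    (by simpa using hstart)
    (by
      simp only [pow_one, pow_zero, Nat.sub_zero, one_mul]
      rw [show -1 * gWeighted N (m - 1) - gWeighted N m =
        -(gWeighted N m + gWeighted N (m - 1)) by ring, abs_neg]
      exact hslope)
  constructor
  · by_cases hkm : k ≤ m
    · have k1 := (key (m - k) le_rfl).1
      have hexp := edgeExp_le h (j := m - k) (by omega)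
      rw [show m - (m - k) = k by omega, abs_mul, abs_pow, abs_neg, abs_one, one_pow, one_mul] at k1
      exact k1.trans (by gcongr)
    · omega
  · intro hk3
    have k2 := (key (m - k - 1) (by omega)).2
    have hexp := edgeExp_le h (j := m - k - 1) (by omega)
    rw [show m - (m - k - 1 + 1) = k by omega, show m - (m - k - 1) = k + 1 by omega, pow_succ,
      show (-1 : ℝ) ^ (m - k - 1) * -1 * gWeighted N k - (-1) ^ (m - k - 1) * gWeighted N (k + 1) =
        (-1) ^ (m - k - 1) * -(gWeighted N (k + 1) + gWeighted N k) by ring, abs_mul, abs_pow,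
      abs_neg, abs_one, one_pow, one_mul, abs_neg] at k2
    exact k2.trans (by gcongr)

theorem leftExterior (h : EdgeScale N S) :
    (∀ k, 3 * k ≤ N → (1 + -(2 + gDiag N k)) * |gWeighted N k| ≤ |gWeighted N (k + 1)|) ∧
      ∑ k ∈ Finset.Ioc 0 (N / 3), -(2 + gDiag N k) * gWeighted N k ^ 2 ≤
        150 * edgeConst ^ 2 * gInv N N := by
  have key := dominant_bounds (c := gWeighted N) (η := fun k => -(2 + gDiag N k)) (K := N / 3)
    (gWeighted_zero N) (fun k _ => by rw [gWeighted_rec]; ring)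
    (fun k hk0 hk => by
      have h1 : 3 * (k : ℝ) ≤ N := by exact_mod_cast (by omega : 3 * k ≤ N)
      have h2 : (0 : ℝ) < k := by exact_mod_cast hk0
      show 0 ≤ -(2 + gDiag N k)
      rw [two_add_gDiag hk0, neg_nonneg]
      exact div_nonpos_of_nonpos_of_nonneg (by linarith) (by positivity))
  refine ⟨fun k hk => key.1 k (by omega), key.2.trans ?_⟩
  obtain ⟨h1, h2⟩ := leftTransition h (k := N / 3) (by omega) (by omega)
  exact edge_product_le h h1 (h2 (by omega))

theorem leftGrowth (h : EdgeScale N S) (hk0 : 0 < k) (hk : 3 * k ≤ N) :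
    |gWeighted N k| ≤ |gWeighted N (k + 1)| := by
  have h1 : 3 * (k : ℝ) ≤ N := by exact_mod_cast hk
  have h2 : (0 : ℝ) < k := by exact_mod_cast hk0
  have h3 := (leftExterior h).1 k hk
  have h4 : 2 + gDiag N k ≤ 0 := by
    rw [two_add_gDiag hk0]
    exact div_nonpos_of_nonpos_of_nonneg (by linarith) (by positivity)
  have := abs_nonneg (gWeighted N k)
  nlinarith

theorem leftSup (h : EdgeScale N S) (hk : 3 * k ≤ N + S + 2) :
    |gWeighted N k| ≤ edgeBound N S * edgeConst := by
  have hB := edgeBound_nonneg (N := N) (S := S)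
  have hC := edgeConst_pos
  by_cases hc : N ≤ 3 * k + 2
  · exact (leftTransition h hc hk).1
  · rcases Nat.eq_zero_or_pos k with rfl | hk0
    · rw [gWeighted_zero, abs_zero]; positivity
    · have hle : ∀ j, k ≤ j → j ≤ N / 3 → |gWeighted N k| ≤ |gWeighted N j| := by
        intro j hj
        induction j, hj using Nat.le_induction with
        | base => intro _; exact le_rfl
        | succ j hj ih =>
          intro hj2
          exact (ih (by omega)).trans (leftGrowth h (by omega) (by omega))
      exact (hle (N / 3) (by omega) le_rfl).trans
        (leftTransition h (k := N / 3) (by omega) (by omega)).1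

theorem leftTail (h : EdgeScale N S) (F : Finset ℕ) (hF : ∀ k ∈ F, 0 < k ∧ 3 * k + S ≤ N) :
    ∑ k ∈ F, gWeighted N k ^ 2 ≤ 150 * edgeConst ^ 2 * gInv N N * (N / S) := by
  have hN := h.posR
  have hS := h.posS
  have hη : ∀ k, 0 < k → 3 * k ≤ N → 0 ≤ -(2 + gDiag N k) := by
    intro k hk0 hk
    have h1 : 3 * (k : ℝ) ≤ N := by exact_mod_cast hk
    have h2 : (0 : ℝ) < k := by exact_mod_cast hk0
    rw [two_add_gDiag hk0, neg_nonneg]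
    exact div_nonpos_of_nonpos_of_nonneg (by linarith) (by positivity)
  have hη2 : ∀ k, 0 < k → 3 * k + S ≤ N → (S : ℝ) / N ≤ -(2 + gDiag N k) := by
    intro k hk0 hk
    have h1 : 3 * (k : ℝ) + S ≤ N := by exact_mod_cast hk
    have h2 : (0 : ℝ) < k := by exact_mod_cast hk0
    rw [two_add_gDiag hk0, ← neg_div, div_le_div_iff₀ hN (by positivity)]
    nlinarith
  have h1 : ∑ k ∈ F, (S : ℝ) / N * gWeighted N k ^ 2 ≤ 150 * edgeConst ^ 2 * gInv N N := by
    calc _ ≤ ∑ k ∈ F, -(2 + gDiag N k) * gWeighted N k ^ 2 := by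
          refine Finset.sum_le_sum fun k hk => ?_
          have := hη2 k (hF k hk).1 (hF k hk).2
          gcongr
      _ ≤ ∑ k ∈ Finset.Ioc 0 (N / 3), -(2 + gDiag N k) * gWeighted N k ^ 2 := by
          refine Finset.sum_le_sum_of_subset_of_nonneg (fun k hk => ?_) fun k hk _ => ?_
          · have := hF k hk
            exact Finset.mem_Ioc.2 ⟨this.1, by omega⟩
          · have := Finset.mem_Ioc.1 hk
            exact mul_nonneg (hη k this.1 (by omega)) (sq_nonneg _)
      _ ≤ _ := (leftExterior h).2
  rw [← Finset.mul_sum] at h1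
  calc ∑ k ∈ F, gWeighted N k ^ 2
      = (N / S) * ((S : ℝ) / N * ∑ k ∈ F, gWeighted N k ^ 2) := by field_simp
    _ ≤ (N / S) * (150 * edgeConst ^ 2 * gInv N N) := by gcongr
    _ = _ := by ring

/-- Below `N / 6` the coefficients grow geometrically. -/
theorem gCoeff_growth (h : EdgeScale N S) (hk : 6 * k ≤ N) :
    2 * gCoeff N k ^ 2 ≤ gCoeff N (k + 1) ^ 2 := by
  have hN := h.posR
  have hNL : (1000 : ℝ) ≤ N := by
    have := h.le
    have := h.large
    linarith
  rcases Nat.eq_zero_or_pos k with rfl | hk0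
  · rw [zero_add, gCoeff_one]
    have : (1000 : ℝ) ^ 2 ≤ (N : ℝ) ^ 2 := by gcongr
    nlinarith [sq_nonneg (gCoeff N 0)]
  · have h1 : 6 * (k : ℝ) ≤ N := by exact_mod_cast hk
    have h2 : (1 : ℝ) ≤ k := by exact_mod_cast hk0
    have h3 := (leftExterior h).1 k (by omega)
    have h4 : 9 / 2 ≤ -(2 + gDiag N k) := by
      rw [two_add_gDiag hk0, ← neg_div, le_div_iff₀ (by positivity)]
      linarith
    have h5 : 11 / 2 * |gWeighted N k| ≤ |gWeighted N (k + 1)| := by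
      refine le_trans ?_ h3
      gcongr
      linarith
    unfold gWeighted at h5
    rw [abs_mul, abs_mul, Nat.abs_cast, Nat.abs_cast] at h5
    push_cast at h5
    have h6 : 2 * |gCoeff N k| ≤ |gCoeff N (k + 1)| := by
      have e1 : ((k : ℝ) + 1) * |gCoeff N (k + 1)| ≤ (2 * k) * |gCoeff N (k + 1)| := by
        gcongr; linarith
      have e2 : k * (2 * |gCoeff N k|) ≤ k * |gCoeff N (k + 1)| := by
        have : 0 ≤ k * |gCoeff N k| := by positivity
        linarith
      exact le_of_mul_le_mul_left e2 (by linarith)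
    have h7 : (2 * |gCoeff N k|) ^ 2 ≤ |gCoeff N (k + 1)| ^ 2 := by gcongr
    rw [mul_pow, sq_abs, sq_abs] at h7
    nlinarith [sq_nonneg (gCoeff N k)]

/-- Near k = 0 bounds on k a_k say little about a_k. Geometric growth transfers the whole initial
segment to an index near N/6, where the weight is harmless. -/
theorem sum_gCoeff_sq_small (h : EdgeScale N S) {n : ℕ} (hn : 6 * n ≤ N + 6) :
    ∑ k ∈ Finset.range (n + 1), gCoeff N k ^ 2 ≤ 2 * gCoeff N n ^ 2 := by
  induction n with
  | zero => simp; nlinarith [sq_nonneg (gCoeff N 0)]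
  | succ n ih =>
    rw [Finset.sum_range_succ]
    have := ih (by omega)
    have := gCoeff_growth h (k := n) (by omega)
    linarith

end LeftEdge

/-! ### Bounds for the coefficients and normalization by Parseval. -/

section Coefficients

variable {N S k : ℕ}

/-- The normalized adiabatic invariant. -/
noncomputable def gNormal (N : ℕ) : ℝ := gInv N N / N

theorem gNormal_nonneg (h : EdgeScale N S) : 0 ≤ gNormal N :=
  div_nonneg (gInv_nonneg h h.center) (Nat.cast_nonneg N)

theorem gWeighted_sq (N k : ℕ) : gWeighted N k ^ 2 = (k : ℝ) ^ 2 * gCoeff N k ^ 2 := by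
  unfold gWeighted; ring

theorem gAmp_le (h : EdgeScale N S) (hz : InZone N S k) :
    gAmp N k ≤ 5 / 2 * (N * (N * edgeDist N k : ℝ) ^ (-(1 / 2) : ℝ)) := by
  have hm := edgeDist_pos h hz
  have hN := h.posR
  have h4 := gAmp_sq_le h hz
  refine (abs_le_of_sq_le_sq' ?_ (by positivity)).2
  have e : ((N * edgeDist N k : ℝ) ^ (-(1 / 2) : ℝ)) ^ 2 = (N * edgeDist N k : ℝ)⁻¹ := by
    rw [← Real.rpow_natCast, ← Real.rpow_mul (by positivity), ← Real.rpow_neg_one]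
    norm_num
  rw [mul_pow, mul_pow, e]
  have : (5 / 2) ^ 2 * ((N : ℝ) ^ 2 * (N * edgeDist N k : ℝ)⁻¹) = 25 / 4 * N / edgeDist N k := by
    field_simp; norm_num
  rw [this, le_div_iff₀ hm]
  linarith

/-- Pointwise bound in the oscillatory range. -/
theorem gCoeff_sq_le_zone (h : EdgeScale N S) (hz : InZone N S k) :
    gCoeff N k ^ 2 ≤ 450 * gNormal N * (N * edgeDist N k : ℝ) ^ (-(1 / 2) : ℝ) := by
  have hN := h.posR
  have hG := gInv_nonneg h h.center
  have h1 := (gWeighted_sq_le h hz).1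
  have h2 := gAmp_le h hz
  set X := (N * edgeDist N k : ℝ) ^ (-(1 / 2) : ℝ)
  rw [gWeighted_sq] at h1
  have hk : (N : ℝ) / 3 ≤ k := by have := hz.leftR; have := h.posS; linarith
  have h3 : ((N : ℝ) / 3) ^ 2 * gCoeff N k ^ 2 ≤ k ^ 2 * gCoeff N k ^ 2 := by gcongr
  have h4 : 20 * gInv N N * gAmp N k ≤ 20 * gInv N N * (5 / 2 * (N * X)) := by gcongr
  have h5 : (N : ℝ) ^ 2 * gCoeff N k ^ 2 ≤ (N : ℝ) ^ 2 * (450 * gNormal N * X) := by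
    have : (N : ℝ) ^ 2 * (450 * gNormal N * X) = 450 * gInv N N * N * X := by
      unfold gNormal; field_simp
    rw [this]
    linarith
  exact le_of_mul_le_mul_left h5 (by positivity)

/-- The constant in the bounds outside of the oscillatory range. -/
noncomputable def outerConst : ℝ := 10 ^ 14 * edgeConst ^ 2

theorem outerConst_pos : 0 < outerConst := by
  have := edgeConst_pos
  unfold outerConst; positivity

/-- The edge bound is of order G/w, and S² = (wS)(wN) with wS bounded turns 1/w into a multiple of
N/S². Dividing by k² later gives the size S⁻² ≈ N^{-2/3}. -/
theorem edge_sq_le (h : EdgeScale N S) {y : ℝ} (hy : |y| ≤ edgeBound N S * edgeConst) :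
    y ^ 2 ≤ 10 ^ 12 / 5 * edgeConst ^ 2 * gNormal N * ((N : ℝ) ^ 2 / S ^ 2) := by
  have hN := h.posR
  have hS := h.posS
  have hw := edgeWidth_pos h
  have hw2 := edgeWidth_sq h
  have hw3 := edgeWidth_mul_le h
  have hR := gNormal_nonneg h
  have hG : gInv N N = gNormal N * N := by unfold gNormal; field_simp
  have h1 : y ^ 2 ≤ (edgeBound N S * edgeConst) ^ 2 := by rw [← sq_abs]; gcongr
  rw [mul_pow, edgeBound_sq h, hG] at h1
  have h2 : 1 / edgeWidth N S ≤ 10 ^ 9 * 33 / 10 * (N / (S : ℝ) ^ 2) := by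
    rw [div_le_iff₀ hw, mul_div_assoc', div_mul_eq_mul_div, le_div_iff₀ (by positivity), one_mul]
    calc (S : ℝ) ^ 2 = S * (edgeWidth N S ^ 2 * N) := by rw [hw2]; ring
      _ = (edgeWidth N S * S) * (edgeWidth N S * N) := by ring
      _ ≤ (10 ^ 9 * 33 / 10) * (edgeWidth N S * N) := by gcongr
      _ = _ := by ring
  calc y ^ 2 ≤ 50 * (gNormal N * N) / edgeWidth N S * edgeConst ^ 2 := h1
    _ = 50 * (gNormal N * N) * edgeConst ^ 2 * (1 / edgeWidth N S) := by ring
    _ ≤ 50 * (gNormal N * N) * edgeConst ^ 2 * (10 ^ 9 * 33 / 10 * (N / (S : ℝ) ^ 2)) := by gcongr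
    _ = 10 ^ 9 * 165 * edgeConst ^ 2 * gNormal N * ((N : ℝ) ^ 2 / S ^ 2) := by ring
    _ ≤ _ := by gcongr; norm_num

theorem gCoeff_sq_le_of_gWeighted (hk : N ≤ 6 * k) (hN : 0 < N) {X : ℝ}
    (h : gWeighted N k ^ 2 ≤ X * (N : ℝ) ^ 2) : gCoeff N k ^ 2 ≤ 36 * X := by
  have hkR : (N : ℝ) / 6 ≤ k := by
    have : (N : ℝ) ≤ 6 * k := by exact_mod_cast hk
    linarith
  have hN' : (0 : ℝ) < N := by exact_mod_cast hN
  rw [gWeighted_sq] at h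
  have h3 : ((N : ℝ) / 6) ^ 2 * gCoeff N k ^ 2 ≤ k ^ 2 * gCoeff N k ^ 2 := by gcongr
  have h5 : (N : ℝ) ^ 2 * gCoeff N k ^ 2 ≤ (N : ℝ) ^ 2 * (36 * X) := by linarith
  exact le_of_mul_le_mul_left h5 (by positivity)

theorem gCoeff_sq_le_outer_aux (h : EdgeScale N S) (hk : N ≤ 6 * k) (hz : ¬ InZone N S k) :
    gCoeff N k ^ 2 ≤ 36 * (10 ^ 12 / 5 * edgeConst ^ 2 * gNormal N / (S : ℝ) ^ 2) := by
  have hw : |gWeighted N k| ≤ edgeBound N S * edgeConst := by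
    by_cases hc : 3 * k ≤ N + S
    · exact leftSup h (by omega)
    · exact rightSup h (by
        by_contra hcc
        exact hz ⟨by omega, by omega⟩)
  refine gCoeff_sq_le_of_gWeighted hk h.pos ((edge_sq_le h hw).trans (le_of_eq ?_))
  ring

theorem sum_gCoeff_sq_range_le (h : EdgeScale N S) :
    ∑ k ∈ Finset.range (N / 6 + 2), gCoeff N k ^ 2 ≤
      72 * (10 ^ 12 / 5 * edgeConst ^ 2 * gNormal N / (S : ℝ) ^ 2) := by
  have hL := h.leNat
  have hS := h.largeNat
  have h1 := sum_gCoeff_sq_small h (n := N / 6 + 1) (by omega)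
  have h2 := gCoeff_sq_le_outer_aux h (k := N / 6 + 1) (by omega) (fun hz => by
    have := hz.left
    omega)
  linarith

/-- Pointwise bound outside of the oscillatory range. -/
theorem gCoeff_sq_le_outer (h : EdgeScale N S) (hz : ¬ InZone N S k) :
    gCoeff N k ^ 2 ≤ outerConst * gNormal N / (S : ℝ) ^ 2 := by
  have hR := gNormal_nonneg h
  have hX : 0 ≤ edgeConst ^ 2 * gNormal N / (S : ℝ) ^ 2 := by positivity
  have e : outerConst * gNormal N / (S : ℝ) ^ 2 =
    10 ^ 14 * (edgeConst ^ 2 * gNormal N / (S : ℝ) ^ 2) := by unfold outerConst; ring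
  by_cases hk : N ≤ 6 * k
  · have h1 := gCoeff_sq_le_outer_aux h hk hz
    rw [e]
    refine h1.trans ?_
    rw [show 36 * (10 ^ 12 / 5 * edgeConst ^ 2 * gNormal N / (S : ℝ) ^ 2) =
      36 * (10 ^ 12 / 5) * (edgeConst ^ 2 * gNormal N / (S : ℝ) ^ 2) by ring]
    gcongr
    norm_num
  · have h1 := Finset.single_le_sum (f := fun k => gCoeff N k ^ 2) (fun i _ => sq_nonneg _)
      (Finset.mem_range.2 (by omega : k < N / 6 + 2))
    refine h1.trans ((sum_gCoeff_sq_range_le h).trans ?_)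
    rw [e, show 72 * (10 ^ 12 / 5 * edgeConst ^ 2 * gNormal N / (S : ℝ) ^ 2) =
      72 * (10 ^ 12 / 5) * (edgeConst ^ 2 * gNormal N / (S : ℝ) ^ 2) by ring]
    gcongr
    norm_num

theorem sum_le_of_subset_union {ι : Type*} [DecidableEq ι] {f : ι → ℝ} (hf : ∀ i, 0 ≤ f i)
    {F A B : Finset ι} (h : F ⊆ A ∪ B) : ∑ i ∈ F, f i ≤ ∑ i ∈ A, f i + ∑ i ∈ B, f i := by
  have h1 := Finset.sum_le_sum_of_subset_of_nonneg (f := f) h fun i _ _ => hf i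
  have h2 := Finset.sum_union_inter (s₁ := A) (s₂ := B) (f := f)
  have h3 : 0 ≤ ∑ i ∈ A ∩ B, f i := Finset.sum_nonneg fun i _ => hf i
  linarith

/-- Square sums outside of the oscillatory range. -/
theorem sum_gCoeff_sq_outer_le (h : EdgeScale N S) (F : Finset ℕ)
    (hF : ∀ k ∈ F, ¬ InZone N S k) :
    ∑ k ∈ F, gCoeff N k ^ 2 ≤ 10 * outerConst * gNormal N / S := by
  have hN := h.posR
  have hS := h.posS
  have hL := h.leNat
  have hSn := h.largeNat
  have hNn := h.pos
  have hR := gNormal_nonneg h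
  have hO := outerConst_pos
  have hf : ∀ k, 0 ≤ gCoeff N k ^ 2 := fun k => sq_nonneg _
  -- The complement of the zone splits into the initial segment, two exterior tails A and B handled
  -- by the weighted sums, and two strips C and D around the edges, each with at most 2S indices of
  -- size O(S⁻²).
  set A := F.filter fun k => 3 * N + S ≤ k with hA
  set B := F.filter fun k => N ≤ 6 * k ∧ 3 * k + S ≤ N with hB
  set C := F.filter fun k => k < 3 * N + S ∧ 3 * N < k + S with hC
  set D := F.filter fun k => 3 * k < N + S ∧ N < 3 * k + S with hD
  have hsub : F ⊆ (Finset.range (N / 6 + 2) ∪ A) ∪ (B ∪ (C ∪ D)) := by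
    intro k hk
    have hnz := hF k hk
    simp only [Finset.mem_union, Finset.mem_range, hA, hB, hC, hD, Finset.mem_filter, hk, true_and]
    by_contra hc
    exact hnz ⟨by omega, by omega⟩
  have s0 : ∑ k ∈ Finset.range (N / 6 + 2), gCoeff N k ^ 2 ≤ outerConst * gNormal N / S := by
    refine (sum_gCoeff_sq_range_le h).trans ?_
    have hS1 : (S : ℝ) ≤ S ^ 2 := by have := h.large; nlinarith
    calc 72 * (10 ^ 12 / 5 * edgeConst ^ 2 * gNormal N / (S : ℝ) ^ 2)
        ≤ 72 * (10 ^ 12 / 5 * edgeConst ^ 2 * gNormal N / (S : ℝ)) := by gcongr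
      _ = 72 * (10 ^ 12 / 5) * (edgeConst ^ 2 * gNormal N / S) := by ring
      _ ≤ 10 ^ 14 * (edgeConst ^ 2 * gNormal N / S) := by gcongr; norm_num
      _ = _ := by unfold outerConst; ring
  have hG : gInv N N = gNormal N * N := by unfold gNormal; field_simp
  have hcoeff : ∀ k, N ≤ 6 * k → gCoeff N k ^ 2 ≤ 36 / (N : ℝ) ^ 2 * gWeighted N k ^ 2 := by
    intro k hk
    have := gCoeff_sq_le_of_gWeighted hk hNn (X := gWeighted N k ^ 2 / (N : ℝ) ^ 2)
      (le_of_eq (by field_simp))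
    refine this.trans (le_of_eq (by ring))
  have sA : ∑ k ∈ A, gCoeff N k ^ 2 ≤ outerConst * gNormal N / S := by
    have hmem : ∀ k ∈ A, 3 * N + S ≤ k := fun k hk => (Finset.mem_filter.1 hk).2
    calc _ ≤ ∑ k ∈ A, 36 / (N : ℝ) ^ 2 * gWeighted N k ^ 2 :=
          Finset.sum_le_sum fun k hk => hcoeff k (by have := hmem k hk; omega)
      _ = 36 / (N : ℝ) ^ 2 * ∑ k ∈ A, gWeighted N k ^ 2 := by rw [Finset.mul_sum]
      _ ≤ 36 / (N : ℝ) ^ 2 * (1200 * edgeConst ^ 2 * gInv N N * (N / S)) := by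
          gcongr
          exact rightTail h A hmem
      _ = 43200 * (edgeConst ^ 2 * gNormal N / S) := by rw [hG]; field_simp; ring
      _ ≤ 10 ^ 14 * (edgeConst ^ 2 * gNormal N / S) := by gcongr; norm_num
      _ = _ := by unfold outerConst; ring
  have sB : ∑ k ∈ B, gCoeff N k ^ 2 ≤ outerConst * gNormal N / S := by
    have hmem : ∀ k ∈ B, N ≤ 6 * k ∧ 3 * k + S ≤ N := fun k hk => (Finset.mem_filter.1 hk).2
    calc _ ≤ ∑ k ∈ B, 36 / (N : ℝ) ^ 2 * gWeighted N k ^ 2 :=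
          Finset.sum_le_sum fun k hk => hcoeff k (hmem k hk).1
      _ = 36 / (N : ℝ) ^ 2 * ∑ k ∈ B, gWeighted N k ^ 2 := by rw [Finset.mul_sum]
      _ ≤ 36 / (N : ℝ) ^ 2 * (150 * edgeConst ^ 2 * gInv N N * (N / S)) := by
          gcongr
          exact leftTail h B fun k hk => ⟨by have := hmem k hk; omega, (hmem k hk).2⟩
      _ = 5400 * (edgeConst ^ 2 * gNormal N / S) := by rw [hG]; field_simp; ring
      _ ≤ 10 ^ 14 * (edgeConst ^ 2 * gNormal N / S) := by gcongr; norm_num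
      _ = _ := by unfold outerConst; ring
  have count : ∀ X : Finset ℕ, X ⊆ F → (X.card : ℝ) ≤ 2 * S →
      ∑ k ∈ X, gCoeff N k ^ 2 ≤ 2 * (outerConst * gNormal N / S) := by
    intro X hX hcard
    calc _ ≤ ∑ k ∈ X, outerConst * gNormal N / (S : ℝ) ^ 2 :=
          Finset.sum_le_sum fun k hk => gCoeff_sq_le_outer h (hF k (hX hk))
      _ = X.card * (outerConst * gNormal N / (S : ℝ) ^ 2) := by
          rw [Finset.sum_const, nsmul_eq_mul]
      _ ≤ (2 * S) * (outerConst * gNormal N / (S : ℝ) ^ 2) := by gcongr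
      _ = _ := by field_simp
  have sC := count C (Finset.filter_subset _ _) (by
    have hsub : C ⊆ Finset.Ioo (3 * N - S) (3 * N + S) := fun k hk => by
      have := (Finset.mem_filter.1 hk).2
      exact Finset.mem_Ioo.2 ⟨by omega, by omega⟩
    have := Finset.card_le_card hsub
    rw [Nat.card_Ioo] at this
    exact_mod_cast (by omega : C.card ≤ 2 * S))
  have sD := count D (Finset.filter_subset _ _) (by
    have hsub : D ⊆ Finset.Ioo ((N - S) / 3) ((N + S) / 3 + 1) := fun k hk => by
      have := (Finset.mem_filter.1 hk).2
      exact Finset.mem_Ioo.2 ⟨by omega, by omega⟩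
    have := Finset.card_le_card hsub
    rw [Nat.card_Ioo] at this
    exact_mod_cast (by omega : D.card ≤ 2 * S))
  have t1 := sum_le_of_subset_union hf hsub
  have t2 := sum_le_of_subset_union hf
    (subset_refl (Finset.range (N / 6 + 2) ∪ A))
  have t3 := sum_le_of_subset_union hf (subset_refl (B ∪ (C ∪ D)))
  have t4 := sum_le_of_subset_union hf (subset_refl (C ∪ D))
  have t5 : 0 ≤ outerConst * gNormal N / S := by positivity
  have t6 : 10 * outerConst * gNormal N / S = 10 * (outerConst * gNormal N / S) := by ring
  rw [t6]
  linarith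

theorem sum_edgeDist_le_of_lt_one (h : EdgeScale N S) {q : ℝ} (hq0 : 0 ≤ q) (hq : q < 1)
    {F : Finset ℕ} (hF : ∀ k ∈ F, InZone N S k) :
    ∑ k ∈ F, (edgeDist N k : ℝ) ^ (-q) ≤
      2 * (1 / (1 - q) * ((8 * N : ℕ) : ℝ) ^ (1 - q)) := by
  have hS := h.one_le
  have h1 := sum_rpow_neg_le_of_lt_one hq0 hq (M := 8 * N) F (fun k => 3 * N - k) (injOn_right hF)
    (fun k hk => by
      have := (hF k hk).right
      constructor <;> omega)
  have h2 := sum_rpow_neg_le_of_lt_one hq0 hq (M := 8 * N) F (fun k => 3 * k - N) (injOn_left hF)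
    (fun k hk => by
      have := (hF k hk).left
      have := (hF k hk).right
      constructor <;> omega)
  calc _ ≤ ∑ k ∈ F, (((3 * N - k : ℕ) : ℝ) ^ (-q) + ((3 * k - N : ℕ) : ℝ) ^ (-q)) :=
        Finset.sum_le_sum fun k _ => edgeDist_rpow_le N k _
    _ ≤ _ := by rw [Finset.sum_add_distrib]; linarith

theorem sum_edgeDist_inv_le (h : EdgeScale N S) {F : Finset ℕ} (hF : ∀ k ∈ F, InZone N S k) :
    ∑ k ∈ F, (edgeDist N k : ℝ) ^ (-1 : ℝ) ≤ 2 * (1 + Real.log (8 * N : ℕ)) := by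
  have hS := h.one_le
  have h1 := sum_inv_le_log (M := 8 * N) F (fun k => 3 * N - k) (injOn_right hF)
    (fun k hk => by
      have := (hF k hk).right
      constructor <;> omega)
  have h2 := sum_inv_le_log (M := 8 * N) F (fun k => 3 * k - N) (injOn_left hF)
    (fun k hk => by
      have := (hF k hk).left
      have := (hF k hk).right
      constructor <;> omega)
  calc _ ≤ ∑ k ∈ F, (((3 * N - k : ℕ) : ℝ) ^ (-1 : ℝ) + ((3 * k - N : ℕ) : ℝ) ^ (-1 : ℝ)) :=
        Finset.sum_le_sum fun k _ => edgeDist_rpow_le N k _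
    _ ≤ _ := by
      simp only [Real.rpow_neg_one]
      rw [Finset.sum_add_distrib]; linarith

/-- Parseval bounds the invariant from below. -/
theorem one_le_gNormal (h : EdgeScale N S) : 1 ≤ (6000 + 10 * outerConst) * gNormal N := by
  classical
  have hN := h.posR
  have hS := h.posS
  have hR := gNormal_nonneg h
  have hO := outerConst_pos
  refine hasSum_le_of_sum_le (hasSum_gCoeff_sq N) fun F => ?_
  rw [← Finset.sum_filter_add_sum_filter_not F (InZone N S)]
  have hZ : ∀ k ∈ F.filter (InZone N S), InZone N S k := fun k hk => (Finset.mem_filter.1 hk).2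
  have h1 := sum_gCoeff_sq_outer_le h (F.filter fun k => ¬ InZone N S k)
    (fun k hk => (Finset.mem_filter.1 hk).2)
  have h2 : 10 * outerConst * gNormal N / S ≤ 10 * outerConst * gNormal N := by
    refine div_le_self (by positivity) ?_
    have := h.large
    linarith
  have h3 := sum_edgeDist_le_of_lt_one h (q := 1 / 2) (by norm_num) (by norm_num) hZ
  have h4 : ∑ k ∈ F.filter (InZone N S), gCoeff N k ^ 2 ≤ 6000 * gNormal N := by
    calc _ ≤ ∑ k ∈ F.filter (InZone N S), 450 * gNormal N * (N : ℝ) ^ (-(1 / 2) : ℝ) *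
          (edgeDist N k : ℝ) ^ (-(1 / 2) : ℝ) := by
          refine Finset.sum_le_sum fun k hk => (gCoeff_sq_le_zone h (hZ k hk)).trans (le_of_eq ?_)
          rw [Real.mul_rpow hN.le (Nat.cast_nonneg _)]
          ring
      _ = 450 * gNormal N * (N : ℝ) ^ (-(1 / 2) : ℝ) *
          ∑ k ∈ F.filter (InZone N S), (edgeDist N k : ℝ) ^ (-(1 / 2) : ℝ) := by
          rw [Finset.mul_sum]
      _ ≤ 450 * gNormal N * (N : ℝ) ^ (-(1 / 2) : ℝ) *
          (2 * (1 / (1 - 1 / 2) * ((8 * N : ℕ) : ℝ) ^ (1 - 1 / 2 : ℝ))) := by gcongr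
      _ = 1800 * 8 ^ (1 / 2 : ℝ) * gNormal N := by
          push_cast
          rw [show (1 - 1 / 2 : ℝ) = 1 / 2 by norm_num, Real.mul_rpow (by norm_num) hN.le,
            Real.rpow_neg hN.le]
          have : (N : ℝ) ^ (1 / 2 : ℝ) ≠ 0 := by positivity
          field_simp
          ring
      _ ≤ 1800 * 3 * gNormal N := by
          gcongr
          rw [← Real.sqrt_eq_rpow, Real.sqrt_le_left (by norm_num)]
          norm_num
      _ ≤ _ := by linarith
  linarith

/-- Parseval bounds the invariant from above. -/
theorem gNormal_le (h : EdgeScale N S) : gNormal N ≤ 200 := by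
  have hN := h.posR
  have hS := h.leNat
  have hG := gInv_nonneg h h.center
  have hz : ∀ k ∈ Finset.Ioc N (2 * N), InZone N S k := fun k hk => by
    have := Finset.mem_Ioc.1 hk
    exact ⟨by omega, by omega⟩
  -- Between N and 2N the amplitude is bounded, so the energy is comparable to the invariant and is
  -- at most 2(c_k² + c_{k-1}²). The factor 25 is 5 · (5/2) · 2.
  have hterm : ∀ k ∈ Finset.Ioc N (2 * N),
      gInv N N / 25 ≤ (2 * N : ℝ) ^ 2 * (gCoeff N k ^ 2 + gCoeff N (k - 1) ^ 2) := by
    intro k hk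
    have hzk := hz k hk
    obtain ⟨hr, hx⟩ := gAmp_spec h hzk
    have hk' := Finset.mem_Ioc.1 hk
    have hkR : (k : ℝ) ≤ 2 * N := by exact_mod_cast hk'.2
    have hk1R : ((k - 1 : ℕ) : ℝ) ≤ 2 * N := by exact_mod_cast (by omega : k - 1 ≤ 2 * N)
    have hd : (N : ℝ) ≤ edgeDist N k := by
      have : N ≤ edgeDist N k := by unfold edgeDist; omega
      exact_mod_cast this
    have h1 := gAmp_sq_le h hzk
    have h2 : gAmp N k ≤ 5 / 2 := by
      refine (abs_le_of_sq_le_sq' ?_ (by norm_num)).2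
      have : gAmp N k ^ 2 * N ≤ 6 * N := le_trans (by gcongr) h1
      have := le_of_mul_le_mul_right this hN
      linarith
    have h3 := gInv_comparable h h.center hzk
    have hE : 0 ≤ gEnergy N k := energy_nonneg hr hx
    have h4 : gInv N k ≤ 5 / 2 * gEnergy N k := by unfold gInv; gcongr
    have h5 : gEnergy N k ≤ 2 * (gWeighted N k ^ 2 + gWeighted N (k - 1) ^ 2) := by
      have hxa := abs_le.1 (abs_le_two_of_amplitude hx)
      unfold gEnergy energy
      nlinarith [sq_nonneg (gWeighted N k + gWeighted N (k - 1)),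
        sq_nonneg (gWeighted N k - gWeighted N (k - 1))]
    rw [gWeighted_sq, gWeighted_sq] at h5
    have h6 : (k : ℝ) ^ 2 * gCoeff N k ^ 2 ≤ (2 * N : ℝ) ^ 2 * gCoeff N k ^ 2 := by gcongr
    have h7 : ((k - 1 : ℕ) : ℝ) ^ 2 * gCoeff N (k - 1) ^ 2 ≤
      (2 * N : ℝ) ^ 2 * gCoeff N (k - 1) ^ 2 := by gcongr
    linarith
  have hsum := Finset.sum_le_sum hterm
  rw [Finset.sum_const, Nat.card_Ioc, nsmul_eq_mul, ← Finset.mul_sum, Finset.sum_add_distrib,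
    show 2 * N - N = N by omega] at hsum
  have h1 := sum_le_hasSum (Finset.Ioc N (2 * N)) (fun _ _ => sq_nonneg _) (hasSum_gCoeff_sq N)
  have h2 : ∑ k ∈ Finset.Ioc N (2 * N), gCoeff N (k - 1) ^ 2 ≤ 1 := by
    have hinj : Set.InjOn (fun k => k - 1) (Finset.Ioc N (2 * N) : Set ℕ) := by
      intro a ha b hb hab
      have := Finset.mem_Ioc.1 ha
      have := Finset.mem_Ioc.1 hb
      simp only at hab
      omega
    rw [← Finset.sum_image (f := fun k => gCoeff N k ^ 2) hinj]
    exact sum_le_hasSum _ (fun _ _ => sq_nonneg _) (hasSum_gCoeff_sq N)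
  have h3 : (N : ℝ) * (gInv N N / 25) ≤ (2 * N : ℝ) ^ 2 * 2 :=
    hsum.trans (by gcongr; linarith)
  rw [gNormal, div_le_iff₀ hN]
  have h4 : N * gInv N N ≤ N * (200 * N) := by nlinarith
  exact le_of_mul_le_mul_left h4 hN

end Coefficients

/-! ### The comparison function, existence of the edge scale, and upper bounds. -/

/-- The `p`-th power of `uFun p N`. -/
noncomputable def uPow (p : ℝ) (N : ℕ) : ℝ :=
  if p < 4 then (N : ℝ) ^ (1 - p / 2)
  else if p = 4 then Real.log N * (N : ℝ) ^ (-1 : ℝ)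
  else (N : ℝ) ^ (1 / 3 - p / 3)

theorem uFun_rpow {p : ℝ} (hp : 0 < p) {N : ℕ} (hN : 10 ≤ N) : uFun p N ^ p = uPow p N := by
  have hN0 : (0 : ℝ) < N := by exact_mod_cast (by omega : 0 < N)
  have hlog : 0 ≤ Real.log N := Real.log_natCast_nonneg N
  unfold uFun uPow
  split_ifs with h1 h2
  · rw [← Real.rpow_mul hN0.le]; congr 1; field_simp
  · subst h2
    rw [Real.mul_rpow (by positivity) (by positivity), ← Real.rpow_mul hlog, ← Real.rpow_mul hN0.le]
    norm_num
  · rw [← Real.rpow_mul hN0.le]; congr 1; field_simp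

theorem uPow_pos (p : ℝ) {N : ℕ} (hN : 10 ≤ N) : 0 < uPow p N := by
  have hN0 : (0 : ℝ) < N := by exact_mod_cast (by omega : 0 < N)
  have hlog : 0 < Real.log N := Real.log_pos (by exact_mod_cast (by omega : 1 < N))
  unfold uPow
  split_ifs <;> positivity

theorem uFun_pos (p : ℝ) {N : ℕ} (hN : 10 ≤ N) : 0 < uFun p N := by
  have hN0 : (0 : ℝ) < N := by exact_mod_cast (by omega : 0 < N)
  have hlog : 0 < Real.log N := Real.log_pos (by exact_mod_cast (by omega : 1 < N))
  unfold uFun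
  split_ifs <;> positivity

theorem one_le_log_of_ten_le {N : ℕ} (hN : 10 ≤ N) : 1 ≤ Real.log N := by
  have h : (10 : ℝ) ≤ N := by exact_mod_cast hN
  rw [Real.le_log_iff_exp_le (by linarith)]
  linarith [Real.exp_one_lt_three]

theorem exists_edgeScale {N : ℕ} (hN : 10 ^ 20 ≤ N) : ∃ S, EdgeScale N S := by
  have hNR : (10 : ℝ) ^ 20 ≤ N := by exact_mod_cast hN
  have hN0 : (0 : ℝ) < N := by linarith [show (0 : ℝ) < 10 ^ 20 by norm_num]
  set x : ℝ := (N : ℝ) ^ (1 / 3 : ℝ) with hx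
  have hx0 : 0 < x := by positivity
  have hx3 : x ^ 3 = N := by
    rw [hx, ← Real.rpow_natCast, ← Real.rpow_mul hN0.le]; norm_num
  have hxl : 4 * 10 ^ 6 ≤ x := by
    by_contra hc
    push Not at hc
    have : x ^ 3 < (4 * 10 ^ 6) ^ 3 := by gcongr
    rw [hx3] at this
    norm_num at this hNR
    linarith
  have h1 : 10 ^ 6 * x ≤ (⌈10 ^ 6 * x⌉₊ : ℝ) := Nat.le_ceil _
  have h2 : (⌈10 ^ 6 * x⌉₊ : ℝ) ≤ 2 * 10 ^ 6 * x := by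
    have := Nat.ceil_lt_add_one (by positivity : 0 ≤ 10 ^ 6 * x)
    linarith
  -- With x = N^{1/3}, the ceiling lies between 10⁶x and 2·10⁶x. The threshold 10²⁰ for N makes x² ≥
  -- 2·10¹², which is the separation 10⁶S ≤ N.
  refine ⟨⌈10 ^ 6 * x⌉₊, ?_, ?_, ?_, by exact_mod_cast hN0⟩
  · calc (10 : ℝ) ^ 18 * N = (10 ^ 6 * x) ^ 3 := by rw [← hx3]; ring
      _ ≤ _ := by gcongr
  · calc ((⌈10 ^ 6 * x⌉₊ : ℝ)) ^ 3 ≤ (2 * 10 ^ 6 * x) ^ 3 := by gcongr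
      _ = 8 * 10 ^ 18 * (N : ℝ) := by rw [← hx3]; ring
      _ ≤ _ := by gcongr; norm_num
  · calc (10 : ℝ) ^ 6 * (⌈10 ^ 6 * x⌉₊ : ℝ) ≤ 10 ^ 6 * (2 * 10 ^ 6 * x) := by gcongr
      _ = 2 * 10 ^ 12 * x := by ring
      _ ≤ (4 * 10 ^ 6 * (4 * 10 ^ 6)) * x := mul_le_mul_of_nonneg_right (by norm_num) hx0.le
      _ ≤ (x * x) * x := by gcongr
      _ = N := by rw [← hx3]; ring

section Upper

variable {N S : ℕ}

theorem EdgeScale.cbrt_le (h : EdgeScale N S) : (N : ℝ) ^ (1 / 3 : ℝ) ≤ S := by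
  have hN := h.posR
  have hS := h.posS
  have h1 := h.cube_ge
  calc (N : ℝ) ^ (1 / 3 : ℝ) ≤ ((S : ℝ) ^ 3) ^ (1 / 3 : ℝ) := by
        gcongr; linarith
    _ = S := by rw [← Real.rpow_natCast, ← Real.rpow_mul hS.le]; norm_num

theorem EdgeScale.le_cbrt (h : EdgeScale N S) : (S : ℝ) ≤ 10 ^ 7 * (N : ℝ) ^ (1 / 3 : ℝ) := by
  have hN := h.posR
  have hS := h.posS
  have h1 := h.cube_le
  calc (S : ℝ) = ((S : ℝ) ^ 3) ^ (1 / 3 : ℝ) := by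
        rw [← Real.rpow_natCast, ← Real.rpow_mul hS.le]; norm_num
    _ ≤ ((10 ^ 7) ^ 3 * (N : ℝ)) ^ (1 / 3 : ℝ) := by
        gcongr
        refine h1.trans ?_
        gcongr
        norm_num
    _ = _ := by
        rw [Real.mul_rpow (by positivity) hN.le, ← Real.rpow_natCast (10 ^ 7),
          ← Real.rpow_mul (by positivity)]
        norm_num

theorem EdgeScale.rpow_le (h : EdgeScale N S) {t : ℝ} (ht : t ≤ 0) :
    (S : ℝ) ^ t ≤ (N : ℝ) ^ (t / 3) := by
  have hN := h.posR
  rw [show t / 3 = 1 / 3 * t by ring, Real.rpow_mul hN.le]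
  exact Real.rpow_le_rpow_of_nonpos (by positivity) h.cbrt_le ht

theorem EdgeScale.le_rpow (h : EdgeScale N S) {t : ℝ} (ht : t ≤ 0) :
    (10 ^ 7) ^ t * (N : ℝ) ^ (t / 3) ≤ (S : ℝ) ^ t := by
  have hN := h.posR
  rw [show t / 3 = 1 / 3 * t by ring, Real.rpow_mul hN.le, ← Real.mul_rpow (by positivity)
    (by positivity)]
  exact Real.rpow_le_rpow_of_nonpos h.posS h.le_cbrt ht

/-- The common constant in the pointwise bounds. -/
noncomputable def coeffConst : ℝ := 90000 + 200 * outerConst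

theorem coeffConst_pos : 0 < coeffConst := by
  have := outerConst_pos
  unfold coeffConst; linarith

theorem gCoeff_sq_le_zone' (h : EdgeScale N S) {k : ℕ} (hz : InZone N S k) :
    gCoeff N k ^ 2 ≤ coeffConst * (N * edgeDist N k : ℝ) ^ (-(1 / 2) : ℝ) := by
  have hO := outerConst_pos
  refine (gCoeff_sq_le_zone h hz).trans ?_
  have := gNormal_le h
  gcongr
  unfold coeffConst
  linarith

theorem gCoeff_sq_le_outer' (h : EdgeScale N S) {k : ℕ} (hz : ¬ InZone N S k) :
    gCoeff N k ^ 2 ≤ coeffConst / (S : ℝ) ^ 2 := by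
  have hO := outerConst_pos
  refine (gCoeff_sq_le_outer h hz).trans ?_
  have := gNormal_le h
  gcongr
  unfold coeffConst
  nlinarith

theorem sum_gCoeff_sq_outer_le' (h : EdgeScale N S) (F : Finset ℕ)
    (hF : ∀ k ∈ F, ¬ InZone N S k) : ∑ k ∈ F, gCoeff N k ^ 2 ≤ 10 * coeffConst / S := by
  have hO := outerConst_pos
  refine (sum_gCoeff_sq_outer_le h F hF).trans ?_
  have := gNormal_le h
  have hS := h.posS
  gcongr ?_ / _
  unfold coeffConst
  nlinarith

theorem abs_rpow_eq_sq_rpow (x p : ℝ) : |x| ^ p = (x ^ 2) ^ (p / 2) := by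
  rw [← sq_abs, ← Real.rpow_natCast, ← Real.rpow_mul (abs_nonneg x)]
  congr 1
  push_cast
  ring

/-- The `ℓ^p` sum in terms of the two scales. -/
theorem sum_abs_gCoeff_rpow_le (h : EdgeScale N S) {p : ℝ} (hp : 2 ≤ p) (F : Finset ℕ) :
    ∃ F' : Finset ℕ, (∀ k ∈ F', InZone N S k) ∧
      ∑ k ∈ F, |gCoeff N k| ^ p ≤ coeffConst ^ (p / 2) *
        (10 * (S : ℝ) ^ (1 - p) +
          (N : ℝ) ^ (-(p / 4)) * ∑ k ∈ F', (edgeDist N k : ℝ) ^ (-(p / 4))) := by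
  classical
  have hN := h.posR
  have hS := h.posS
  have hC := coeffConst_pos
  refine ⟨F.filter (InZone N S), fun k hk => (Finset.mem_filter.1 hk).2, ?_⟩
  rw [← Finset.sum_filter_add_sum_filter_not F (InZone N S), mul_add, add_comm]
  refine add_le_add ?_ ?_
  · have hmem : ∀ k ∈ F.filter (fun k => ¬ InZone N S k), ¬ InZone N S k :=
      fun k hk => (Finset.mem_filter.1 hk).2
    -- Outside the zone the bound interpolates: the power p - 2 is estimated by the supremum, of
    -- order 1/S, and the square sum by a multiple of 1/S.
    calc ∑ k ∈ F.filter (fun k => ¬ InZone N S k), |gCoeff N k| ^ p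
        ≤ ∑ k ∈ F.filter (fun k => ¬ InZone N S k),
          (coeffConst / (S : ℝ) ^ 2) ^ (p / 2 - 1) * gCoeff N k ^ 2 := by
          refine Finset.sum_le_sum fun k hk => ?_
          have hb := gCoeff_sq_le_outer' h (hmem k hk)
          rw [abs_rpow_eq_sq_rpow]
          rcases (sq_nonneg (gCoeff N k)).eq_or_lt with h0 | h0
          · rw [← h0, Real.zero_rpow (by linarith), mul_zero]
          · calc (gCoeff N k ^ 2) ^ (p / 2) = (gCoeff N k ^ 2) ^ (p / 2 - 1) * gCoeff N k ^ 2 := by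
                  rw [Real.rpow_sub_one h0.ne', div_mul_cancel₀ _ h0.ne']
              _ ≤ _ := by
                gcongr
                linarith
      _ = (coeffConst / (S : ℝ) ^ 2) ^ (p / 2 - 1) *
          ∑ k ∈ F.filter (fun k => ¬ InZone N S k), gCoeff N k ^ 2 := by rw [Finset.mul_sum]
      _ ≤ (coeffConst / (S : ℝ) ^ 2) ^ (p / 2 - 1) * (10 * coeffConst / S) := by
          gcongr
          exact sum_gCoeff_sq_outer_le' h _ hmem
      _ = coeffConst ^ (p / 2) * (10 * (S : ℝ) ^ (1 - p)) := by
          rw [Real.div_rpow hC.le (by positivity), Real.rpow_sub_one hC.ne',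
            ← Real.rpow_natCast (S : ℝ) 2, ← Real.rpow_mul hS.le,
            show ((2 : ℕ) : ℝ) * (p / 2 - 1) = p - 1 - 1 by push_cast; ring,
            show 1 - p = -(p - 1) by ring, Real.rpow_neg hS.le, Real.rpow_sub_one hS.ne' (p - 1)]
          field_simp
  · rw [Finset.mul_sum, Finset.mul_sum]
    refine Finset.sum_le_sum fun k hk => ?_
    have hz := (Finset.mem_filter.1 hk).2
    have hb := gCoeff_sq_le_zone' h hz
    have hm := edgeDist_pos h hz
    rw [abs_rpow_eq_sq_rpow]
    calc (gCoeff N k ^ 2) ^ (p / 2)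
        ≤ (coeffConst * (N * edgeDist N k : ℝ) ^ (-(1 / 2) : ℝ)) ^ (p / 2) := by gcongr
      _ = _ := by
        rw [Real.mul_rpow hC.le (by positivity), ← Real.rpow_mul (by positivity),
          show -(1 / 2) * (p / 2) = -(p / 4) by ring, Real.mul_rpow hN.le hm.le]

/-- Upper bound for the `ℓ^p` sums. -/
theorem exists_sum_le_uPow {p : ℝ} (hp : 2 ≤ p) : ∃ C : ℝ, 0 < C ∧ ∀ N S : ℕ, EdgeScale N S →
    ∀ F : Finset ℕ, ∑ k ∈ F, |gCoeff N k| ^ p ≤ C * uPow p N := by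
  have hC := coeffConst_pos
  have hC' : 0 < coeffConst ^ (p / 2) := by positivity
  suffices H : ∃ C : ℝ, 0 < C ∧ ∀ N S : ℕ, EdgeScale N S → ∀ F' : Finset ℕ,
      (∀ k ∈ F', InZone N S k) → 10 * (S : ℝ) ^ (1 - p) +
          (N : ℝ) ^ (-(p / 4)) * ∑ k ∈ F', (edgeDist N k : ℝ) ^ (-(p / 4)) ≤ C * uPow p N by
    obtain ⟨C, hC0, H⟩ := H
    refine ⟨coeffConst ^ (p / 2) * C, by positivity, fun N S h F => ?_⟩
    obtain ⟨F', hF', hle⟩ := sum_abs_gCoeff_rpow_le h hp F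
    refine hle.trans ?_
    rw [mul_assoc]
    gcongr
    exact H N S h F' hF'
  have hten : ∀ N S : ℕ, EdgeScale N S → 10 ≤ N := fun N S h => by
    have := h.leNat
    have := h.largeNat
    omega
  -- The exponent p/4 of the edge distance is below, at or above 1: the sum is dominated by the
  -- bulk, spread over all dyadic scales, or concentrated at the edges.
  rcases lt_trichotomy p 4 with hp4 | hp4 | hp4
  · have hq : 0 < 1 - p / 4 := by linarith
    refine ⟨10 + 2 * (1 / (1 - p / 4) * 8 ^ (1 - p / 4)), by positivity, fun N S h F' hF' => ?_⟩
    have hN := h.posR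
    have hN1 : (1 : ℝ) ≤ N := by exact_mod_cast h.pos
    have hu : uPow p N = (N : ℝ) ^ (1 - p / 2) := if_pos hp4
    rw [hu, add_mul]
    refine add_le_add ?_ ?_
    · have h1 := h.rpow_le (t := 1 - p) (by linarith)
      have h2 : (N : ℝ) ^ ((1 - p) / 3) ≤ (N : ℝ) ^ (1 - p / 2) :=
        Real.rpow_le_rpow_of_exponent_le hN1 (by linarith)
      linarith
    · have h1 := sum_edgeDist_le_of_lt_one h (q := p / 4) (by linarith) (by linarith) hF'
      calc (N : ℝ) ^ (-(p / 4)) * ∑ k ∈ F', (edgeDist N k : ℝ) ^ (-(p / 4))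
          ≤ (N : ℝ) ^ (-(p / 4)) * (2 * (1 / (1 - p / 4) * ((8 * N : ℕ) : ℝ) ^ (1 - p / 4))) := by
            gcongr
        _ = 2 * (1 / (1 - p / 4) * 8 ^ (1 - p / 4)) *
            ((N : ℝ) ^ (-(p / 4)) * (N : ℝ) ^ (1 - p / 4)) := by
            push_cast
            rw [Real.mul_rpow (by norm_num) hN.le]; ring
        _ = _ := by
            rw [← Real.rpow_add hN]
            congr 2
            ring
  · subst hp4
    refine ⟨16, by norm_num, fun N S h F' hF' => ?_⟩
    have hN := h.posR
    have hN1 : (1 : ℝ) ≤ N := by exact_mod_cast h.pos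
    have hlog := one_le_log_of_ten_le (hten N S h)
    have hu : uPow 4 N = Real.log N * (N : ℝ) ^ (-1 : ℝ) := by simp [uPow]
    have h1 := h.rpow_le (t := 1 - 4) (by norm_num)
    have h2 := sum_edgeDist_inv_le h hF'
    have h3 : Real.log ((8 * N : ℕ) : ℝ) ≤ 2 * Real.log N := by
      rw [← Real.log_rpow hN, Real.rpow_two]
      apply Real.log_le_log (by exact_mod_cast (by have := h.pos; omega : 0 < 8 * N))
      push_cast
      have : (10 : ℝ) ≤ N := by exact_mod_cast hten N S h
      nlinarith
    have hX : 0 < (N : ℝ) ^ (-1 : ℝ) := by positivity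
    rw [hu]
    norm_num at h1 h2 h3 ⊢
    have h4 : (N : ℝ)⁻¹ * ∑ k ∈ F', (edgeDist N k : ℝ)⁻¹ ≤ (N : ℝ)⁻¹ * (6 * Real.log N) := by
      gcongr
      simp only [Real.rpow_neg_one] at h2
      linarith
    simp only [Real.rpow_neg_one] at hX h1 ⊢
    nlinarith
  · refine ⟨10 + 2 * (p / 4 / (p / 4 - 1)), ?_, fun N S h F' hF' => ?_⟩
    · have : 0 < p / 4 - 1 := by linarith
      positivity
    have hN := h.posR
    have hq : 0 < p / 4 - 1 := by linarith
    have hu : uPow p N = (N : ℝ) ^ (1 / 3 - p / 3) := by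
      rw [uPow, if_neg (by linarith), if_neg (by linarith)]
    rw [hu, add_mul]
    refine add_le_add ?_ ?_
    · have h1 := h.rpow_le (t := 1 - p) (by linarith)
      rw [show (1 - p) / 3 = 1 / 3 - p / 3 by ring] at h1
      gcongr
    · have h1 := sum_edgeDist_le h (q := p / 4) (by linarith) hF'
      have h2 := h.rpow_le (t := 1 - p / 4) (by linarith)
      calc (N : ℝ) ^ (-(p / 4)) * ∑ k ∈ F', (edgeDist N k : ℝ) ^ (-(p / 4))
          ≤ (N : ℝ) ^ (-(p / 4)) * (2 * (p / 4 / (p / 4 - 1) * (N : ℝ) ^ ((1 - p / 4) / 3))) := by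
            gcongr
            exact h1.trans (by gcongr)
        _ = 2 * (p / 4 / (p / 4 - 1)) *
            ((N : ℝ) ^ (-(p / 4)) * (N : ℝ) ^ ((1 - p / 4) / 3)) := by ring
        _ = _ := by
            rw [← Real.rpow_add hN]
            congr 2
            ring

/-- Upper bound for the supremum of the coefficients. -/
theorem abs_gCoeff_le (h : EdgeScale N S) (k : ℕ) :
    |gCoeff N k| ≤ coeffConst ^ (1 / 2 : ℝ) * (N : ℝ) ^ (-(1 / 3) : ℝ) := by
  have hN := h.posR
  have hS := h.posS
  have hC := coeffConst_pos
  have h1 : gCoeff N k ^ 2 ≤ coeffConst * (N : ℝ) ^ (-(2 / 3) : ℝ) := by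
    have e := h.rpow_le (t := -2) (by norm_num)
    have e2 : (S : ℝ) ^ (-2 : ℝ) = 1 / (S : ℝ) ^ 2 := by
      rw [Real.rpow_neg hS.le, Real.rpow_two, one_div]
    rw [e2, show (-2 / 3 : ℝ) = -(2 / 3) by ring] at e
    by_cases hz : InZone N S k
    · refine (gCoeff_sq_le_zone' h hz).trans ?_
      gcongr
      have hm := edgeDist_pos h hz
      have hSm : (S : ℝ) ≤ edgeDist N k := by exact_mod_cast hz.le_edgeDist
      have h2 : (N : ℝ) ^ (4 / 3 : ℝ) ≤ N * edgeDist N k := by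
        calc (N : ℝ) ^ (4 / 3 : ℝ) = N * (N : ℝ) ^ (1 / 3 : ℝ) := by
              rw [show (4 / 3 : ℝ) = 1 + 1 / 3 by norm_num, Real.rpow_add hN, Real.rpow_one]
          _ ≤ _ := by
              gcongr
              exact h.cbrt_le.trans hSm
      calc (N * edgeDist N k : ℝ) ^ (-(1 / 2) : ℝ) ≤ ((N : ℝ) ^ (4 / 3 : ℝ)) ^ (-(1 / 2) : ℝ) :=
            Real.rpow_le_rpow_of_nonpos (by positivity) h2 (by norm_num)
        _ = _ := by rw [← Real.rpow_mul hN.le]; norm_num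
    · refine (gCoeff_sq_le_outer' h hz).trans ?_
      rw [div_eq_mul_one_div]
      gcongr
  refine (abs_le_of_sq_le_sq (h1.trans (le_of_eq ?_)) (by positivity))
  rw [mul_pow, ← Real.rpow_natCast (coeffConst ^ (1 / 2 : ℝ)), ← Real.rpow_mul hC.le,
    ← Real.rpow_natCast ((N : ℝ) ^ (-(1 / 3) : ℝ)), ← Real.rpow_mul hN.le]
  norm_num

end Upper

/-! ### Lower bounds for the pairwise minima on blocks near the right edge. -/

section Blocks

variable {N S s k : ℕ}

/-- The discrete virial identity. -/
theorem virial_identity (hk : 2 ≤ k) :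
    (4 - gDiag N k ^ 2) * (gWeighted N k * gWeighted N (k - 1)) =
      gDiag N k * gEnergy N k - (gCross N k - gCross N (k - 1)) -
        gStep N k * gWeighted N (k - 1) ^ 2 := by
  rw [gCross_pred hk]
  unfold gCross gEnergy energy gStep
  ring

/-- Only the pairs (2j, 2j+1) occur in the minima. This replaces the product of a pair (2j+1, 2j+2)
by that of the preceding pair, at the cost of a cross term of order G, small against the typical
product G/ρ. -/
theorem gWeighted_mul_succ (hk : 1 ≤ k) :
    gWeighted N (k + 1) * gWeighted N k =
      gWeighted N k * gWeighted N (k - 1) + gCross N k := by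
  rw [gWeighted_rec' hk]
  unfold gCross
  ring

theorem sum_Ico_pairs (f : ℕ → ℝ) {a b : ℕ} (hab : a ≤ b) :
    ∑ k ∈ Finset.Ico (2 * a + 1) (2 * b + 1), f k =
      ∑ j ∈ Finset.Ico a b, (f (2 * j + 1) + f (2 * j + 2)) := by
  induction b, hab using Nat.le_induction with
  | base => simp
  | succ b hb ih =>
    rw [Finset.sum_Ico_succ_top hb, ← ih, show 2 * (b + 1) + 1 = 2 * b + 1 + 1 + 1 by ring,
      Finset.sum_Ico_succ_top (by omega), Finset.sum_Ico_succ_top (by omega)]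
    ring

theorem sum_Ico_sub_pred (f : ℕ → ℝ) {a b : ℕ} (hab : a ≤ b) :
    ∑ k ∈ Finset.Ico (a + 1) (b + 1), (f k - f (k - 1)) = f b - f a := by
  induction b, hab using Nat.le_induction with
  | base => simp
  | succ b hb ih =>
    rw [Finset.sum_Ico_succ_top (by omega), ih, Nat.add_sub_cancel]
    ring

/-- A block at distance about `2 s` from the right edge. -/
structure BlockScale (N S s : ℕ) : Prop where
  scale : EdgeScale N S
  ge : S ≤ s
  le : 10 ^ 6 * s ≤ N

/-- `ρ = √(s/N)`. -/
noncomputable def blockWidth (N s : ℕ) : ℝ := √((s : ℝ) / N)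

theorem BlockScale.sR (h : BlockScale N S s) : (10 : ℝ) ^ 6 ≤ s :=
  h.scale.large.trans (by exact_mod_cast h.ge)

theorem BlockScale.width_pos (h : BlockScale N S s) : 0 < blockWidth N s := by
  have := h.scale.posR
  have := h.sR
  unfold blockWidth
  have : (0 : ℝ) < s := by linarith
  positivity

theorem BlockScale.width_sq (h : BlockScale N S s) : blockWidth N s ^ 2 * N = s := by
  have := h.scale.posR
  rw [blockWidth, Real.sq_sqrt (by positivity)]
  field_simp

theorem BlockScale.width_le (h : BlockScale N S s) : blockWidth N s ≤ 1 / 1000 := by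
  have hN := h.scale.posR
  have h1 : (10 : ℝ) ^ 6 * s ≤ N := by exact_mod_cast h.le
  refine (abs_le_of_sq_le_sq' ?_ (by norm_num)).2
  refine le_of_mul_le_mul_right ?_ hN
  rw [h.width_sq]
  linarith

/-- Up to constants ρs is the phase run through in the block. Its size makes the boundary terms G
negligible against the main term Gρs of the virial sum. -/
theorem BlockScale.width_mul_ge (h : BlockScale N S s) : 10 ^ 9 ≤ blockWidth N s * s := by
  have hN := h.scale.posR
  have hw := h.width_pos
  have hsS : (S : ℝ) ≤ s := by exact_mod_cast h.ge
  refine (abs_le_of_sq_le_sq' ?_ (by positivity)).2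
  refine le_of_mul_le_mul_right ?_ hN
  calc ((10 : ℝ) ^ 9) ^ 2 * N = 10 ^ 18 * N := by norm_num
    _ ≤ (S : ℝ) ^ 3 := h.scale.cube_ge
    _ ≤ (s : ℝ) ^ 3 := by gcongr
    _ = (blockWidth N s ^ 2 * N) * s ^ 2 := by rw [h.width_sq]; ring
    _ = _ := by ring

/-- Membership of an index in the block. -/
structure InBlock (N s k : ℕ) : Prop where
  lower : 3 * N ≤ k + 4 * s + 1
  upper : k + 2 * s ≤ 3 * N

theorem BlockScale.inZone (h : BlockScale N S s) (hk : InBlock N s k) : InZone N S k := by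
  have := h.le
  have := h.ge
  have := hk.lower
  have := hk.upper
  exact ⟨by omega, by omega⟩

/-- In a block the distance to the right edge stays between 2s and 4s + 1 and the left edge is far
away, so 4 - x² is of order s/N = ρ² and the amplitude of order 1/ρ. -/
theorem block_amplitude (h : BlockScale N S s) (hk : InBlock N s k) :
    gAmp N k * blockWidth N s ≤ 7 / 4 ∧ 1 / 2 ≤ gAmp N k * blockWidth N s ∧
      4 - gDiag N k ^ 2 ≤ 4 * blockWidth N s ^ 2 ∧ 0 ≤ 4 - gDiag N k ^ 2 ∧ 1 ≤ gDiag N k := by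
  have hz := h.inZone hk
  obtain ⟨hr, hx⟩ := gAmp_spec h.scale hz
  have hN := h.scale.posR
  have hw := h.width_pos
  have hw2 := h.width_sq
  have hle := h.le
  have hleR : (10 : ℝ) ^ 6 * s ≤ N := by exact_mod_cast h.le
  have hs := h.sR
  have hk1 : 3 * (N : ℝ) ≤ k + 4 * s + 1 := by exact_mod_cast hk.lower
  have hk2 : (k : ℝ) + 2 * s ≤ 3 * N := by exact_mod_cast hk.upper
  have hk0 : (0 : ℝ) < k := by linarith
  have hkN : 29 / 10 * (N : ℝ) ≤ k := by linarith
  have hd : (2 * s : ℝ) ≤ edgeDist N k := by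
    have : 2 * s ≤ edgeDist N k := by
      have := hk.lower
      have := hk.upper
      unfold edgeDist
      omega
    exact_mod_cast this
  have h1 := gAmp_sq_le h.scale hz
  have h2 : gAmp N k ^ 2 * (2 * s) ≤ 6 * N := le_trans (by gcongr) h1
  have c1 : gAmp N k * blockWidth N s ≤ 7 / 4 := by
    refine (abs_le_of_sq_le_sq' ?_ (by norm_num)).2
    have : (gAmp N k * blockWidth N s) ^ 2 * N ≤ 3 * N := by
      rw [← hw2] at h2
      linarith
    have := le_of_mul_le_mul_right this hN
    linarith
  have c3 : 4 - gDiag N k ^ 2 ≤ 4 * blockWidth N s ^ 2 := by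
    have hkn : 0 < k := by exact_mod_cast hk0
    rw [four_sub_gDiag_sq hkn, div_le_iff₀ (by positivity)]
    have e : 4 * blockWidth N s ^ 2 * (4 * (k : ℝ) ^ 2) * N = 16 * s * k ^ 2 := by
      rw [← hw2]; ring
    refine le_of_mul_le_mul_right ?_ hN
    rw [e]
    have e2 : 3 * (N : ℝ) - k ≤ 5 * s := by linarith
    have e3 : 3 * (k : ℝ) - N ≤ 3 * k := by linarith
    have e4 : (3 * (N : ℝ) - k) * (3 * k - N) ≤ (5 * s) * (3 * k) := by
      apply mul_le_mul e2 e3 <;> linarith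
    have e5 : 45 * (s : ℝ) * k * N ≤ 45 * s * k * (10 / 29 * k) := by
      gcongr; linarith
    have e6 : 3 * ((3 * (N : ℝ) - k) * (3 * k - N)) * N ≤ 3 * ((5 * s) * (3 * k)) * N := by gcongr
    have : 0 ≤ (s : ℝ) * k ^ 2 := by positivity
    linarith
  refine ⟨c1, ?_, c3, ?_, ?_⟩
  · refine (abs_le_of_sq_le_sq' ?_ (by positivity)).2
    have := mul_le_mul_of_nonneg_left c3 (sq_nonneg (gAmp N k))
    rw [hx] at this
    nlinarith
  · have : 0 < gAmp N k ^ 2 := by positivity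
    by_contra hc
    nlinarith
  · unfold gDiag
    have : 3 * (N : ℝ) / (2 * k) ≤ 3 / 2 := by
      rw [div_le_iff₀ (by positivity)]; linarith
    linarith

/-- Energy and size bounds in a block. -/
theorem block_energy (h : BlockScale N S s) (hk : InBlock N s k) :
    gInv N N * blockWidth N s / 9 ≤ gEnergy N k ∧ |gCross N k| ≤ 10 * gInv N N ∧
      gWeighted N k ^ 2 ≤ 35 * gInv N N / blockWidth N s ∧
      gWeighted N (k - 1) ^ 2 ≤ 35 * gInv N N / blockWidth N s := by
  have hz := h.inZone hk
  obtain ⟨hr, hx⟩ := gAmp_spec h.scale hz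
  have hw := h.width_pos
  have hG := gInv_nonneg h.scale h.scale.center
  obtain ⟨c1, c2, -⟩ := block_amplitude h hk
  have hI1 := gInv_comparable h.scale hz h.scale.center
  have hI2 := gInv_comparable h.scale h.scale.center hz
  obtain ⟨w1, w2⟩ := gWeighted_sq_le h.scale hz
  have e : 20 * gInv N N * gAmp N k ≤ 35 * gInv N N / blockWidth N s := by
    rw [le_div_iff₀ hw]
    nlinarith
  refine ⟨?_, ?_, w1.trans e, w2.trans e⟩
  · have hE : 0 ≤ gEnergy N k := energy_nonneg hr hx
    have : gInv N k * blockWidth N s ≤ 7 / 4 * gEnergy N k := by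
      unfold gInv
      nlinarith
    nlinarith
  · have := abs_gCross_le h.scale hz
    linarith

/-- The start of the index range `J = ⌊3N/2⌋`. -/
def blockTop (N : ℕ) : ℕ := 3 * N / 2

theorem inBlock_of_mem (h : BlockScale N S s)
    (hk1 : 2 * (blockTop N - 2 * s) ≤ k) (hk2 : k ≤ 2 * (blockTop N - s)) : InBlock N s k := by
  have := h.le
  unfold blockTop at hk1 hk2
  exact ⟨by omega, by omega⟩

/-- Mean value of the products `c_k c_{k-1}` over a block. -/
theorem block_virial (h : BlockScale N S s) :
    gInv N N * blockWidth N s * s / 5 ≤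
      ∑ k ∈ Finset.Ico (2 * (blockTop N - 2 * s) + 1) (2 * (blockTop N - s) + 1),
        (4 - gDiag N k ^ 2) * (gWeighted N k * gWeighted N (k - 1)) := by
  have hN := h.scale.posR
  have hNn := h.scale.pos
  have hw := h.width_pos
  have hw2 := h.width_sq
  have hle := h.le
  have hs := h.sR
  have hG := gInv_nonneg h.scale h.scale.center
  have hws := h.width_mul_ge
  set a := 2 * (blockTop N - 2 * s) with ha
  set b := 2 * (blockTop N - s) with hb
  set G := gInv N N
  set ρ := blockWidth N s
  have hab : a ≤ b := by omega
  have hcard : b - a = 2 * s := by unfold blockTop at ha hb; omega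
  have hblock : ∀ k, a ≤ k → k ≤ b → InBlock N s k := fun k h1 h2 => inBlock_of_mem h h1 h2
  -- In the virial identity the energy supplies Gρ/9, the cross terms telescope to at most 20G over
  -- the block, and the drift is at most (14/N)(35G/ρ) = 490Gρ/s because ρ²N = s.
  have hterm : ∀ k ∈ Finset.Ico (a + 1) (b + 1),
      (G * ρ / 9 - 490 * G * ρ / s) - (gCross N k - gCross N (k - 1)) ≤
        (4 - gDiag N k ^ 2) * (gWeighted N k * gWeighted N (k - 1)) := by
    intro k hk
    have hk' := Finset.mem_Ico.1 hk
    have hkb := hblock k (by omega) (by omega)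
    have hz := h.inZone hkb
    have hk10 := hz.ten_le h.scale
    obtain ⟨-, -, -, -, hx1⟩ := block_amplitude h hkb
    obtain ⟨hE, -, -, hc⟩ := block_energy h hkb
    have hδ := hz.gStep_le h.scale
    have hδ0 := hz.gStep_nonneg h.scale
    rw [virial_identity (by omega)]
    have hE0 : 0 ≤ G * ρ / 9 := by positivity
    have e1 : G * ρ / 9 ≤ gDiag N k * gEnergy N k := by nlinarith
    have e2 : gStep N k * gWeighted N (k - 1) ^ 2 ≤ 490 * G * ρ / s := by
      calc gStep N k * gWeighted N (k - 1) ^ 2 ≤ (14 / N) * (35 * G / ρ) := by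
            gcongr
            rwa [le_div_iff₀ hN]
        _ = 490 * G * ρ / (ρ ^ 2 * N) := by field_simp; ring
        _ = _ := by rw [hw2]
    linarith
  have hsum := Finset.sum_le_sum hterm
  rw [Finset.sum_sub_distrib, sum_Ico_sub_pred _ hab, Finset.sum_const, Nat.card_Ico, nsmul_eq_mul,
    show b + 1 - (a + 1) = 2 * s by omega] at hsum
  have q1 := abs_le.1 (block_energy h (hblock a le_rfl hab)).2.1
  have q2 := abs_le.1 (block_energy h (hblock b hab le_rfl)).2.1
  refine le_trans ?_ hsum
  have hs0 : (0 : ℝ) < s := by linarith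
  have e3 : ((2 * s : ℕ) : ℝ) * (G * ρ / 9 - 490 * G * ρ / s) = 2 / 9 * (G * ρ * s) - 980 * (G * ρ) := by
    push_cast; field_simp; ring
  rw [e3]
  have e4 : G * 10 ^ 9 ≤ G * ρ * s := by rw [mul_assoc]; gcongr
  have e5 : G * ρ * 10 ^ 6 ≤ G * ρ * s := by gcongr
  have : 0 ≤ G * ρ := by positivity
  linarith

/-- The sum of the pairwise minima over a block. -/
theorem block_sum_min (h : BlockScale N S s) :
    s * √(35 * gInv N N / blockWidth N s) / 2800 ≤
      ∑ j ∈ Finset.Ico (blockTop N - 2 * s) (blockTop N - s),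
        min |gWeighted N (2 * j)| |gWeighted N (2 * j + 1)| := by
  have hw := h.width_pos
  have hwl := h.width_le
  have hle := h.le
  have hs := h.sR
  have hG := gInv_nonneg h.scale h.scale.center
  have hv := block_virial h
  rw [sum_Ico_pairs _ (by omega)] at hv
  set G := gInv N N
  set ρ := blockWidth N s
  set A := √(35 * G / ρ) with hA
  have hA2 : A ^ 2 = 35 * G / ρ := Real.sq_sqrt (by positivity)
  have hA0 : 0 ≤ A := Real.sqrt_nonneg _
  set F := Finset.Ico (blockTop N - 2 * s) (blockTop N - s) with hF
  have hcard : (F.card : ℝ) = s := by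
    rw [hF, Nat.card_Ico]
    unfold blockTop
    congr 1
    omega
  have hterm : ∀ j ∈ F,
      (4 - gDiag N (2 * j + 1) ^ 2) * (gWeighted N (2 * j + 1) * gWeighted N (2 * j + 1 - 1)) +
        (4 - gDiag N (2 * j + 2) ^ 2) * (gWeighted N (2 * j + 2) * gWeighted N (2 * j + 2 - 1)) ≤
      4 * ρ ^ 2 * (2 * (A * min |gWeighted N (2 * j)| |gWeighted N (2 * j + 1)|) + 10 * G) := by
    intro j hj
    have hj' := Finset.mem_Ico.1 hj
    have hb1 := inBlock_of_mem h (k := 2 * j + 1) (by omega) (by omega)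
    have hb2 := inBlock_of_mem h (k := 2 * j + 2) (by omega) (by omega)
    obtain ⟨-, -, d1, d2, -⟩ := block_amplitude h hb1
    obtain ⟨-, -, d3, d4, -⟩ := block_amplitude h hb2
    obtain ⟨-, hQ, w1, w2⟩ := block_energy h hb1
    have hmul := gWeighted_mul_succ (N := N) (k := 2 * j + 1) (by omega)
    rw [show 2 * j + 2 - 1 = 2 * j + 1 by omega, show 2 * j + 2 = 2 * j + 1 + 1 by ring, hmul]
    rw [show 2 * j + 1 - 1 = 2 * j by omega] at w2 ⊢
    have a1 : |gWeighted N (2 * j + 1)| ≤ A := abs_le_of_sq_le_sq (w1.trans hA2.ge) hA0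
    have a2 : |gWeighted N (2 * j)| ≤ A := abs_le_of_sq_le_sq (w2.trans hA2.ge) hA0
    -- A bounds both factors, so their product is at most A times the smaller one; thus a lower
    -- bound on products becomes one on minima.
    have hP : gWeighted N (2 * j + 1) * gWeighted N (2 * j) ≤
        A * min |gWeighted N (2 * j)| |gWeighted N (2 * j + 1)| := by
      refine (le_abs_self _).trans ?_
      rw [abs_mul]
      rcases min_choice |gWeighted N (2 * j)| |gWeighted N (2 * j + 1)| with hc | hc
      · rw [hc]; gcongr
      · rw [hc, mul_comm]; gcongr
    have hM0 : 0 ≤ A * min |gWeighted N (2 * j)| |gWeighted N (2 * j + 1)| := by positivity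
    set M := A * min |gWeighted N (2 * j)| |gWeighted N (2 * j + 1)|
    have hQ' := (abs_le.1 hQ).2
    rw [show 2 * j + 2 = 2 * j + 1 + 1 by ring] at d3 d4
    have t1 := mul_le_mul_of_nonneg_left hP d2
    have t2 := mul_le_mul_of_nonneg_left (add_le_add hP hQ') d4
    have t3 := mul_le_mul_of_nonneg_right d1 hM0
    have t4 := mul_le_mul_of_nonneg_right d3 (by linarith : 0 ≤ M + 10 * G)
    linarith
  have hsum := hv.trans (Finset.sum_le_sum hterm)
  rw [← Finset.mul_sum, Finset.sum_add_distrib, ← Finset.mul_sum, ← Finset.mul_sum,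
    Finset.sum_const, nsmul_eq_mul, hcard] at hsum
  set M := ∑ j ∈ F, min |gWeighted N (2 * j)| |gWeighted N (2 * j + 1)|
  -- The cross terms contribute at most 40ρ²Gs, negligible against Gρs/5 since ρ ≤ 1/1000; one
  -- factor ρ is then cancelled.
  have h1 : G * s / 80 ≤ ρ * (A * M) := by
    have e1 : ρ * (G * s / 5) ≤ ρ * (4 * ρ * (2 * (A * M) + s * (10 * G))) := by linarith
    have e2 := le_of_mul_le_mul_left e1 hw
    have e3 : 0 ≤ G * s := by positivity
    have e4 : ρ * (G * s) ≤ 1 / 1000 * (G * s) := by gcongr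
    linarith
  have h2 : A ^ 2 * ρ = 35 * G := by rw [hA2]; field_simp
  rcases hA0.eq_or_lt with hA' | hA'
  · rw [← hA']
    have : 0 ≤ M := Finset.sum_nonneg fun j _ => by positivity
    simpa using this
  · have e1 : (A * ρ) * (s * A / 2800) ≤ (A * ρ) * M := by
      calc (A * ρ) * (s * A / 2800) = (A ^ 2 * ρ) * s / 2800 := by ring
        _ = G * s / 80 := by rw [h2]; ring
        _ ≤ _ := h1
        _ = _ := by ring
    exact le_of_mul_le_mul_left e1 (by positivity)

theorem pairedMin_gFun (p : ℝ) (N j : ℕ) :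
    pairedMin p (taylorCoeff (gFun N)) j =
      min (|gCoeff N (2 * j)| ^ p) (|gCoeff N (2 * j + 1)| ^ p) := by
  simp only [pairedMin, norm_taylorCoeff_gFun]

theorem pairedMin_gFun_nonneg (p : ℝ) (N j : ℕ) : 0 ≤ pairedMin p (taylorCoeff (gFun N)) j := by
  rw [pairedMin_gFun]; positivity

theorem min_rpow_eq {x y p : ℝ} (hx : 0 ≤ x) (hy : 0 ≤ y) (hp : 0 ≤ p) :
    min (x ^ p) (y ^ p) = min x y ^ p := by
  rcases le_total x y with h | h
  · rw [min_eq_left h, min_eq_left (Real.rpow_le_rpow hx h hp)]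
  · rw [min_eq_right h, min_eq_right (Real.rpow_le_rpow hy h hp)]

/-- Lower bound for the paired sum over a block. -/
theorem exists_block_lower {p : ℝ} (hp : 2 ≤ p) : ∃ c : ℝ, 0 < c ∧ ∀ N S s : ℕ,
    BlockScale N S s → c * (s * (N * s : ℝ) ^ (-(p / 4))) ≤
      ∑ j ∈ Finset.Ico (blockTop N - 2 * s) (blockTop N - s),
        pairedMin p (taylorCoeff (gFun N)) j := by
  have hO := outerConst_pos
  -- Here 8400 = 3 · 2800 combines the index bound k ≤ 3N with the constant of `block_sum_min`, and
  -- 6000 + 10·`outerConst` comes from `one_le_gNormal`.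
  set ν : ℝ := 35 / (6000 + 10 * outerConst) / 8400 ^ 2 with hν
  have hν0 : 0 < ν := by positivity
  refine ⟨ν ^ (p / 2), by positivity, fun N S s h => ?_⟩
  have hN := h.scale.posR
  have hw := h.width_pos
  have hw2 := h.width_sq
  have hle := h.le
  have hs := h.sR
  have hs0 : (0 : ℝ) < s := by linarith
  have hm := block_sum_min h
  have hR := one_le_gNormal h.scale
  have hG : gInv N N = gNormal N * N := by unfold gNormal; field_simp
  have hG0 := gInv_nonneg h.scale h.scale.center
  set A := √(35 * gInv N N / blockWidth N s) with hA
  have hA2 : A ^ 2 = 35 * gInv N N / blockWidth N s := Real.sq_sqrt (by positivity)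
  have hA0 : 0 ≤ A := Real.sqrt_nonneg _
  set F := Finset.Ico (blockTop N - 2 * s) (blockTop N - s) with hF
  have hcard : (F.card : ℝ) = s := by
    rw [hF, Nat.card_Ico]
    unfold blockTop
    congr 1
    omega
  -- The power mean inequality passes from the sum of the minima to the sum of their p-th powers
  -- without losing the order of magnitude, since the mean is of maximal order.
  have hpm := Real.rpow_sum_le_const_mul_sum_rpow_of_nonneg (s := F) (p := p) (by linarith)
    (f := fun j => min |gWeighted N (2 * j)| |gWeighted N (2 * j + 1)|)
    (fun j _ => by positivity)
  rw [hcard] at hpm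
  set M := ∑ j ∈ F, min |gWeighted N (2 * j)| |gWeighted N (2 * j + 1)| ^ p
  have hM : s * (A / 2800) ^ p ≤ M := by
    have e1 : (s * (A / 2800)) ^ p ≤ (s : ℝ) ^ (p - 1) * M := by
      refine le_trans ?_ hpm
      refine Real.rpow_le_rpow (by positivity) ?_ (by linarith)
      linarith
    rw [Real.mul_rpow hs0.le (by positivity)] at e1
    have e2 : (s : ℝ) ^ p = (s : ℝ) ^ (p - 1) * s := by
      rw [Real.rpow_sub_one hs0.ne']; field_simp
    rw [e2, mul_assoc] at e1
    exact le_of_mul_le_mul_left e1 (by positivity)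
  have hterm : ∀ j ∈ F, (1 / (3 * N : ℝ)) ^ p * min |gWeighted N (2 * j)| |gWeighted N (2 * j + 1)| ^ p ≤
      pairedMin p (taylorCoeff (gFun N)) j := by
    intro j hj
    have hj' := Finset.mem_Ico.1 hj
    have hb1 := inBlock_of_mem h (k := 2 * j + 1) (by omega) (by omega)
    have hjN : 2 * j + 1 ≤ 3 * N := by have := hb1.upper; omega
    have key : ∀ k : ℕ, k ≤ 3 * N → 1 / (3 * N : ℝ) * |gWeighted N k| ≤ |gCoeff N k| := by
      intro k hk
      have hkR : (k : ℝ) ≤ 3 * N := by exact_mod_cast hk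
      unfold gWeighted
      rw [abs_mul, Nat.abs_cast, ← mul_assoc, one_div_mul_eq_div]
      exact mul_le_of_le_one_left (abs_nonneg _) (by rw [div_le_one (by positivity)]; exact hkR)
    rw [pairedMin_gFun, min_rpow_eq (abs_nonneg _) (abs_nonneg _) (by linarith),
      ← Real.mul_rpow (by positivity) (by positivity)]
    refine Real.rpow_le_rpow (by positivity) ?_ (by linarith)
    rw [mul_min_of_nonneg _ _ (by positivity)]
    exact min_le_min (key _ (by omega)) (key _ hjN)
  refine le_trans ?_ (Finset.sum_le_sum hterm)
  rw [← Finset.mul_sum]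
  calc ν ^ (p / 2) * (s * (N * s : ℝ) ^ (-(p / 4)))
      ≤ (1 / (3 * N : ℝ)) ^ p * (s * (A / 2800) ^ p) := by
        have hsq : (N * s : ℝ) ^ (-(1 / 2) : ℝ) = 1 / (N * blockWidth N s) := by
          have e : (N * s : ℝ) = (N * blockWidth N s) ^ 2 := by rw [← hw2]; ring
          rw [e, ← Real.rpow_natCast, ← Real.rpow_mul (by positivity),
            show ((2 : ℕ) : ℝ) * -(1 / 2) = -1 by norm_num, Real.rpow_neg_one, one_div]
        have hB : ν * (N * s : ℝ) ^ (-(1 / 2) : ℝ) ≤ (1 / (3 * N) * (A / 2800)) ^ 2 := by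
          have e2 : (1 / (3 * N) * (A / 2800)) ^ 2 =
              35 * gNormal N / 8400 ^ 2 * (1 / (N * blockWidth N s)) := by
            rw [mul_pow, div_pow A, hA2, hG]
            field_simp
            ring
          rw [hsq, e2]
          gcongr
          rw [hν]
          gcongr
          rw [div_le_iff₀ (by positivity)]
          linarith
        have hB2 := Real.rpow_le_rpow (by positivity) hB (by linarith : 0 ≤ p / 2)
        rw [Real.mul_rpow hν0.le (by positivity), ← Real.rpow_mul (by positivity),
          ← Real.rpow_natCast, ← Real.rpow_mul (by positivity),
          show -(1 / 2) * (p / 2) = -(p / 4) by ring,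
          show ((2 : ℕ) : ℝ) * (p / 2) = p by push_cast; ring,
          Real.mul_rpow (x := 1 / (3 * N : ℝ)) (by positivity) (by positivity)] at hB2
        have := mul_le_mul_of_nonneg_left hB2 hs0.le
        linarith
    _ ≤ _ := by gcongr

/-- Lower bound for the paired sums. -/
theorem exists_uPow_le_sum {p : ℝ} (hp : 2 ≤ p) : ∃ c : ℝ, 0 < c ∧ ∀ N S : ℕ, 10 ^ 40 ≤ N →
    EdgeScale N S → ∃ F : Finset ℕ,
      c * uPow p N ≤ ∑ j ∈ F, pairedMin p (taylorCoeff (gFun N)) j := by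
  obtain ⟨c, hc, hblock⟩ := exists_block_lower hp
  rcases lt_trichotomy p 4 with hp4 | hp4 | hp4
  -- For p < 4 the bulk dominates: one block with s = ⌊N/10⁶⌋, the largest admissible.
  · refine ⟨c * (1 / (2 * 10 ^ 6)), by positivity, fun N S hNl h => ?_⟩
    have hN := h.posR
    have hb : BlockScale N S (N / 10 ^ 6) :=
      ⟨h, (Nat.le_div_iff_mul_le (by norm_num)).2 (by have := h.leNat; linarith),
        Nat.mul_div_le _ _⟩
    refine ⟨_, le_trans ?_ (hblock N S _ hb)⟩
    have hu : uPow p N = (N : ℝ) ^ (1 - p / 2) := if_pos hp4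
    rw [hu, mul_assoc]
    refine mul_le_mul_of_nonneg_left ?_ hc.le
    have hsl : (N : ℝ) / (2 * 10 ^ 6) ≤ ((N / 10 ^ 6 : ℕ) : ℝ) := by
      have h1 : N ≤ 2 * 10 ^ 6 * (N / 10 ^ 6) := by omega
      have h2 : (N : ℝ) ≤ 2 * 10 ^ 6 * ((N / 10 ^ 6 : ℕ) : ℝ) := by exact_mod_cast h1
      rw [div_le_iff₀ (by norm_num)]
      linarith
    have hsu : ((N / 10 ^ 6 : ℕ) : ℝ) ≤ N := by exact_mod_cast Nat.div_le_self _ _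
    have hs0 : (0 : ℝ) < ((N / 10 ^ 6 : ℕ) : ℝ) := lt_of_lt_of_le (by positivity) hsl
    calc 1 / (2 * 10 ^ 6) * (N : ℝ) ^ (1 - p / 2)
        = (N : ℝ) / (2 * 10 ^ 6) * (N * N : ℝ) ^ (-(p / 4)) := by
          rw [Real.mul_rpow hN.le hN.le, ← Real.rpow_add hN,
            show 1 - p / 2 = 1 + (-(p / 4) + -(p / 4)) by ring, Real.rpow_add hN, Real.rpow_one]
          ring
      _ ≤ _ := by
          gcongr ?_ * ?_
          exact Real.rpow_le_rpow_of_nonpos (by positivity) (by gcongr) (by linarith)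
  · subst hp4
    refine ⟨c / 8, by positivity, fun N S hNl h => ?_⟩
    have hN := h.posR
    have hN40 : (10 : ℝ) ^ 40 ≤ N := by exact_mod_cast hNl
    have hN1 : (1 : ℝ) ≤ N := by exact_mod_cast h.pos
    have hlog8 : 8 ≤ Real.log N := by
      rw [Real.le_log_iff_exp_le hN]
      calc Real.exp 8 = Real.exp 1 ^ 8 := by rw [← Real.exp_nat_mul]; norm_num
        _ ≤ 3 ^ 8 := by gcongr; exact Real.exp_one_lt_three.le
        _ ≤ 10 ^ 40 := by norm_num
        _ ≤ N := hN40
    set n := ⌊Real.log N / 4⌋₊ with hn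
    have hn1 : Real.log N / 8 ≤ n := by
      have := Nat.lt_floor_add_one (Real.log N / 4)
      rw [← hn] at this
      linarith
    have hn2 : (n : ℝ) ≤ Real.log N / 4 := Nat.floor_le (by linarith)
    have hpow : (2 : ℝ) ^ n ≤ (N : ℝ) ^ (1 / 4 : ℝ) := by
      calc (2 : ℝ) ^ n ≤ Real.exp 1 ^ n := by
            gcongr
            linarith [Real.add_one_le_exp 1]
        _ = Real.exp n := by rw [← Real.exp_nat_mul, mul_one]
        _ ≤ Real.exp (Real.log N * (1 / 4)) := Real.exp_le_exp.2 (by linarith)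
        _ = _ := by rw [Real.rpow_def_of_pos hN]
    have hscale : ∀ i, i < n → BlockScale N S (S * 2 ^ i) := by
      intro i hi
      refine ⟨h, Nat.le_mul_of_pos_right _ (by positivity), ?_⟩
      have : (10 : ℝ) ^ 6 * (S * 2 ^ i) ≤ N := by
        calc (10 : ℝ) ^ 6 * (S * 2 ^ i)
            ≤ 10 ^ 6 * ((10 ^ 7 * (N : ℝ) ^ (1 / 3 : ℝ)) * (N : ℝ) ^ (1 / 4 : ℝ)) := by
              gcongr
              · exact h.le_cbrt
              · refine le_trans ?_ hpow
                gcongr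
                norm_num
          _ = 10 ^ 13 * ((N : ℝ) ^ (1 / 3 : ℝ) * (N : ℝ) ^ (1 / 4 : ℝ)) := by ring
          _ ≤ (N : ℝ) ^ (5 / 12 : ℝ) * ((N : ℝ) ^ (1 / 3 : ℝ) * (N : ℝ) ^ (1 / 4 : ℝ)) := by
              gcongr
              calc (10 : ℝ) ^ 13 ≤ ((10 : ℝ) ^ 40) ^ (5 / 12 : ℝ) := by
                    rw [← Real.rpow_natCast 10 40, ← Real.rpow_mul (by norm_num),
                      ← Real.rpow_natCast 10 13]
                    exact Real.rpow_le_rpow_of_exponent_le (by norm_num) (by norm_num)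
                _ ≤ _ := by gcongr
          _ = N := by
              rw [← Real.rpow_add hN, ← Real.rpow_add hN]
              norm_num
      exact_mod_cast this
    -- The block for s occupies the indices from J - 2s to J - s, so doubling s produces adjacent
    -- disjoint intervals.
    have hind : ∀ m, m ≤ n → m * (c * (N : ℝ)⁻¹) ≤
        ∑ j ∈ Finset.Ico (blockTop N - S * 2 ^ m) (blockTop N - S),
          pairedMin 4 (taylorCoeff (gFun N)) j := by
      intro m
      induction m with
      | zero => simp
      | succ m ih =>
        intro hm
        have hb := hscale m (by omega)
        have h1 := hblock N S _ hb
        have h2 := ih (by omega)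
        have hs : (0 : ℝ) < ((S * 2 ^ m : ℕ) : ℝ) := by
          have := hb.sR
          linarith
        have e : c * ((S * 2 ^ m : ℕ) * (N * (S * 2 ^ m : ℕ) : ℝ) ^ (-(4 / 4) : ℝ)) =
            c * (N : ℝ)⁻¹ := by
          rw [show (-(4 / 4) : ℝ) = -1 by norm_num, Real.rpow_neg_one]
          field_simp
        rw [e, show 2 * (S * 2 ^ m) = S * 2 ^ (m + 1) by ring] at h1
        rw [← Finset.sum_Ico_consecutive _ (n := blockTop N - S * 2 ^ m)]
        · push_cast
          linarith
        · have : S * 2 ^ m ≤ S * 2 ^ (m + 1) := by gcongr <;> omega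
          omega
        · have := Nat.le_mul_of_pos_right S (show 0 < 2 ^ m by positivity)
          omega
    refine ⟨_, le_trans ?_ (hind n le_rfl)⟩
    have hu : uPow 4 N = Real.log N * (N : ℝ) ^ (-1 : ℝ) := by simp [uPow]
    rw [hu, Real.rpow_neg_one]
    have : 0 < c * (N : ℝ)⁻¹ := by positivity
    nlinarith
  -- For p > 4 the edge dominates: one block with s = S, the smallest admissible.
  · refine ⟨c * (10 ^ 7) ^ (1 - p / 4), by positivity, fun N S hNl h => ?_⟩
    have hN := h.posR
    have hS := h.posS
    refine ⟨_, le_trans ?_ (hblock N S S ⟨h, le_rfl, h.leNat⟩)⟩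
    have hu : uPow p N = (N : ℝ) ^ (1 / 3 - p / 3) := by
      rw [uPow, if_neg (by linarith), if_neg (by linarith)]
    rw [hu, mul_assoc]
    refine mul_le_mul_of_nonneg_left ?_ hc.le
    have h1 := h.le_rpow (t := 1 - p / 4) (by linarith)
    calc (10 ^ 7) ^ (1 - p / 4) * (N : ℝ) ^ (1 / 3 - p / 3)
        = (N : ℝ) ^ (-(p / 4)) * ((10 ^ 7) ^ (1 - p / 4) * (N : ℝ) ^ ((1 - p / 4) / 3)) := by
          rw [show 1 / 3 - p / 3 = -(p / 4) + (1 - p / 4) / 3 by ring, Real.rpow_add hN]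
          ring
      _ ≤ (N : ℝ) ^ (-(p / 4)) * (S : ℝ) ^ (1 - p / 4) := by gcongr
      _ = _ := by
          rw [Real.mul_rpow hN.le hS.le, sub_eq_add_neg, Real.rpow_add hS, Real.rpow_one]
          ring

end Blocks

/-! ### Finitely many small N, positivity, and assembly of the theorem. -/

/-- Descending induction on the threshold: each additional index only forces the constants to
include one more positive ratio f/g. -/
theorem ComparableFrom.of_eventually {N₀ : ℕ} {f g : ℕ → ℝ} (hf : ∀ N, N₀ ≤ N → 0 < f N)
    (hg : ∀ N, N₀ ≤ N → 0 < g N) (N₁ : ℕ) (h : ComparableFrom N₁ f g) : ComparableFrom N₀ f g := by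
  induction N₁ with
  | zero =>
    obtain ⟨c, C, hc, hC, H⟩ := h
    exact ⟨c, C, hc, hC, fun N _ => H N (Nat.zero_le N)⟩
  | succ M ih =>
    obtain ⟨c, C, hc, hC, H⟩ := h
    by_cases hM : N₀ ≤ M
    · have hfM := hf M hM
      have hgM := hg M hM
      refine ih ⟨min c (f M / g M), max C (f M / g M), by positivity, by positivity,
        fun N hN => ?_⟩
      rcases hN.eq_or_lt with rfl | hlt
      · constructor
        · calc min c (f M / g M) * g M ≤ f M / g M * g M := by gcongr; exact min_le_right _ _
            _ = f M := by field_simp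
        · calc f M = f M / g M * g M := by field_simp
            _ ≤ max C (f M / g M) * g M := by gcongr; exact le_max_right _ _
      · have hgN := hg N (by omega)
        obtain ⟨h1, h2⟩ := H N hlt
        constructor
        · refine le_trans ?_ h1
          gcongr
          exact min_le_left _ _
        · refine h2.trans ?_
          gcongr
          exact le_max_left _ _
    · exact ⟨c, C, hc, hC, fun N hN => H N (by omega)⟩

theorem gCoeff_sq_le_one (N k : ℕ) : gCoeff N k ^ 2 ≤ 1 :=
  le_hasSum (hasSum_gCoeff_sq N) k fun _ _ => sq_nonneg _

theorem abs_gCoeff_le_one (N k : ℕ) : |gCoeff N k| ≤ 1 :=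
  abs_le_of_sq_le_sq (by simpa using gCoeff_sq_le_one N k) zero_le_one

theorem summable_abs_gCoeff_rpow {p : ℝ} (hp : 2 ≤ p) (N : ℕ) :
    Summable fun k => |gCoeff N k| ^ p := by
  refine Summable.of_nonneg_of_le (fun k => by positivity) (fun k => ?_)
    (hasSum_gCoeff_sq N).summable
  rw [← sq_abs, ← Real.rpow_two]
  exact Real.rpow_le_rpow_of_exponent_ge_of_imp (abs_nonneg _) (abs_gCoeff_le_one N k) hp
    (fun _ h => by linarith)

theorem pairedMin_gFun_le (p : ℝ) (N j : ℕ) :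
    pairedMin p (taylorCoeff (gFun N)) j ≤ |gCoeff N (2 * j)| ^ p := by
  rw [pairedMin_gFun]; exact min_le_left _ _

theorem summable_pairedMin_gFun {p : ℝ} (hp : 2 ≤ p) (N : ℕ) :
    Summable (pairedMin p (taylorCoeff (gFun N))) :=
  Summable.of_nonneg_of_le (pairedMin_gFun_nonneg p N) (pairedMin_gFun_le p N)
    ((summable_abs_gCoeff_rpow hp N).comp_injective (mul_right_injective₀ (two_ne_zero (α := ℕ))))

theorem tsum_pairedMin_le {p : ℝ} (hp : 2 ≤ p) (N : ℕ) :
    ∑' j, pairedMin p (taylorCoeff (gFun N)) j ≤ ∑' k, |gCoeff N k| ^ p := by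
  have hinj : Function.Injective fun j : ℕ => 2 * j := mul_right_injective₀ (two_ne_zero (α := ℕ))
  refine ((summable_pairedMin_gFun hp N).tsum_le_tsum (pairedMin_gFun_le p N)
    ((summable_abs_gCoeff_rpow hp N).comp_injective hinj)).trans ?_
  exact tsum_comp_le_tsum_of_inj (summable_abs_gCoeff_rpow hp N) (fun _ => by positivity) hinj

theorem gWeighted_one_eq_zero_of_consecutive {N k : ℕ} (h1 : gWeighted N k = 0)
    (h2 : gWeighted N (k + 1) = 0) : gWeighted N 1 = 0 := by
  induction k with
  | zero => exact h2
  | succ k ih =>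
    have h := gWeighted_rec N k
    rw [h1, h2, zero_add, mul_zero] at h
    exact ih h h1

/-- Beyond the turning point a zero would propagate forward by monotonicity. Two consecutive zeros
propagate backward to c_1 = -(3N/2) a_0, which is not zero. -/
theorem gWeighted_ne_zero {N k : ℕ} (hN : 0 < N) (hk : 3 * N ≤ k) : gWeighted N k ≠ 0 := by
  intro h0
  have hN' : (0 : ℝ) < N := by exact_mod_cast hN
  have hdec := (recessive_bounds (c := gWeighted N) (η := fun k => gDiag N k - 2) (m := 3 * N - 1)
    (fun k _ => by rw [gWeighted_rec]; ring)
    (fun k hk => by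
      have h1 : 3 * (N : ℝ) ≤ k := by exact_mod_cast (by omega : 3 * N ≤ k)
      have h2 : (0 : ℝ) < k := by linarith
      show 0 ≤ gDiag N k - 2
      unfold gDiag
      have : 3 * (N : ℝ) / (2 * k) ≤ 1 / 2 := by
        rw [div_le_iff₀ (by positivity)]; linarith
      linarith)
    (tendsto_mul_gCoeff N)).1 k (by omega)
  rw [h0, abs_zero] at hdec
  have h1 := gWeighted_one_eq_zero_of_consecutive h0 (abs_nonpos_iff.1 hdec)
  rw [gWeighted, Nat.cast_one, one_mul, gCoeff_one] at h1
  exact mul_ne_zero (by simp [hN.ne']) (gCoeff_zero_ne_zero N) h1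

theorem gCoeff_ne_zero {N k : ℕ} (hN : 0 < N) (hk : 3 * N ≤ k) : gCoeff N k ≠ 0 := by
  have h := gWeighted_ne_zero hN hk
  exact fun h0 => h (by rw [gWeighted, h0, mul_zero])

/-- The pair with index 2N consists of the coefficients 4N and 4N + 1, both beyond the turning point
and hence nonzero. -/
theorem tsum_pairedMin_pos {p : ℝ} (hp : 2 ≤ p) {N : ℕ} (hN : 0 < N) :
    0 < ∑' j, pairedMin p (taylorCoeff (gFun N)) j := by
  refine (summable_pairedMin_gFun hp N).tsum_pos (pairedMin_gFun_nonneg p N) (2 * N) ?_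
  rw [pairedMin_gFun]
  have h1 := abs_pos.2 (gCoeff_ne_zero (N := N) (k := 2 * (2 * N)) hN (by omega))
  have h2 := abs_pos.2 (gCoeff_ne_zero (N := N) (k := 2 * (2 * N) + 1) hN (by omega))
  positivity

theorem seqNorm_gFun (p : ℝ) (N : ℕ) :
    seqNorm p (taylorCoeff (gFun N)) = (∑' k, |gCoeff N k| ^ p) ^ (1 / p) := by
  simp only [seqNorm, norm_taylorCoeff_gFun]

theorem pairedNorm_le_seqNorm {p : ℝ} (hp : 2 ≤ p) (N : ℕ) :
    pairedNorm p (taylorCoeff (gFun N)) ≤ seqNorm p (taylorCoeff (gFun N)) := by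
  rw [seqNorm_gFun]
  exact Real.rpow_le_rpow (tsum_nonneg (pairedMin_gFun_nonneg p N)) (tsum_pairedMin_le hp N)
    (by positivity)

theorem pairedNorm_pos {p : ℝ} (hp : 2 ≤ p) {N : ℕ} (hN : 0 < N) :
    0 < pairedNorm p (taylorCoeff (gFun N)) :=
  Real.rpow_pos_of_pos (tsum_pairedMin_pos hp hN) _

/-- Two-sided bounds for the norms for large `N`. -/
theorem exists_norm_bounds {p : ℝ} (hp : 2 ≤ p) : ∃ c C : ℝ, 0 < c ∧ 0 < C ∧
    ∀ N : ℕ, 10 ^ 40 ≤ N → c * uFun p N ≤ pairedNorm p (taylorCoeff (gFun N)) ∧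
      seqNorm p (taylorCoeff (gFun N)) ≤ C * uFun p N := by
  obtain ⟨C, hC, hup⟩ := exists_sum_le_uPow hp
  obtain ⟨c, hc, hlow⟩ := exists_uPow_le_sum hp
  have hp0 : 0 < p := by linarith
  refine ⟨c ^ (1 / p), C ^ (1 / p), by positivity, by positivity, fun N hN => ?_⟩
  have hN10 : 10 ≤ N := by omega
  obtain ⟨S, hS⟩ := exists_edgeScale (N := N) (by omega)
  have hu := uFun_pos p hN10
  have hroot : ∀ a : ℝ, 0 < a → (a * uPow p N) ^ (1 / p) = a ^ (1 / p) * uFun p N := by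
    intro a ha
    rw [← uFun_rpow hp0 hN10, Real.mul_rpow ha.le (by positivity), ← Real.rpow_mul hu.le,
      mul_one_div_cancel hp0.ne', Real.rpow_one]
  have hpw := uPow_pos p hN10
  constructor
  · obtain ⟨F, hF⟩ := hlow N S hN hS
    rw [← hroot c hc, pairedNorm]
    refine Real.rpow_le_rpow (by positivity) (hF.trans ?_) (by positivity)
    exact (summable_pairedMin_gFun hp N).sum_le_tsum F fun j _ => pairedMin_gFun_nonneg p N j
  · rw [← hroot C hC, seqNorm_gFun]
    refine Real.rpow_le_rpow (tsum_nonneg fun k => by positivity) ?_ (by positivity)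
    exact (summable_abs_gCoeff_rpow hp N).tsum_le_of_sum_le (hup N S hS)

theorem comparable_seqNorm_uFun {p : ℝ} (hp : 2 ≤ p) :
    ComparableFrom 10 (fun N => seqNorm p (taylorCoeff (gFun N))) (uFun p) := by
  obtain ⟨c, C, hc, hC, H⟩ := exists_norm_bounds hp
  refine ComparableFrom.of_eventually (fun N hN => ?_) (fun N hN => uFun_pos p hN) (10 ^ 40)
    ⟨c, C, hc, hC, fun N hN => ⟨(H N hN).1.trans (pairedNorm_le_seqNorm hp N), (H N hN).2⟩⟩
  exact lt_of_lt_of_le (pairedNorm_pos hp (by omega)) (pairedNorm_le_seqNorm hp N)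

theorem comparable_pairedNorm_seqNorm {p : ℝ} (hp : 2 ≤ p) :
    ComparableFrom 10 (fun N => pairedNorm p (taylorCoeff (gFun N)))
      (fun N => seqNorm p (taylorCoeff (gFun N))) := by
  obtain ⟨c, C, hc, hC, H⟩ := exists_norm_bounds hp
  refine ComparableFrom.of_eventually (fun N hN => pairedNorm_pos hp (by omega)) (fun N hN => ?_)
    (10 ^ 40) ⟨c / C, 1, by positivity, one_pos, fun N hN => ⟨?_, ?_⟩⟩
  · exact lt_of_lt_of_le (pairedNorm_pos hp (by omega)) (pairedNorm_le_seqNorm hp N)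
  · obtain ⟨h1, h2⟩ := H N hN
    calc c / C * seqNorm p (taylorCoeff (gFun N)) ≤ c / C * (C * uFun p N) := by gcongr
      _ = c * uFun p N := by field_simp
      _ ≤ _ := h1
  · rw [one_mul]; exact pairedNorm_le_seqNorm hp N

theorem exists_seqSupNorm_le : ∃ C : ℝ, 0 < C ∧ ∀ N : ℕ, 10 ≤ N →
    BddAbove (Set.range fun k => ‖taylorCoeff (gFun N) k‖) ∧
      seqSupNorm (taylorCoeff (gFun N)) ≤ C * (N : ℝ) ^ (-(1 / 3) : ℝ) := by
  have hC := coeffConst_pos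
  -- The second summand covers N < 10²⁰, where the trivial bound |a_k| ≤ 1 suffices.
  refine ⟨coeffConst ^ (1 / 2 : ℝ) + (10 ^ 20) ^ (1 / 3 : ℝ), by positivity, fun N hN => ?_⟩
  have hN0 : (0 : ℝ) < N := by exact_mod_cast (by omega : 0 < N)
  refine ⟨⟨1, ?_⟩, ciSup_le fun k => ?_⟩
  · rintro _ ⟨k, rfl⟩
    show ‖taylorCoeff (gFun N) k‖ ≤ 1
    rw [norm_taylorCoeff_gFun]
    exact abs_gCoeff_le_one N k
  · rw [norm_taylorCoeff_gFun, add_mul]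
    by_cases hl : 10 ^ 20 ≤ N
    · obtain ⟨S, hS⟩ := exists_edgeScale hl
      have := abs_gCoeff_le hS k
      have : 0 ≤ (10 ^ 20 : ℝ) ^ (1 / 3 : ℝ) * (N : ℝ) ^ (-(1 / 3) : ℝ) := by positivity
      linarith
    · have h1 := abs_gCoeff_le_one N k
      have hNl : (N : ℝ) ≤ 10 ^ 20 := by exact_mod_cast (not_le.1 hl).le
      have h2 : 1 ≤ (10 ^ 20 : ℝ) ^ (1 / 3 : ℝ) * (N : ℝ) ^ (-(1 / 3) : ℝ) := by
        rw [Real.rpow_neg hN0.le, ← div_eq_mul_inv, one_le_div (by positivity)]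
        gcongr
      have : 0 ≤ coeffConst ^ (1 / 2 : ℝ) * (N : ℝ) ^ (-(1 / 3) : ℝ) := by positivity
      linarith

theorem mainTheorem6 :
    -- (i) `g_N` is holomorphic in the unit disc and its supremum norm there is `1`
    (∀ N : ℕ, 10 ≤ N →
      DifferentiableOn ℂ (gFun N) (Metric.ball 0 1) ∧
      IsLUB ((fun z => ‖gFun N z‖) '' Metric.ball (0 : ℂ) 1) 1) ∧
    -- (ii)
    (∀ N : ℕ, 10 ≤ N → ∀ z : ℂ, ‖z‖ = 1 - 1 / (N : ℝ) →
      Real.exp (-4) ≤ ‖gFun N z‖) ∧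
    -- (iii)
    (∃ δ : ℝ, 0 < δ ∧ ∀ N : ℕ, 10 ≤ N → ∀ k : ℕ, 4 * N ≤ k →
      ‖taylorCoeff (gFun N) k‖ ≤ Real.exp (-δ * k)) ∧
    -- (iv)
    (∃ C : ℝ, 0 < C ∧ ∀ N : ℕ, 10 ≤ N →
      BddAbove (Set.range fun k => ‖taylorCoeff (gFun N) k‖) ∧
      seqSupNorm (taylorCoeff (gFun N)) ≤ C * (N : ℝ) ^ (-(1 / 3) : ℝ)) ∧
    -- (v)
    (∀ p : ℝ, 2 ≤ p →
      (∀ N : ℕ, 10 ≤ N →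
        Summable (fun k => ‖taylorCoeff (gFun N) k‖ ^ p) ∧
        Summable (pairedMin p (taylorCoeff (gFun N)))) ∧
      ComparableFrom 10 (fun N => pairedNorm p (taylorCoeff (gFun N)))
        (fun N => seqNorm p (taylorCoeff (gFun N))) ∧
      ComparableFrom 10 (fun N => seqNorm p (taylorCoeff (gFun N))) (uFun p)) := by

  refine ⟨fun N _ => ⟨(differentiableOn_gFun N).mono (Metric.ball_subset_ball one_le_two),
    gFun_isLUB N⟩, fun N hN z hz => gFun_lower_bound hN hz,
    ⟨Real.log (11 / 10) / 8, div_pos (Real.log_pos (by norm_num)) (by norm_num),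
      fun N _ k hk => taylorCoeff_exp_decay hk⟩, exists_seqSupNorm_le, fun p hp => ⟨fun N _ => ⟨?_,
      summable_pairedMin_gFun hp N⟩, comparable_pairedNorm_seqNorm hp, comparable_seqNorm_uFun hp⟩⟩
  simp only [norm_taylorCoeff_gFun]
  exact summable_abs_gCoeff_rpow hp N
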